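/- Let $n\ge 1$ and let $\langle v,w\rangle=\sum_j v_j\overline{w_j}$ on $\mathbb{C}^n$. Let $\nu$ be a nonzero finite Borel measure on $\mathbb{C}P^{n-1}$ with total mass $|\nu|$, and put $R_\nu=n/|\nu|$. Suppose that $\nu$ is supported on a complex projective variety $Y\subset\mathbb{C}P^{n-1}$ (the common zero locus of homogeneous polynomials, possibly reducible), i.e. $\nu(\mathbb{C}P^{n-1}\setminus Y)=0$, and that $\nu$ is absolutely continuous on every irreducible component $Z$ of $Y$: a Borel set $N\subset Z$ whose trace on the smooth locus of $Z$ is Lebesgue-null in holomorphic charts satisfies $\nu(N)=0$ (in particular the singular locus of $Z$ is $\nu$-null). For a positive definite Hermitian $n\times n$ matrix $G$ put $$T_\nu(G)=R_\nu\int_{\mathbb{C}P^{n-1}}\Pi_z\,\frac{|z|^2}{\langle G^{-1}z,z\rangle}\,d\nu([z]),$$ where $\Pi_z$ is the orthogonal projector onto $\mathbb{C}z$ for $\langle\cdot,\cdot\rangle$. If $G$ is a positive definite fixed point of $T_\nu$, let $q_G^*(v,w)=\langle G^{-1}v,w\rangle$, let $F_G(z)$ be the $q_G^*$-orthogonal projector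 onto $\mathbb{C}z$, let $\mathscr{L}_G$ be the real vector space of operators on $\mathbb{C}^n$ that are Hermitian for $q_G^*$, and let the associated quantum channel be $$\mathcal{E}_G:\mathscr{L}_G\to\mathscr{L}_G,\qquad \mathcal{E}_G(A)=R_\nu\int_{\mathbb{C}P^{n-1}}\mathrm{tr}\big(F_G(z)A\big)\,F_G(z)\,d\nu([z]).$$ Its spectral gap is $1-\lambda_1$, where $\lambda_0\ge\lambda_1\ge\cdots$ are the eigenvalues of $\mathcal{E}_G$ listed with multiplicity (with $\lambda_1:=0$ if $n=1$). (i) Assume that $$\frac{\nu(\Sigma)}{\dim\Sigma+1}<\frac{|\nu|}{n}$$ for every nonempty proper projective subspace $\Sigma\subsetneq\mathbb{C}P^{n-1}$. Then $T_\nu$ maps positive definite Hermitian matrices to positive definite Hermitian matrices; for every positive definite Hermitian $G_0$ the iterates $T_\nu^r(G_0)$ converge as $r\to\infty$ to a positive definite fixed point of $T_\nu$; the positive definite fixed point of $T_\nu$ is unique up to multiplication by a positive scalar; and for every positive definite fixed point $G$ the channel $\mathcal{E}_G$ has positive spectral gap. (ii) Assume in addition that some irreducible component $Z$ of $Y$ with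 $\nu(Z)>0$ is not contained in any proper projective subspace of $\mathbb{C}P^{n-1}$. Then $\mathcal{E}_G$ is invertible for every positive definite fixed point $G$ of $T_\nu$. -/

import Mathlib

open scoped LinearAlgebra.Projectivization Matrix Topology ComplexOrder
open MeasureTheory Filter

noncomputable section

namespace Donaldson

variable {n d : ℕ}

/-! ### The projective space `ℂP^{n-1}` and its subvarieties -/

/-- `ProjSpace n` is the projective space `ℂP^{n-1}` of complex lines in `ℂ^n`. -/
abbrev ProjSpace (n : ℕ) : Type := ℙ ℂ (Fin n → ℂ)

/-- The usual (quotient) topology of `ℂP^{n-1}`. -/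
instance instTopologicalSpaceProjSpace : TopologicalSpace (ProjSpace n) :=
  inferInstanceAs (TopologicalSpace (Quotient (projectivizationSetoid ℂ (Fin n → ℂ))))

instance instMeasurableSpaceProjSpace : MeasurableSpace (ProjSpace n) := borel _

instance instBorelSpaceProjSpace : BorelSpace (ProjSpace n) := ⟨rfl⟩

/-- The projective subspace `ℙ(S)` attached to a linear subspace `S` of `ℂ^n`; its dimension is
`dim S - 1`, and it is proper iff `S ≠ ⊤`, nonempty iff `S ≠ ⊥`. -/
def projSubspace (S : Submodule ℂ (Fin n → ℂ)) : Set (ProjSpace n) :=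
  {x | x.submodule ≤ S}

/-- Common zero loci in `ℂP^{n-1}` of a set of homogeneous polynomials. -/
def IsAlgebraicSet (Y : Set (ProjSpace n)) : Prop :=
  ∃ I : Set (MvPolynomial (Fin n) ℂ), (∀ p ∈ I, ∃ k : ℕ, p.IsHomogeneous k) ∧
    Y = {x | ∀ p ∈ I, MvPolynomial.eval x.rep p = 0}

/-- Irreducible projective varieties. -/
def IsIrreducibleVariety (Z : Set (ProjSpace n)) : Prop :=
  IsAlgebraicSet Z ∧ Z.Nonempty ∧
    ∀ A B : Set (ProjSpace n), IsAlgebraicSet A → IsAlgebraicSet B → Z ⊆ A ∪ B → Z ⊆ A ∨ Z ⊆ B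

/-- `Z` is an irreducible component of `Y`: a maximal irreducible variety contained in `Y`. -/
def IsComponent (Z Y : Set (ProjSpace n)) : Prop :=
  IsIrreducibleVariety Z ∧ Z ⊆ Y ∧
    ∀ Z' : Set (ProjSpace n), IsIrreducibleVariety Z' → Z' ⊆ Y → Z ⊆ Z' → Z' = Z

/-- `φ : U → ℂP^{n-1}` is a local holomorphic parametrization (inverse of a holomorphic chart) of
the smooth locus of `Z`: it is a holomorphic immersion on the open set `U ⊆ ℂ^d` (expressed
through a lift `f` to `ℂ^n ∖ {0}`), and a homeomorphism of `U` onto a relatively open subset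
of `Z`. -/
structure IsLocalParam (Z : Set (ProjSpace n)) (U : Set (Fin d → ℂ))
    (φ : (Fin d → ℂ) → ProjSpace n) : Prop where
  isOpen : IsOpen U
  immersion : ∃ f : (Fin d → ℂ) → (Fin n → ℂ), DifferentiableOn ℂ f U ∧
    (∀ u ∈ U, ∃ h : f u ≠ 0, φ u = Projectivization.mk ℂ (f u) h) ∧
    (∀ u ∈ U, ∀ w : Fin d → ℂ, (∃ c : ℂ, fderiv ℂ f u w = c • f u) → w = 0)
  injOn : Set.InjOn φ U
  image_open : ∀ V ⊆ U, IsOpen V → ∃ O : Set (ProjSpace n), IsOpen O ∧ φ '' V = O ∩ Z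

/-- `N` is Lebesgue-null in `Z`: its trace on the smooth locus of `Z`, a complex manifold, is a
null set in all holomorphic charts. In particular the singular locus of `Z` is null. -/
def IsNullIn (Z N : Set (ProjSpace n)) : Prop :=
  ∀ (d : ℕ) (U : Set (Fin d → ℂ)) (φ : (Fin d → ℂ) → ProjSpace n),
    IsLocalParam Z U φ → volume (U ∩ φ ⁻¹' N) = 0

/-- `ν` is absolutely continuous on `Z`, with respect to the Lebesgue measure class of `Z`. -/
def IsAbsContOn (ν : Measure (ProjSpace n)) (Z : Set (ProjSpace n)) : Prop :=
  ∀ N : Set (ProjSpace n), MeasurableSet N → N ⊆ Z → IsNullIn Z N → ν N = 0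

/-! ### Hermitian products and Donaldson's map -/

/-- The standard Hermitian product `⟨v, w⟩ = ∑ v_j \bar{w_j}`. -/
def herm (v w : Fin n → ℂ) : ℂ := ∑ j, v j * star (w j)

/-- The Hermitian product `q*(v, w) = ⟨G⁻¹ v, w⟩` attached to a positive matrix `G`. -/
def dualProd (G : Matrix (Fin n) (Fin n) ℂ) (v w : Fin n → ℂ) : ℂ := herm (G⁻¹ *ᵥ v) w

/-- The projector `v ↦ (q*(v, z) / q*(z, z)) z` onto the line `x = [z]`, orthogonal for
`q* = dualProd G`; see `projector_mulVec`. -/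
def projector (G : Matrix (Fin n) (Fin n) ℂ) (x : ProjSpace n) : Matrix (Fin n) (Fin n) ℂ :=
  Matrix.of fun i j => dualProd G (Pi.single j 1) x.rep / dualProd G x.rep x.rep * x.rep i

/-- The constant `R_ν = n / |ν|`. -/
def ratio (ν : Measure (ProjSpace n)) : ℝ := n / ν.real Set.univ

/-- Donaldson's map `T_ν(G) = R_ν ∫ Π_z |z|² / ⟨G⁻¹ z, z⟩ dν([z])`, where `Π_z` is the orthogonal
projector onto `z` for the standard product; the integral is taken entrywise. -/
def donaldsonMap (ν : Measure (ProjSpace n)) (G : Matrix (Fin n) (Fin n) ℂ) :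
    Matrix (Fin n) (Fin n) ℂ :=
  Matrix.of fun i j => (ratio ν : ℂ) *
    ∫ x, projector 1 x i j * (herm x.rep x.rep / herm (G⁻¹ *ᵥ x.rep) x.rep) ∂ν

/-! ### The quantum channel -/

lemma herm_add_left (u v w : Fin n → ℂ) : herm (u + v) w = herm u w + herm v w := by
  simp [herm, add_mul, Finset.sum_add_distrib]

lemma herm_smul_left (c : ℂ) (v w : Fin n → ℂ) : herm (c • v) w = c * herm v w := by
  simp [herm, Finset.mul_sum, mul_assoc]

lemma star_herm (v w : Fin n → ℂ) : star (herm v w) = herm w v := by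
  simp [herm, mul_comm]

lemma herm_eq (v w : Fin n → ℂ) : herm v w = v ⬝ᵥ star w := by
  simp [herm, dotProduct]

lemma dualProd_add_left (G : Matrix (Fin n) (Fin n) ℂ) (u v w : Fin n → ℂ) :
    dualProd G (u + v) w = dualProd G u w + dualProd G v w := by
  simp [dualProd, Matrix.mulVec_add, herm_add_left]

lemma dualProd_smul_left (G : Matrix (Fin n) (Fin n) ℂ) (c : ℂ) (v w : Fin n → ℂ) :
    dualProd G (c • v) w = c * dualProd G v w := by
  simp [dualProd, Matrix.mulVec_smul, herm_smul_left]

lemma dualProd_star {G : Matrix (Fin n) (Fin n) ℂ} (hG : G.PosDef) (v w : Fin n → ℂ) :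
    star (dualProd G v w) = dualProd G w v := by
  have h : (G⁻¹)ᴴ = G⁻¹ := hG.inv.isHermitian
  rw [dualProd, star_herm, dualProd, herm_eq, herm_eq, Matrix.star_mulVec, h,
    dotProduct_comm, ← Matrix.dotProduct_mulVec, dotProduct_comm]

lemma dualProd_add_right {G : Matrix (Fin n) (Fin n) ℂ} (u v w : Fin n → ℂ) :
    dualProd G u (v + w) = dualProd G u v + dualProd G u w := by
  simp [dualProd, herm, mul_add, Finset.sum_add_distrib]

lemma dualProd_smul_right {G : Matrix (Fin n) (Fin n) ℂ} (c : ℂ) (v w : Fin n → ℂ) :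
    dualProd G v (c • w) = star c * dualProd G v w := by
  simp [dualProd, herm, Finset.mul_sum, mul_left_comm]

lemma dualProd_self_ne {G : Matrix (Fin n) (Fin n) ℂ} (hG : G.PosDef) {v : Fin n → ℂ}
    (hv : v ≠ 0) : dualProd G v v ≠ 0 := by
  have h := hG.inv.dotProduct_mulVec_pos hv
  rw [dualProd, herm_eq, dotProduct_comm]
  exact h.ne'

lemma projector_mulVec (G : Matrix (Fin n) (Fin n) ℂ) (x : ProjSpace n) (v : Fin n → ℂ) :
    projector G x *ᵥ v = (dualProd G v x.rep / dualProd G x.rep x.rep) • x.rep := by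
  have key : dualProd G v x.rep = ∑ j, v j * dualProd G (Pi.single j 1) x.rep := by
    let L : (Fin n → ℂ) →ₗ[ℂ] ℂ :=
      { toFun := fun v => dualProd G v x.rep
        map_add' := fun a b => dualProd_add_left G a b _
        map_smul' := fun c a => dualProd_smul_left G c a _ }
    have := LinearMap.pi_apply_eq_sum_univ L v
    have e : ∀ j : Fin n, (fun k => if j = k then (1 : ℂ) else 0) = Pi.single j 1 := by
      intro j
      ext k
      simp [Pi.single_apply, eq_comm]
    simpa [L, e] using this
  ext i
  simp only [Matrix.mulVec, dotProduct, projector, Matrix.of_apply, Pi.smul_apply, smul_eq_mul]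
  rw [key, Finset.sum_div, Finset.sum_mul]
  refine Finset.sum_congr rfl fun j _ => ?_
  ring

lemma dualProd_projector {G : Matrix (Fin n) (Fin n) ℂ} (hG : G.PosDef) (x : ProjSpace n)
    (v w : Fin n → ℂ) :
    dualProd G (projector G x *ᵥ v) w = dualProd G v (projector G x *ᵥ w) := by
  rw [projector_mulVec, projector_mulVec, dualProd_smul_left, dualProd_smul_right, star_div₀,
    dualProd_star hG, dualProd_star hG]
  ring

lemma projector_mk {G : Matrix (Fin n) (Fin n) ℂ} (v : Fin n → ℂ) (hv : v ≠ 0) (i j : Fin n) :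
    projector G (Projectivization.mk ℂ v hv) i j =
      dualProd G (Pi.single j 1) v / dualProd G v v * v i := by
  obtain ⟨a, ha⟩ := Projectivization.exists_smul_eq_mk_rep ℂ v hv
  have ha' : (Projectivization.mk ℂ v hv).rep = (a : ℂ) • v := by
    rw [← ha]
    rfl
  have h0 : (a : ℂ) ≠ 0 := a.ne_zero
  have h1 : star (a : ℂ) ≠ 0 := star_ne_zero.2 h0
  simp only [projector, Matrix.of_apply, ha', dualProd_smul_left, dualProd_smul_right,
    Pi.smul_apply, smul_eq_mul]
  by_cases hd : dualProd G v v = 0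
  · simp [hd]
  · field_simp

lemma continuous_projector {G : Matrix (Fin n) (Fin n) ℂ} (hG : G.PosDef) (i j : Fin n) :
    Continuous fun x : ProjSpace n => projector G x i j := by
  have hq : Topology.IsQuotientMap
      (fun v : {v : Fin n → ℂ // v ≠ 0} => (Projectivization.mk ℂ v.1 v.2 : ProjSpace n)) :=
    isQuotientMap_quot_mk
  rw [hq.continuous_iff]
  have : ((fun x : ProjSpace n => projector G x i j) ∘
      fun v : {v : Fin n → ℂ // v ≠ 0} => (Projectivization.mk ℂ v.1 v.2 : ProjSpace n)) =
      fun v => dualProd G (Pi.single j 1) v.1 / dualProd G v.1 v.1 * v.1 i :=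
    funext fun v => projector_mk v.1 v.2 i j
  rw [this]
  have hk : ∀ k : Fin n, Continuous fun v : {v : Fin n → ℂ // v ≠ 0} => v.1 k :=
    fun k => (continuous_apply k).comp continuous_subtype_val
  refine Continuous.mul (Continuous.div ?_ ?_ fun v => dualProd_self_ne hG v.2) (hk i)
  · simp only [dualProd, herm]
    exact continuous_finsetSum _ fun a _ => continuous_const.mul (hk a).star
  · simp only [dualProd, herm, Matrix.mulVec, dotProduct]
    exact continuous_finsetSum _ fun a _ =>
      (continuous_finsetSum _ fun b _ => continuous_const.mul (hk b)).mul (hk a).star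

instance instCompactSpaceProjSpace : CompactSpace (ProjSpace n) := by
  have hc : Continuous
      (fun v : {v : Fin n → ℂ // v ≠ 0} => (Projectivization.mk ℂ v.1 v.2 : ProjSpace n)) :=
    continuous_quot_mk
  let g : Metric.sphere (0 : Fin n → ℂ) 1 → ProjSpace n :=
    fun v => Projectivization.mk ℂ v.1 (Metric.ne_of_mem_sphere v.2 one_ne_zero)
  have hg : Continuous g :=
    hc.comp (f := fun v : Metric.sphere (0 : Fin n → ℂ) 1 =>
      (⟨v.1, Metric.ne_of_mem_sphere v.2 one_ne_zero⟩ : {v : Fin n → ℂ // v ≠ 0}))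
      (by fun_prop)
  have hs : Function.Surjective g := by
    intro x
    have h0 : x.rep ≠ 0 := x.rep_nonzero
    have hn : (‖x.rep‖ : ℂ) ≠ 0 := by simpa using h0
    refine ⟨⟨((‖x.rep‖ : ℂ)⁻¹) • x.rep, by simp [norm_smul, h0]⟩, ?_⟩
    conv_rhs => rw [← x.mk_rep]
    exact (Projectivization.mk_eq_mk_iff' ℂ _ _ _ _).2 ⟨_, rfl⟩
  have : CompactSpace (Metric.sphere (0 : Fin n → ℂ) 1) :=
    isCompact_iff_compactSpace.1 (isCompact_sphere _ _)
  exact ⟨by simpa [hs.range_eq] using isCompact_range hg⟩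

/-- The real vector space `ℒ(H)` of Hermitian operators of `H = (ℂ^n, q*)`, `q* = dualProd G`. -/
def hermOps (G : Matrix (Fin n) (Fin n) ℂ) : Submodule ℝ (Matrix (Fin n) (Fin n) ℂ) where
  carrier := {A | ∀ v w, dualProd G (A *ᵥ v) w = dualProd G v (A *ᵥ w)}
  zero_mem' v w := by simp [dualProd, herm]
  add_mem' {A B} hA hB v w := by
    simp [Matrix.add_mulVec, dualProd_add_left, dualProd_add_right, hA v w, hB v w]
  smul_mem' c A hA v w := by
    have h : ∀ u, (c • A) *ᵥ u = (c : ℂ) • (A *ᵥ u) := fun u => by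
      ext i
      simp [Matrix.mulVec, dotProduct, Finset.mul_sum, mul_assoc]
    rw [h, h, dualProd_smul_left, dualProd_smul_right, hA v w]
    simp

/-- `R_ν ∫ ((F, A)) F dν = n ∫ ((F, A)) F dα`, with `F` the `q*`-orthogonal projector,
`((F, A)) = tr (F A)` and `α = ν / |ν|`; the integral is taken entrywise. -/
def channelFun (ν : Measure (ProjSpace n)) (G A : Matrix (Fin n) (Fin n) ℂ) :
    Matrix (Fin n) (Fin n) ℂ :=
  Matrix.of fun i j => (ratio ν : ℂ) *
    ∫ x, (projector G x * A).trace * projector G x i j ∂ν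

lemma integrable_channel (ν : Measure (ProjSpace n)) [IsFiniteMeasure ν]
    {G : Matrix (Fin n) (Fin n) ℂ} (hG : G.PosDef) (A : Matrix (Fin n) (Fin n) ℂ) (i j : Fin n) :
    Integrable (fun x => (projector G x * A).trace * projector G x i j) ν := by
  have h := continuous_projector hG
  have hc : Continuous fun x : ProjSpace n =>
      (projector G x * A).trace * projector G x i j := by
    simp only [Matrix.trace, Matrix.diag, Matrix.mul_apply]
    exact Continuous.mul (continuous_finsetSum _ fun a _ => continuous_finsetSum _ fun b _ =>
      (h a b).mul continuous_const) (h i j)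
  exact hc.integrable_of_hasCompactSupport (HasCompactSupport.of_compactSpace _)

lemma mem_hermOps_iff {G : Matrix (Fin n) (Fin n) ℂ} (hG : G.PosDef)
    (A : Matrix (Fin n) (Fin n) ℂ) :
    A ∈ hermOps G ↔ ∀ i j, (G⁻¹ * A) i j = star ((G⁻¹ * A) j i) := by
  have key : ∀ v w, dualProd G v (A *ᵥ w) = herm v ((G⁻¹ * A) *ᵥ w) := fun v w => by
    rw [← dualProd_star hG, dualProd, star_herm, Matrix.mulVec_mulVec]
  have key2 : ∀ v w, dualProd G (A *ᵥ v) w = herm ((G⁻¹ * A) *ᵥ v) w := fun v w => by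
    rw [dualProd, Matrix.mulVec_mulVec]
  constructor
  · intro h i j
    have := h (Pi.single j 1) (Pi.single i 1)
    rw [key, key2] at this
    simpa [herm, Pi.single_apply, Matrix.mulVec, dotProduct] using this
  · intro h v w
    rw [key, key2]
    simp only [herm, Matrix.mulVec, dotProduct, Finset.sum_mul, star_sum, Finset.mul_sum, star_mul]
    rw [Finset.sum_comm]
    refine Finset.sum_congr rfl fun a _ => Finset.sum_congr rfl fun b _ => ?_
    rw [h b a]
    ring

lemma trace_projector_mul (G A : Matrix (Fin n) (Fin n) ℂ) (x : ProjSpace n) :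
    (projector G x * A).trace = dualProd G (A *ᵥ x.rep) x.rep / dualProd G x.rep x.rep := by
  have h : projector G x = Matrix.vecMulVec x.rep
      (fun j => dualProd G (Pi.single j 1) x.rep / dualProd G x.rep x.rep) := by
    ext i j
    simp [projector, Matrix.vecMulVec_apply, mul_comm]
  have h2 := projector_mulVec G x (A *ᵥ x.rep)
  rw [h, Matrix.vecMulVec_mulVec] at h2
  rw [h, Matrix.vecMulVec_mul, Matrix.trace_vecMulVec, dotProduct_comm,
    ← Matrix.dotProduct_mulVec]
  obtain ⟨i, hi⟩ := Function.ne_iff.1 x.rep_nonzero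
  have h3 := congrFun h2 i
  simp only [Pi.smul_apply, smul_eq_mul, MulOpposite.smul_eq_mul_unop, MulOpposite.unop_op] at h3
  rw [mul_comm] at h3
  exact mul_right_cancel₀ hi h3

lemma channelFun_mem (ν : Measure (ProjSpace n)) [IsFiniteMeasure ν]
    {G : Matrix (Fin n) (Fin n) ℂ} (hG : G.PosDef) {A : Matrix (Fin n) (Fin n) ℂ}
    (hA : A ∈ hermOps G) : channelFun ν G A ∈ hermOps G := by
  rw [mem_hermOps_iff hG]
  have key : ∀ i j, (G⁻¹ * channelFun ν G A) i j =
      (ratio ν : ℂ) * ∫ x, (projector G x * A).trace * (G⁻¹ * projector G x) i j ∂ν := by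
    intro i j
    simp only [Matrix.mul_apply, channelFun, Matrix.of_apply, Finset.mul_sum]
    rw [integral_finsetSum _ fun a _ => ?_, Finset.mul_sum]
    · refine Finset.sum_congr rfl fun a _ => ?_
      simp only [mul_left_comm _ (G⁻¹ i a)]
      rw [integral_const_mul]
      ring
    · simp only [mul_left_comm _ (G⁻¹ i a)]
      exact (integrable_channel ν hG A a j).const_mul _
  intro i j
  rw [key, key, star_mul', ← starRingEnd_apply (∫ x, _ ∂ν), ← integral_conj]
  congr 1
  · simp
  · refine integral_congr_ae (Eventually.of_forall fun x => ?_)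
    have hp : projector G x ∈ hermOps G := fun v w => dualProd_projector hG x v w
    have ht : star (projector G x * A).trace = (projector G x * A).trace := by
      rw [trace_projector_mul, star_div₀, dualProd_star hG, dualProd_star hG, hA]
    simp only [map_mul, starRingEnd_apply]
    rw [ht, (mem_hermOps_iff hG _).1 hp i j]

/-- The quantum channel `ℰ : ℒ(H) → ℒ(H)`, `ℰ(A) = n ∫ ((F, A)) F dα`, of the operator-valued
measure `dW = n F dα` on `H = (ℂ^n, q*)`, `q* = dualProd G`, where `F = projector G` and
`α = ν / |ν|`. -/
def quantumChannel (ν : Measure (ProjSpace n)) [IsFiniteMeasure ν]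
    (G : Matrix (Fin n) (Fin n) ℂ) (hG : G.PosDef) : hermOps G →ₗ[ℝ] hermOps G where
  toFun A := ⟨channelFun ν G A, channelFun_mem ν hG A.2⟩
  map_add' A B := by
    ext i j
    simp only [channelFun, Submodule.coe_add, Matrix.mul_add, Matrix.trace_add, add_mul,
      Matrix.of_apply, Matrix.add_apply]
    rw [integral_add (integrable_channel ν hG _ i j) (integrable_channel ν hG _ i j), mul_add]
  map_smul' c A := by
    ext i j
    simp only [channelFun, Submodule.coe_smul, Matrix.mul_smul, Matrix.trace_smul,
      Matrix.of_apply, Matrix.smul_apply, RingHom.id_apply, smul_mul_assoc]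
    rw [integral_smul, mul_smul_comm]

/-- The `k`-th eigenvalue (`k = 0, 1, …`) in the decreasing list `γ₀ ≥ γ₁ ≥ …` of the real
eigenvalues, repeated according to multiplicity; `0` beyond the end of the list. The quantum
channel is symmetric for the inner product `tr (A B)` on `ℒ(H)`, so all its eigenvalues are real. -/
def eigenvalueDesc {V : Type*} [AddCommGroup V] [Module ℝ V] [Module.Finite ℝ V]
    (E : V →ₗ[ℝ] V) (k : ℕ) : ℝ :=
  (E.charpoly.roots.sort (fun a b : ℝ => b ≤ a)).getD k 0

/-- The spectral gap `1 - γ₁`. -/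
def spectralGap {V : Type*} [AddCommGroup V] [Module ℝ V] [Module.Finite ℝ V]
    (E : V →ₗ[ℝ] V) : ℝ :=
  1 - eigenvalueDesc E 1

end Donaldson

end

/-!
`T_ν` preserves the order of matrices and is homogeneous of degree one. For `ε > 0` the iterates of
`(1 - ε) T_ν + ε` starting at `ε` increase; testing `G ≤ (1 - ε) T_ν(G) + ε` against an operator
supported on a subspace `S` bounds `dim S` by `R_ν ν(ℙ(S))` up to errors that vanish when `G`
degenerates along `S`, so stability prevents degeneration, both for these iterates and for their
limits as `ε → 0`. This gives a fixed point `P`.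

If `G ≤ b P` with contact space `ker (b P - G)`, then `T_ν(G) ≤ b P` with a contact space that
is no larger, and by stability it can only be the same if it is `0` or everything. Hence the least
`b` with `T_ν^r(G) ≤ b P` decreases to a value for which the orbit converges to `b P`, which also
gives uniqueness.

For a fixed point, `tr (A²) - tr (A ℰ(A))` is an average of variances of `A`. If it vanishes, almost
every line of `ν` is an eigenline of `A`, and by stability `A` is scalar. So the eigenvalue `1` is
simple and is the largest one.

If `ℰ(A) = 0`, then `⟨G⁻¹ A z, z⟩ = 0` for almost every `[z]`. On a nondegenerate component charged
by `ν` this is a real analytic equation in holomorphic coordinates, so it holds on an open set, and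
it polarizes to `⟨G⁻¹ A z, w⟩ = 0`. As open subsets of an irreducible variety are Zariski dense, a
linear form vanishing on one of them is zero, hence `A = 0`.
-/

noncomputable section

open scoped MatrixOrder Matrix.Norms.L2Operator

namespace Donaldson

/-! ### Order and convergence in C⋆-algebras -/

section CStarOrder

variable {A : Type*} [CStarAlgebra A] [PartialOrder A] [StarOrderedRing A]

lemma exists_pos_algebraMap_le {a : A} (ha : IsStrictlyPositive a) :
    ∃ r : ℝ, 0 < r ∧ algebraMap ℝ A r ≤ a := by
  cases subsingleton_or_nontrivial A
  · exact ⟨1, one_pos, (Subsingleton.elim _ _).le⟩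
  · exact (CFC.exists_pos_algebraMap_le_iff ha.isSelfAdjoint).2 fun _ => ha.spectrum_pos

lemma exists_pos_smul_le {a b : A} (ha : IsStrictlyPositive a) (hb : IsSelfAdjoint b) :
    ∃ c : ℝ, 0 < c ∧ c • b ≤ a := by
  obtain ⟨r, hr, hra⟩ := exists_pos_algebraMap_le ha
  refine ⟨r / (‖b‖ + 1), by positivity, le_trans ?_ hra⟩
  calc (r / (‖b‖ + 1)) • b ≤ (r / (‖b‖ + 1)) • algebraMap ℝ A ‖b‖ :=
        smul_le_smul_of_nonneg_left hb.le_algebraMap_norm_self (by positivity)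
    _ = algebraMap ℝ A (r / (‖b‖ + 1) * ‖b‖) := by rw [map_mul, Algebra.smul_def]
    _ ≤ algebraMap ℝ A r := algebraMap_mono A (by
        rw [div_mul_eq_mul_div, div_le_iff₀ (by positivity)]
        nlinarith)

lemma eventually_le_add_smul {ι : Type*} {l : Filter ι} {u : ι → A} {a p : A}
    (hu : ∀ᶠ i in l, IsSelfAdjoint (u i)) (ha : IsSelfAdjoint a) (hp : IsStrictlyPositive p)
    (h : Tendsto u l (𝓝 a)) {ε : ℝ} (hε : 0 < ε) : ∀ᶠ i in l, u i ≤ a + ε • p := by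
  obtain ⟨r, hr, hrp⟩ := exists_pos_algebraMap_le hp
  have hnear : ∀ᶠ i in l, ‖u i - a‖ < ε * r :=
    (tendsto_iff_norm_sub_tendsto_zero.1 h).eventually_lt_const (by positivity)
  filter_upwards [hnear, hu] with i hi hui
  rw [← sub_le_iff_le_add']
  calc u i - a ≤ algebraMap ℝ A ‖u i - a‖ := (hui.sub ha).le_algebraMap_norm_self
    _ ≤ algebraMap ℝ A (ε * r) := algebraMap_mono A hi.le
    _ = ε • algebraMap ℝ A r := by rw [map_mul, Algebra.smul_def]
    _ ≤ ε • p := smul_le_smul_of_nonneg_left hrp hε.le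

lemma eventually_smul_le_and_le_smul {ι : Type*} {l : Filter ι} {u : ι → A} {a : A}
    (hu : ∀ᶠ i in l, IsSelfAdjoint (u i)) (ha : IsStrictlyPositive a) (h : Tendsto u l (𝓝 a))
    {ε : ℝ} (hε : 0 < ε) : ∀ᶠ i in l, (1 - ε) • a ≤ u i ∧ u i ≤ (1 + ε) • a := by
  filter_upwards [eventually_le_add_smul hu ha.isSelfAdjoint ha h hε,
    eventually_le_add_smul (hu.mono fun _ hi => hi.neg) ha.isSelfAdjoint.neg ha h.neg hε]
    with i hr hl
  rw [sub_smul, add_smul, one_smul]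
  refine ⟨?_, hr⟩
  rw [← neg_le_neg_iff, neg_sub']
  simpa using hl

lemma norm_sub_le_of_smul_le_of_le_smul {a b : A} {ε : ℝ} (hε : 0 ≤ ε) (hl : (1 - ε) • a ≤ b)
    (hr : b ≤ (1 + ε) • a) : ‖b - a‖ ≤ 3 * ε * ‖a‖ := by
  have hwidth : b - (1 - ε) • a ≤ (2 * ε) • a := by
    rw [sub_le_iff_le_add, ← add_smul]
    convert hr using 2
    ring
  have hnorm : ‖b - (1 - ε) • a‖ ≤ 2 * ε * ‖a‖ := by
    rw [← Real.norm_of_nonneg (by positivity : 0 ≤ 2 * ε), ← norm_smul]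
    exact CStarAlgebra.norm_le_norm_of_nonneg_of_le (sub_nonneg.2 hl) hwidth
  calc ‖b - a‖ = ‖(b - (1 - ε) • a) - ε • a‖ := by congr 1; module
    _ ≤ 2 * ε * ‖a‖ + ε * ‖a‖ := (norm_sub_le _ _).trans
        (add_le_add hnorm (by rw [norm_smul, Real.norm_of_nonneg hε]))
    _ = 3 * ε * ‖a‖ := by ring

lemma tendsto_of_eventually_smul_le_of_le_smul {ι : Type*} {l : Filter ι} {u : ι → A} {a : A}
    (h : ∀ ε : ℝ, 0 < ε → ε < 1 → ∀ᶠ i in l, (1 - ε) • a ≤ u i ∧ u i ≤ (1 + ε) • a) :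
    Tendsto u l (𝓝 a) := by
  rw [Metric.tendsto_nhds]
  intro δ hδ
  have hlim : Tendsto (fun ε : ℝ => 3 * ε * ‖a‖) (𝓝[>] 0) (𝓝 0) :=
    tendsto_nhdsWithin_of_tendsto_nhds (Continuous.tendsto' (by fun_prop) _ _ (by simp))
  have hIoo : ∀ᶠ ε : ℝ in 𝓝[>] 0, ε ∈ Set.Ioo 0 1 := Ioo_mem_nhdsGT one_pos
  obtain ⟨ε, ⟨hε0, hε1⟩, hεδ⟩ := (hIoo.and (hlim.eventually_lt_const hδ)).exists
  filter_upwards [h ε hε0 hε1] with i hi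
  rw [dist_eq_norm]
  exact (norm_sub_le_of_smul_le_of_le_smul hε0.le hi.1 hi.2).trans_lt hεδ

lemma continuousOn_of_monotoneOn_of_map_smul {f : A → A}
    (hmono : MonotoneOn f {a | IsStrictlyPositive a})
    (hsmul : ∀ a, IsStrictlyPositive a → ∀ c : ℝ, 0 < c → f (c • a) = c • f a) :
    ContinuousOn f {a | IsStrictlyPositive a} := by
  intro a (ha : IsStrictlyPositive a)
  refine tendsto_of_eventually_smul_le_of_le_smul fun ε hε0 hε1 => ?_
  have hsa : ∀ᶠ b in 𝓝[{b | IsStrictlyPositive b}] a, IsSelfAdjoint b :=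
    eventually_nhdsWithin_of_forall fun _ hb => hb.isSelfAdjoint
  filter_upwards [eventually_smul_le_and_le_smul hsa ha (tendsto_id'.2 nhdsWithin_le_nhds) hε0,
    self_mem_nhdsWithin] with b hb hbpos
  have hl : 0 < 1 - ε := sub_pos.2 hε1
  have hr : 0 < 1 + ε := by positivity
  rw [← hsmul a ha _ hl, ← hsmul a ha _ hr]
  exact ⟨hmono (ha.smul hl) hbpos hb.1, hmono hbpos (ha.smul hr) hb.2⟩

lemma exists_tendsto_of_antitone [ProperSpace A] {u : ℕ → A} (hu : Antitone u)
    (hnonneg : ∀ k, 0 ≤ u k) : ∃ a, 0 ≤ a ∧ Tendsto u atTop (𝓝 a) := by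
  have hbdd : ∀ k, u k ∈ Metric.closedBall (0 : A) ‖u 0‖ := fun k => by
    rw [mem_closedBall_zero_iff]
    exact CStarAlgebra.norm_le_norm_of_nonneg_of_le (hnonneg k) (hu k.zero_le)
  obtain ⟨a, -, φ, hφ, hlim⟩ := (isCompact_closedBall (0 : A) ‖u 0‖).tendsto_subseq hbdd
  have hle : ∀ k, a ≤ u k := fun k => by
    refine le_of_tendsto hlim ?_
    filter_upwards [eventually_ge_atTop k] with m hm
    exact hu (hm.trans (hφ.id_le m))
  have hnorm : Antitone fun k => ‖u k - a‖ := fun k m hkm =>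
    CStarAlgebra.norm_le_norm_of_nonneg_of_le (sub_nonneg.2 (hle m)) (sub_le_sub_right (hu hkm) a)
  refine ⟨a, ge_of_tendsto' hlim fun k => hnonneg _, tendsto_iff_norm_sub_tendsto_zero.2 ?_⟩
  exact tendsto_iff_tendsto_subseq_of_antitone hnorm hφ.tendsto_atTop |>.2
    (tendsto_iff_norm_sub_tendsto_zero.1 hlim)

end CStarOrder

/-! ### Hermitian forms -/

section HermitianForm

variable {ι : Type*} [Fintype ι] {A B B' : Matrix ι ι ℂ}

/-- The value `⟨A v, v⟩` of the quadratic form of a matrix, for the standard Hermitian product. It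
is only used for Hermitian `A`, where taking the real part loses nothing, see `ofReal_quad`. -/
def quad (A : Matrix ι ι ℂ) (v : ι → ℂ) : ℝ := (star v ⬝ᵥ A *ᵥ v).re

lemma quad_sub (A B : Matrix ι ι ℂ) (v : ι → ℂ) : quad (A - B) v = quad A v - quad B v := by
  simp [quad, Matrix.sub_mulVec]

lemma quad_smul (c : ℝ) (A : Matrix ι ι ℂ) (v : ι → ℂ) : quad (c • A) v = c * quad A v := by
  simp [quad, Matrix.smul_mulVec]

lemma quad_smul_vec (A : Matrix ι ι ℂ) (c : ℂ) (v : ι → ℂ) :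
    quad A (c • v) = ‖c‖ ^ 2 * quad A v := by
  have h : star (c • v) ⬝ᵥ A *ᵥ (c • v) = ((‖c‖ ^ 2 : ℝ) : ℂ) * (star v ⬝ᵥ A *ᵥ v) := by
    rw [Matrix.mulVec_smul, star_smul, smul_dotProduct, dotProduct_smul, smul_eq_mul, smul_eq_mul,
      ← mul_assoc, Complex.star_def, Complex.conj_mul', ← Complex.ofReal_pow]
  rw [quad, h, Complex.re_ofReal_mul, quad]

lemma quad_sub_vec (hA : A.IsHermitian) (u w : ι → ℂ) :
    quad A (u - w) = quad A u - 2 * (star w ⬝ᵥ A *ᵥ u).re + quad A w := by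
  have h : star u ⬝ᵥ A *ᵥ w = star (star w ⬝ᵥ A *ᵥ u) := by
    rw [Matrix.star_dotProduct, Matrix.star_mulVec, hA.eq, ← Matrix.dotProduct_mulVec]
  simp only [quad, star_sub, Matrix.mulVec_sub, sub_dotProduct, dotProduct_sub, h,
    Complex.sub_re, Complex.star_def, Complex.conj_re]
  ring

lemma ofReal_quad (hA : A.IsHermitian) (v : ι → ℂ) : (quad A v : ℂ) = star v ⬝ᵥ A *ᵥ v :=
  Complex.ext rfl (hA.im_star_dotProduct_mulVec_self v).symm

lemma quad_pos (hA : A.PosDef) {v : ι → ℂ} (hv : v ≠ 0) : 0 < quad A v := hA.re_dotProduct_pos hv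

lemma quad_nonneg (hA : A.PosSemidef) (v : ι → ℂ) : 0 ≤ quad A v := hA.re_dotProduct_nonneg v

lemma posDef_of_quad_pos (hA : A.IsHermitian) (h : ∀ v, v ≠ 0 → 0 < quad A v) : A.PosDef :=
  Matrix.PosDef.of_dotProduct_mulVec_pos hA fun v hv => by
    rw [← ofReal_quad hA]; exact_mod_cast h v hv

lemma mulVec_eq_zero_of_quad_eq_zero (hA : A.PosSemidef) {v : ι → ℂ} (h : quad A v = 0) :
    A *ᵥ v = 0 := by
  rw [← hA.dotProduct_mulVec_zero_iff, ← ofReal_quad hA.1, h, Complex.ofReal_zero]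

lemma quad_le_quad (h : A ≤ B) (v : ι → ℂ) : quad A v ≤ quad B v := by
  rw [← sub_nonneg, ← quad_sub]
  exact quad_nonneg (Matrix.le_iff.1 h) v

lemma quad_vecMulVec_star (v z : ι → ℂ) :
    quad (Matrix.vecMulVec v (star v)) z = ‖star v ⬝ᵥ z‖ ^ 2 := by
  have h : star z ⬝ᵥ v = star (star v ⬝ᵥ z) := by rw [Matrix.star_dotProduct]
  rw [quad, Matrix.vecMulVec_mulVec, dotProduct_smul, h, MulOpposite.smul_eq_mul_unop,
    MulOpposite.unop_op, Complex.star_def, Complex.conj_mul', ← Complex.ofReal_pow,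
    Complex.ofReal_re]

lemma trace_mul_vecMulVec_star (A : Matrix ι ι ℂ) (v : ι → ℂ) :
    (A * Matrix.vecMulVec v (star v)).trace.re = quad A v := by
  rw [Matrix.mul_vecMulVec, Matrix.trace_vecMulVec, dotProduct_comm, quad]

/-- The kernel of a matrix acting on column vectors. -/
abbrev matKer (A : Matrix ι ι ℂ) : Submodule ℂ (ι → ℂ) := LinearMap.ker A.mulVecLin

lemma posDef_of_matKer_eq_bot (hA : A.PosSemidef) (hker : matKer A = ⊥) : A.PosDef :=
  posDef_of_quad_pos hA.1 fun v hv => (quad_nonneg hA v).lt_of_ne' fun h => hv <| by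
    have hmem : v ∈ matKer A := mulVec_eq_zero_of_quad_eq_zero hA h
    rwa [hker, Submodule.mem_bot] at hmem

lemma mem_matKer {v : ι → ℂ} : v ∈ matKer A ↔ A *ᵥ v = 0 := Iff.rfl

lemma continuous_quad (v : ι → ℂ) : Continuous fun A : Matrix ι ι ℂ => quad A v :=
  Complex.continuous_re.comp (continuous_const.dotProduct
    (continuous_id.matrix_mulVec continuous_const))

lemma continuous_re_trace : Continuous fun A : Matrix ι ι ℂ => A.trace.re :=
  Complex.continuous_re.comp continuous_id.matrix_trace

lemma matKer_eq_top : matKer A = ⊤ ↔ A = 0 := by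
  classical
  rw [LinearMap.ker_eq_top]
  exact Matrix.toLin'.map_eq_zero_iff

lemma trace_mul_nonneg (hA : 0 ≤ A) (hB : 0 ≤ B) : 0 ≤ (A * B).trace.re := by
  classical
  obtain ⟨C, rfl⟩ := CStarAlgebra.nonneg_iff_eq_star_mul_self.1 hA
  rw [Matrix.mul_assoc, Matrix.trace_mul_comm]
  exact (Complex.le_def.1
    ((Matrix.nonneg_iff_posSemidef.1 hB).mul_mul_conjTranspose_same C).trace_nonneg).1

lemma trace_mul_mono (hA : 0 ≤ A) (h : B ≤ B') : (A * B).trace.re ≤ (A * B').trace.re := by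
  rw [← sub_nonneg, ← Complex.sub_re, ← Matrix.trace_sub, ← Matrix.mul_sub]
  exact trace_mul_nonneg hA (sub_nonneg.2 h)

variable [DecidableEq ι]

lemma mulVec_inv_mulVec (hA : A.PosDef) (v : ι → ℂ) : A *ᵥ (A⁻¹ *ᵥ v) = v := by
  rw [Matrix.mulVec_mulVec, Matrix.mul_nonsing_inv _ hA.det_pos.ne'.isUnit, Matrix.one_mulVec]

lemma inv_le_inv_of_le (hA : A.PosDef) (h : A ≤ B) : B⁻¹ ≤ A⁻¹ := by
  rw [Matrix.nonsing_inv_eq_ringInverse, Matrix.nonsing_inv_eq_ringInverse]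
  exact CStarAlgebra.ringInverse_le_ringInverse h hA.isStrictlyPositive

lemma inv_inv_of_posDef (hA : A.PosDef) : A⁻¹⁻¹ = A :=
  Matrix.nonsing_inv_nonsing_inv _ hA.det_pos.ne'.isUnit

lemma tendsto_matrix_inv {α : Type*} {l : Filter α} {u : α → Matrix ι ι ℂ}
    (hA : A.PosDef) (hu : Tendsto u l (𝓝 A)) : Tendsto (fun k => (u k)⁻¹) l (𝓝 A⁻¹) := by
  simp only [Matrix.nonsing_inv_eq_ringInverse]
  obtain ⟨a, ha⟩ := hA.isUnit
  exact (ha ▸ NormedRing.inverse_continuousAt a).tendsto.comp hu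

lemma norm_le_re_trace (hA : 0 ≤ A) : ‖A‖ ≤ A.trace.re := by
  cases isEmpty_or_nonempty ι
  · simp [Subsingleton.elim A 0]
  have hA' : A.PosSemidef := Matrix.nonneg_iff_posSemidef.1 hA
  have hmem : ‖A‖ ∈ spectrum ℝ A := CStarAlgebra.norm_mem_spectrum_of_nonneg
  rw [hA'.1.spectrum_real_eq_range_eigenvalues] at hmem
  obtain ⟨i, hi⟩ := hmem
  have htrace : A.trace.re = ∑ j, hA'.1.eigenvalues j := by
    simp [hA'.1.trace_eq_sum_eigenvalues]
  rw [htrace, ← hi]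
  exact Finset.single_le_sum (fun j _ => hA'.eigenvalues_nonneg j) (Finset.mem_univ i)

end HermitianForm

/-! ### Matrix-valued integrals -/

section MatrixIntegral

variable {X ι : Type*} [MeasurableSpace X] {μ : Measure X} [Fintype ι] [DecidableEq ι]
  {f : X → Matrix ι ι ℂ}

lemma integral_matrix_apply (hf : Integrable f μ) (i j : ι) :
    (∫ x, f x ∂μ) i j = ∫ x, f x i j ∂μ :=
  ((Matrix.entryLinearMap ℂ ℂ i j).toContinuousLinearMap.integral_comp_comm hf).symm

lemma re_trace_mul_integral (B : Matrix ι ι ℂ) (hf : Integrable f μ) :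
    (B * ∫ x, f x ∂μ).trace.re = ∫ x, (B * f x).trace.re ∂μ := by
  let L : Matrix ι ι ℂ →ₗ[ℝ] ℝ := Complex.reLm ∘ₗ
    (Matrix.traceLinearMap ι ℂ ℂ ∘ₗ LinearMap.mulLeft ℂ B).restrictScalars ℝ
  exact (L.toContinuousLinearMap.integral_comp_comm hf).symm

lemma mulVec_integral_mulVec (B : Matrix ι ι ℂ) (hf : Integrable f μ) (v : ι → ℂ) :
    B *ᵥ (∫ x, f x ∂μ) *ᵥ v = ∫ x, B *ᵥ f x *ᵥ v ∂μ :=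
  ((B.mulVecLin ∘ₗ (Matrix.mulVecBilin ℂ ℂ).flip v).toContinuousLinearMap.integral_comp_comm
    hf).symm

end MatrixIntegral

/-! ### Donaldson's map -/

section DonaldsonMap

variable {n : ℕ} {G G' A B : Matrix (Fin n) (Fin n) ℂ} {x : ProjSpace n}

lemma isQuotientMap_mk : Topology.IsQuotientMap
    (fun v : {v : Fin n → ℂ // v ≠ 0} => (Projectivization.mk ℂ v.1 v.2 : ProjSpace n)) :=
  isQuotientMap_quot_mk

lemma mem_projSubspace {S : Submodule ℂ (Fin n → ℂ)} : x ∈ projSubspace S ↔ x.rep ∈ S := by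
  rw [projSubspace, Set.mem_ofPred_eq, Projectivization.submodule_eq,
    Submodule.span_singleton_le_iff_mem]

lemma projSubspace_bot : projSubspace (⊥ : Submodule ℂ (Fin n → ℂ)) = ∅ := by
  ext x
  simp [mem_projSubspace, x.rep_nonzero]

lemma isClosed_projSubspace (S : Submodule ℂ (Fin n → ℂ)) : IsClosed (projSubspace S) := by
  rw [← isQuotientMap_mk.isClosed_preimage]
  have : (fun v : {v : Fin n → ℂ // v ≠ 0} => (Projectivization.mk ℂ v.1 v.2 : ProjSpace n)) ⁻¹'
      projSubspace S = Subtype.val ⁻¹' (S : Set (Fin n → ℂ)) := by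
    ext v
    simp [projSubspace, Projectivization.submodule_mk, Submodule.span_singleton_le_iff_mem]
  rw [this]
  exact S.closed_of_finiteDimensional.preimage continuous_subtype_val

lemma dualProd_eq (G : Matrix (Fin n) (Fin n) ℂ) (v w : Fin n → ℂ) :
    dualProd G v w = star w ⬝ᵥ G⁻¹ *ᵥ v := by
  rw [dualProd, herm_eq, dotProduct_comm]

lemma dualProd_self (hG : G.PosDef) (v : Fin n → ℂ) : dualProd G v v = (quad G⁻¹ v : ℂ) := by
  rw [dualProd_eq, ofReal_quad hG.inv.1]

lemma quad_inv_rep_pos (hG : G.PosDef) (x : ProjSpace n) : 0 < quad G⁻¹ x.rep :=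
  quad_pos hG.inv x.rep_nonzero

/-- The integrand `z z^* / ⟨G⁻¹ z, z⟩ = Π_z |z|² / ⟨G⁻¹ z, z⟩` of Donaldson's map. -/
def kern (G : Matrix (Fin n) (Fin n) ℂ) (x : ProjSpace n) : Matrix (Fin n) (Fin n) ℂ :=
  (quad G⁻¹ x.rep)⁻¹ • Matrix.vecMulVec x.rep (star x.rep)

lemma projector_eq_kern_mul (hG : G.PosDef) (x : ProjSpace n) : projector G x = kern G x * G⁻¹ := by
  ext i j
  have hcol : dualProd G (Pi.single j 1) x.rep = (star x.rep ᵥ* G⁻¹) j := by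
    rw [dualProd_eq, Matrix.dotProduct_mulVec, dotProduct_single_one]
  simp only [projector, kern, Matrix.of_apply, hcol, dualProd_self hG, Matrix.smul_mul,
    Matrix.smul_apply, Matrix.vecMulVec_mul, Matrix.vecMulVec_apply, Complex.real_smul,
    Complex.ofReal_inv]
  ring

lemma continuous_projector_matrix (hG : G.PosDef) : Continuous (projector G) :=
  continuous_matrix (continuous_projector hG)

lemma continuous_kern (hG : G.PosDef) : Continuous (kern G) := by
  have h : kern G = fun x => projector G x * G := by
    ext1 x
    rw [projector_eq_kern_mul hG, Matrix.mul_assoc,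
      Matrix.nonsing_inv_mul _ hG.det_pos.ne'.isUnit, Matrix.mul_one]
  rw [h]
  exact (continuous_projector_matrix hG).mul continuous_const

lemma kern_mono (hG : G.PosDef) (hG' : G'.PosDef) (h : G ≤ G') (x : ProjSpace n) :
    kern G x ≤ kern G' x :=
  smul_le_smul_of_nonneg_right
    (inv_anti₀ (quad_inv_rep_pos hG' x) (quad_le_quad (inv_le_inv_of_le hG h) _))
    (Matrix.posSemidef_vecMulVec_self_star x.rep).nonneg

lemma kern_smul (hG : G.PosDef) {c : ℝ} (hc : c ≠ 0) (x : ProjSpace n) :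
    kern (c • G) x = c • kern G x := by
  have hinv : (c • G)⁻¹ = c⁻¹ • G⁻¹ := Matrix.inv_eq_left_inv (by
    rw [Matrix.smul_mul, Matrix.mul_smul, smul_smul, inv_mul_cancel₀ hc, one_smul,
      Matrix.nonsing_inv_mul _ hG.det_pos.ne'.isUnit])
  rw [kern, hinv, quad_smul, mul_inv, inv_inv, mul_smul, kern]

lemma trace_mul_kern (B G : Matrix (Fin n) (Fin n) ℂ) (x : ProjSpace n) :
    (B * kern G x).trace.re = quad B x.rep / quad G⁻¹ x.rep := by
  rw [kern, Matrix.mul_smul, Matrix.trace_smul, Complex.smul_re, trace_mul_vecMulVec_star,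
    smul_eq_mul, inv_mul_eq_div]

lemma continuous_quad_div (hG : G.PosDef) (B : Matrix (Fin n) (Fin n) ℂ) :
    Continuous fun x : ProjSpace n => quad B x.rep / quad G⁻¹ x.rep := by
  simp only [← trace_mul_kern]
  exact Complex.continuous_re.comp (continuous_const.mul (continuous_kern hG)).matrix_trace

lemma ratio_nonneg (ν : Measure (ProjSpace n)) : 0 ≤ ratio ν := by
  unfold ratio; positivity

lemma nonempty_fin_of_measure_ne_zero {ν : Measure (ProjSpace n)} (hν : ν ≠ 0) :
    Nonempty (Fin n) := by
  by_contra h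
  rw [not_nonempty_iff] at h
  have : IsEmpty (ProjSpace n) := ⟨fun x => x.rep_nonzero (Subsingleton.elim _ _)⟩
  exact hν (Measure.eq_zero_of_isEmpty ν)

variable (ν : Measure (ProjSpace n)) [IsFiniteMeasure ν]

lemma integrable_of_continuous {E : Type*} [NormedAddCommGroup E] {f : ProjSpace n → E}
    (hf : Continuous f) : Integrable f ν :=
  hf.integrable_of_hasCompactSupport (HasCompactSupport.of_compactSpace _)

lemma donaldsonMap_eq_integral (hG : G.PosDef) :
    donaldsonMap ν G = ratio ν • ∫ x, kern G x ∂ν := by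
  ext i j
  rw [Matrix.smul_apply, integral_matrix_apply (integrable_of_continuous ν (continuous_kern hG)),
    Complex.real_smul]
  simp only [donaldsonMap, Matrix.of_apply]
  congr 2
  ext x
  have hone : herm x.rep x.rep = (quad (1 : Matrix (Fin n) (Fin n) ℂ) x.rep : ℂ) := by
    rw [ofReal_quad Matrix.isHermitian_one, Matrix.one_mulVec, herm_eq, dotProduct_comm]
  have hG' : herm (G⁻¹ *ᵥ x.rep) x.rep = (quad G⁻¹ x.rep : ℂ) := dualProd_self hG x.rep
  have hne : (quad (1 : Matrix (Fin n) (Fin n) ℂ) x.rep : ℂ) ≠ 0 :=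
    Complex.ofReal_ne_zero.2 (quad_pos Matrix.PosDef.one x.rep_nonzero).ne'
  rw [hone, hG', projector_eq_kern_mul Matrix.PosDef.one, kern, kern, inv_one, Matrix.mul_one,
    Matrix.smul_apply, Matrix.smul_apply, Complex.real_smul, Complex.real_smul,
    Complex.ofReal_inv, Complex.ofReal_inv]
  field_simp

lemma trace_mul_donaldsonMap (hG : G.PosDef) (B : Matrix (Fin n) (Fin n) ℂ) :
    (B * donaldsonMap ν G).trace.re = ratio ν * ∫ x, quad B x.rep / quad G⁻¹ x.rep ∂ν := by
  rw [donaldsonMap_eq_integral ν hG, Matrix.mul_smul, Matrix.trace_smul, Complex.smul_re,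
    re_trace_mul_integral B (integrable_of_continuous ν (continuous_kern hG)), smul_eq_mul]
  simp only [trace_mul_kern]

lemma quad_donaldsonMap (hG : G.PosDef) (v : Fin n → ℂ) :
    quad (donaldsonMap ν G) v = ratio ν * ∫ x, ‖star v ⬝ᵥ x.rep‖ ^ 2 / quad G⁻¹ x.rep ∂ν := by
  rw [← trace_mul_vecMulVec_star, Matrix.trace_mul_comm, trace_mul_donaldsonMap ν hG]
  simp only [quad_vecMulVec_star]

lemma donaldsonMap_nonneg (hG : G.PosDef) : 0 ≤ donaldsonMap ν G := by
  rw [donaldsonMap_eq_integral ν hG]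
  exact smul_nonneg (ratio_nonneg ν) (integral_nonneg fun x =>
    smul_nonneg (inv_pos.2 (quad_inv_rep_pos hG x)).le
      (Matrix.posSemidef_vecMulVec_self_star x.rep).nonneg)

lemma donaldsonMap_mono (hG : G.PosDef) (hG' : G'.PosDef) (h : G ≤ G') :
    donaldsonMap ν G ≤ donaldsonMap ν G' := by
  rw [donaldsonMap_eq_integral ν hG, donaldsonMap_eq_integral ν hG']
  exact smul_le_smul_of_nonneg_left (integral_mono
    (integrable_of_continuous ν (continuous_kern hG))
    (integrable_of_continuous ν (continuous_kern hG')) (kern_mono hG hG' h)) (ratio_nonneg ν)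

lemma donaldsonMap_smul (hG : G.PosDef) {c : ℝ} (hc : 0 < c) :
    donaldsonMap ν (c • G) = c • donaldsonMap ν G := by
  rw [donaldsonMap_eq_integral ν hG, donaldsonMap_eq_integral ν (hG.smul hc)]
  simp only [kern_smul hG hc.ne', integral_smul]
  rw [smul_comm]

lemma continuousOn_donaldsonMap : ContinuousOn (donaldsonMap ν) {G | IsStrictlyPositive G} :=
  continuousOn_of_monotoneOn_of_map_smul
    (fun _ hG _ hG' h => donaldsonMap_mono ν (Matrix.isStrictlyPositive_iff_posDef.1 hG)
      (Matrix.isStrictlyPositive_iff_posDef.1 hG') h)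
    fun _ hG _ hc => donaldsonMap_smul ν (Matrix.isStrictlyPositive_iff_posDef.1 hG) hc

variable {ν}

lemma real_univ_pos (hν : ν ≠ 0) : 0 < ν.real Set.univ :=
  have : NeZero ν := ⟨hν⟩
  measureReal_univ_pos

lemma ratio_mul_real_univ (hν : ν ≠ 0) : ratio ν * ν.real Set.univ = n := by
  rw [ratio, div_mul_cancel₀ _ (real_univ_pos hν).ne']

lemma ratio_pos (hν : ν ≠ 0) : 0 < ratio ν :=
  div_pos (Nat.cast_pos.2 (Fin.pos_iff_nonempty.2 (nonempty_fin_of_measure_ne_zero hν)))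
    (real_univ_pos hν)

end DonaldsonMap

/-! ### Stable measures -/

section Stability

variable {n : ℕ} {ν : Measure (ProjSpace n)} [IsFiniteMeasure ν] {S S' : Submodule ℂ (Fin n → ℂ)}

/-- The stability condition `ν(Σ) / (dim Σ + 1) < |ν| / n` for all nonempty proper projective
subspaces `Σ = ℙ(S)`, for which `dim Σ + 1` is the rank of `S`. -/
def IsStable (ν : Measure (ProjSpace n)) : Prop :=
  ∀ S : Submodule ℂ (Fin n → ℂ), S ≠ ⊥ → S ≠ ⊤ →
    ν.real (projSubspace S) / (Module.finrank ℂ S : ℝ) < ν.real Set.univ / (n : ℝ)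

lemma IsStable.ratio_mul_real_lt (hs : IsStable ν) (hν : ν ≠ 0) (hbot : S ≠ ⊥) (htop : S ≠ ⊤) :
    ratio ν * ν.real (projSubspace S) < Module.finrank ℂ S := by
  have hn : (0 : ℝ) < n :=
    Nat.cast_pos.2 (Fin.pos_iff_nonempty.2 (nonempty_fin_of_measure_ne_zero hν))
  have hS : (0 : ℝ) < Module.finrank ℂ S :=
    Nat.cast_pos.2 (Module.finrank_pos_iff.2 (Submodule.nontrivial_iff_ne_bot.2 hbot))
  have h := hs S hbot htop
  rw [div_lt_div_iff₀ hS hn] at h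
  rw [ratio, div_mul_eq_mul_div, div_lt_iff₀ (real_univ_pos hν)]
  linarith

lemma IsStable.ratio_mul_real_le (hs : IsStable ν) (hν : ν ≠ 0) (htop : S ≠ ⊤) :
    ratio ν * ν.real (projSubspace S) ≤ Module.finrank ℂ S := by
  rcases eq_or_ne S ⊥ with rfl | hbot
  · simp [projSubspace_bot]
  · exact (hs.ratio_mul_real_lt hν hbot htop).le

lemma IsStable.not_ae_mem_or (hs : IsStable ν) (hν : ν ≠ 0) (hbot : S ≠ ⊥) (htop : S ≠ ⊤)
    (hrank : Module.finrank ℂ S + Module.finrank ℂ S' ≤ n) :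
    ¬ ∀ᵐ x ∂ν, x ∈ projSubspace S ∨ x ∈ projSubspace S' := by
  intro h
  have hpos : 0 < Module.finrank ℂ S :=
    Module.finrank_pos_iff.2 (Submodule.nontrivial_iff_ne_bot.2 hbot)
  have htop' : S' ≠ ⊤ := by
    rintro rfl
    rw [finrank_top, Module.finrank_fin_fun] at hrank
    omega
  have hcover : ν.real Set.univ ≤ ν.real (projSubspace S) + ν.real (projSubspace S') := by
    rw [measureReal_congr (eventuallyEq_univ.2 h).symm]
    exact measureReal_union_le _ _
  have hlt : (n : ℝ) < Module.finrank ℂ S + Module.finrank ℂ S' :=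
    calc (n : ℝ) = ratio ν * ν.real Set.univ := (ratio_mul_real_univ hν).symm
      _ ≤ ratio ν * (ν.real (projSubspace S) + ν.real (projSubspace S')) :=
        mul_le_mul_of_nonneg_left hcover (ratio_nonneg ν)
      _ = ratio ν * ν.real (projSubspace S) + ratio ν * ν.real (projSubspace S') := mul_add ..
      _ < _ := add_lt_add_of_lt_of_le (hs.ratio_mul_real_lt hν hbot htop)
        (hs.ratio_mul_real_le hν htop')
  exact absurd hrank (not_le.2 (by exact_mod_cast hlt))

lemma IsStable.not_ae_mem (hs : IsStable ν) (hν : ν ≠ 0) (htop : S ≠ ⊤) :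
    ¬ ∀ᵐ x ∂ν, x ∈ projSubspace S := by
  intro h
  rcases eq_or_ne S ⊥ with rfl | hbot
  · have : NeZero ν := ⟨hν⟩
    obtain ⟨x, hx⟩ := h.exists
    simp [projSubspace_bot] at hx
  · refine hs.not_ae_mem_or (S' := ⊥) hν hbot htop ?_ (h.mono fun x => Or.inl)
    simpa using Submodule.finrank_le S

/-- The orthogonal of a set for the standard Hermitian product. -/
def orth (s : Set (Fin n → ℂ)) : Submodule ℂ (Fin n → ℂ) where
  carrier := {z | ∀ v ∈ s, star v ⬝ᵥ z = 0}
  zero_mem' v _ := dotProduct_zero _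
  add_mem' ha hb v hv := by rw [dotProduct_add, ha v hv, hb v hv, add_zero]
  smul_mem' c z hz v hv := by rw [dotProduct_smul, hz v hv, smul_zero]

lemma mem_orth {s : Set (Fin n → ℂ)} {z : Fin n → ℂ} :
    z ∈ orth s ↔ ∀ v ∈ s, star v ⬝ᵥ z = 0 := Iff.rfl

lemma orth_ne_top {s : Set (Fin n → ℂ)} {v : Fin n → ℂ} (hs : v ∈ s) (hv : v ≠ 0) :
    orth s ≠ ⊤ := fun h =>
  hv (dotProduct_star_self_eq_zero.1 (mem_orth.1 (h ▸ Submodule.mem_top) v hs))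

lemma donaldsonMap_posDef (hs : IsStable ν) (hν : ν ≠ 0) {G : Matrix (Fin n) (Fin n) ℂ}
    (hG : G.PosDef) : (donaldsonMap ν G).PosDef := by
  refine posDef_of_quad_pos (Matrix.nonneg_iff_posSemidef.1 (donaldsonMap_nonneg ν hG)).1
    fun v hv => ?_
  rw [quad_donaldsonMap ν hG]
  refine mul_pos (ratio_pos hν) ?_
  have hnonneg (x : ProjSpace n) : 0 ≤ ‖star v ⬝ᵥ x.rep‖ ^ 2 / quad G⁻¹ x.rep :=
    div_nonneg (by positivity) (quad_inv_rep_pos hG x).le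
  have hint : Integrable (fun x : ProjSpace n => ‖star v ⬝ᵥ x.rep‖ ^ 2 / quad G⁻¹ x.rep) ν := by
    simp only [← quad_vecMulVec_star]
    exact integrable_of_continuous ν (continuous_quad_div hG _)
  refine (integral_nonneg hnonneg).lt_of_ne fun h =>
    hs.not_ae_mem hν (orth_ne_top (Set.mem_singleton v) hv) ?_
  filter_upwards [(integral_eq_zero_iff_of_nonneg hnonneg hint).1 h.symm] with x hx
  rw [mem_projSubspace, mem_orth]
  rintro _ rfl
  simpa [(quad_inv_rep_pos hG x).ne'] using hx

end Stability

/-! ### Shorted operators -/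

section ShortedOperator

variable {ι κ : Type*} [Fintype ι] [Fintype κ] [DecidableEq κ]

lemma exists_isometry_into (S : Submodule ℂ (ι → ℂ)) :
    ∃ V : Matrix ι (Fin (Module.finrank ℂ S)) ℂ, Vᴴ * V = 1 ∧ ∀ j, V.col j ∈ S := by
  let e := WithLp.linearEquiv 2 ℂ (ι → ℂ)
  have hrank := (e.ofSubmodule' S).finrank_eq
  let b := (stdOrthonormalBasis ℂ (S.comap e.toLinearMap)).reindex (finCongr hrank)
  refine ⟨Matrix.of fun i j => (b j).1 i, ?_, fun j => (b j).2⟩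
  ext j k
  rw [Matrix.one_apply, ← orthonormal_iff_ite.1 b.orthonormal j k, Submodule.coe_inner,
    EuclideanSpace.inner_eq_star_dotProduct, dotProduct_comm]
  rfl

lemma mulVec_injective_of_isometry {V : Matrix ι κ ℂ} (hV : Vᴴ * V = 1) :
    Function.Injective V.mulVec :=
  Function.LeftInverse.injective (g := Vᴴ.mulVec) fun w => by
    rw [Matrix.mulVec_mulVec, hV, Matrix.one_mulVec]

variable [DecidableEq ι]
  {H N : Matrix ι ι ℂ} {V : Matrix ι κ ℂ}

/-- The shorted operator of `H` on the range of `V`: the largest Hermitian matrix `W ≤ H` with range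
in the range of `V`. It allows to compare a degenerating `H` with the kernel of its limit. -/
def shorted (H : Matrix ι ι ℂ) (V : Matrix ι κ ℂ) : Matrix ι ι ℂ := V * (Vᴴ * H⁻¹ * V)⁻¹ * Vᴴ

lemma shorted_nonneg (hH : H.PosDef) : 0 ≤ shorted H V :=
  (((hH.inv.posSemidef.conjTranspose_mul_mul_same V).inv).mul_mul_conjTranspose_same V).nonneg

lemma inv_mul_compression (hH : H.PosDef) (hV : Vᴴ * V = 1) :
    (Vᴴ * H⁻¹ * V)⁻¹ * (Vᴴ * H⁻¹ * V) = 1 :=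
  Matrix.nonsing_inv_mul _ (hH.inv.conjTranspose_mul_mul_same
    (mulVec_injective_of_isometry hV)).det_pos.ne'.isUnit

lemma trace_shorted_mul_inv (hH : H.PosDef) (hV : Vᴴ * V = 1) :
    (shorted H V * H⁻¹).trace = Fintype.card κ := by
  rw [shorted, Matrix.mul_assoc, Matrix.mul_assoc, Matrix.trace_mul_comm, Matrix.mul_assoc,
    inv_mul_compression hH hV, Matrix.trace_one]

lemma shorted_mul_inv_mul_shorted (hH : H.PosDef) (hV : Vᴴ * V = 1) :
    shorted H V * H⁻¹ * shorted H V = shorted H V :=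
  calc shorted H V * H⁻¹ * shorted H V
      = V * ((Vᴴ * H⁻¹ * V)⁻¹ * (Vᴴ * H⁻¹ * V)) * (Vᴴ * H⁻¹ * V)⁻¹ * Vᴴ := by
        simp only [shorted, Matrix.mul_assoc]
    _ = shorted H V := by rw [inv_mul_compression hH hV, Matrix.mul_one, shorted]

lemma shorted_le (hH : H.PosDef) (hV : Vᴴ * V = 1) : shorted H V ≤ H := by
  have hW : (shorted H V)ᴴ = shorted H V := (Matrix.nonneg_iff_posSemidef.1 (shorted_nonneg hH)).1
  have hHH : H * H⁻¹ = 1 := Matrix.mul_nonsing_inv _ hH.det_pos.ne'.isUnit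
  have hHH' : H⁻¹ * H = 1 := Matrix.nonsing_inv_mul _ hH.det_pos.ne'.isUnit
  have hsq : H - shorted H V =
      (1 - shorted H V * H⁻¹) * H * (1 - shorted H V * H⁻¹)ᴴ := by
    rw [Matrix.conjTranspose_sub, Matrix.conjTranspose_one, Matrix.conjTranspose_mul, hW,
      hH.inv.1.eq, Matrix.sub_mul, Matrix.mul_assoc _ H⁻¹ H, hHH', Matrix.one_mul, Matrix.mul_one,
      Matrix.mul_sub, Matrix.mul_one, Matrix.sub_mul, ← Matrix.mul_assoc, hHH, Matrix.one_mul,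
      ← Matrix.mul_assoc, shorted_mul_inv_mul_shorted hH hV, sub_self, sub_zero]
  rw [Matrix.le_iff, hsq]
  exact hH.posSemidef.mul_mul_conjTranspose_same _

lemma shorted_le_conj (hH : H.PosDef) (hV : Vᴴ * V = 1) :
    shorted H V ≤ V * Vᴴ * H * (V * Vᴴ) := by
  have hconj : V * Vᴴ * shorted H V * (V * Vᴴ) = shorted H V := by
    calc V * Vᴴ * shorted H V * (V * Vᴴ)
        = V * (Vᴴ * V) * (Vᴴ * H⁻¹ * V)⁻¹ * (Vᴴ * V) * Vᴴ := by
          simp only [shorted, Matrix.mul_assoc]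
      _ = shorted H V := by rw [hV, Matrix.mul_one, Matrix.mul_one, shorted]
  have hP : IsSelfAdjoint (V * Vᴴ) := Matrix.isHermitian_mul_conjTranspose_self V
  have h := hP.conjugate_le_conjugate (shorted_le hH hV)
  rwa [hconj] at h

lemma tendsto_shorted {α : Type*} {l : Filter α} {H : α → Matrix ι ι ℂ} (hH : ∀ k, (H k).PosDef)
    (hN : Tendsto H l (𝓝 N)) (hV : Vᴴ * V = 1) (hNV : N * V = 0) :
    Tendsto (fun k => shorted (H k) V) l (𝓝 0) := by
  have hconj : Tendsto (fun k => V * Vᴴ * H k * (V * Vᴴ)) l (𝓝 0) := by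
    have h := (hN.const_mul (V * Vᴴ)).mul_const (V * Vᴴ)
    rwa [Matrix.mul_assoc (V * Vᴴ) N, ← Matrix.mul_assoc N, hNV, Matrix.zero_mul,
      Matrix.mul_zero] at h
  exact squeeze_zero_norm (fun k => CStarAlgebra.norm_le_norm_of_nonneg_of_le
    (shorted_nonneg (hH k)) (shorted_le_conj (hH k) hV))
    (tendsto_zero_iff_norm_tendsto_zero.1 hconj)

end ShortedOperator

/-! ### Existence of a fixed point -/

section Existence

variable {n : ℕ} {ν : Measure (ProjSpace n)} {ε : ℝ} {G G' H N W : Matrix (Fin n) (Fin n) ℂ}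

/-- The regularization `(1 - ε) T_ν + ε` of Donaldson's map, whose values are bounded below. -/
def regMap (ν : Measure (ProjSpace n)) (ε : ℝ) (G : Matrix (Fin n) (Fin n) ℂ) :
    Matrix (Fin n) (Fin n) ℂ := (1 - ε) • donaldsonMap ν G + ε • (1 : Matrix (Fin n) (Fin n) ℂ)

lemma ne_zero_of_le_trace (hν : ν ≠ 0) (h : n ≤ N.trace.re) : N ≠ 0 := by
  rintro rfl
  have hn : (0 : ℝ) < n :=
    Nat.cast_pos.2 (Fin.pos_iff_nonempty.2 (nonempty_fin_of_measure_ne_zero hν))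
  simp only [Matrix.trace_zero, Complex.zero_re] at h
  linarith

variable [IsFiniteMeasure ν]

lemma smul_one_le_regMap (hε : ε ≤ 1) (hG : G.PosDef) :
    ε • (1 : Matrix (Fin n) (Fin n) ℂ) ≤ regMap ν ε G :=
  le_add_of_nonneg_left (smul_nonneg (sub_nonneg.2 hε) (donaldsonMap_nonneg ν hG))

lemma posDef_smul_one (hε : 0 < ε) : (ε • (1 : Matrix (Fin n) (Fin n) ℂ)).PosDef :=
  Matrix.PosDef.one.smul hε

lemma regMap_posDef (hε0 : 0 < ε) (hε1 : ε ≤ 1) (hG : G.PosDef) : (regMap ν ε G).PosDef :=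
  Matrix.PosDef.posSemidef_add
    ((Matrix.nonneg_iff_posSemidef.1 (donaldsonMap_nonneg ν hG)).smul (sub_nonneg.2 hε1))
    (posDef_smul_one hε0)

lemma regMap_mono (hε : ε ≤ 1) (hG : G.PosDef) (hG' : G'.PosDef) (h : G ≤ G') :
    regMap ν ε G ≤ regMap ν ε G' :=
  add_le_add_left
    (smul_le_smul_of_nonneg_left (donaldsonMap_mono ν hG hG' h) (sub_nonneg.2 hε)) _

lemma tendsto_donaldsonMap {α : Type*} {l : Filter α} {u : α → Matrix (Fin n) (Fin n) ℂ}
    (hG : G.PosDef) (hu : ∀ k, (u k).PosDef) (hlim : Tendsto u l (𝓝 G)) :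
    Tendsto (fun k => donaldsonMap ν (u k)) l (𝓝 (donaldsonMap ν G)) :=
  (continuousOn_donaldsonMap ν G hG.isStrictlyPositive).tendsto.comp
    (tendsto_nhdsWithin_iff.2 ⟨hlim, Eventually.of_forall fun k => (hu k).isStrictlyPositive⟩)

lemma tendsto_regMap {α : Type*} {l : Filter α} {u : α → Matrix (Fin n) (Fin n) ℂ} {δ : α → ℝ}
    (hG : G.PosDef) (hu : ∀ k, (u k).PosDef) (hlim : Tendsto u l (𝓝 G))
    (hδ : Tendsto δ l (𝓝 ε)) :
    Tendsto (fun k => regMap ν (δ k) (u k)) l (𝓝 (regMap ν ε G)) :=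
  ((hδ.const_sub 1).smul (tendsto_donaldsonMap hG hu hlim)).add (hδ.smul_const _)

lemma trace_mul_regMap_inv (ε : ℝ) (hH : H.PosDef) (B : Matrix (Fin n) (Fin n) ℂ) :
    (B * regMap ν ε H⁻¹).trace.re =
      (1 - ε) * (ratio ν * ∫ x, quad B x.rep / quad H x.rep ∂ν) + ε * B.trace.re := by
  rw [regMap, Matrix.mul_add, Matrix.mul_smul, Matrix.mul_smul, Matrix.trace_add,
    Matrix.trace_smul, Matrix.trace_smul, Matrix.mul_one, Complex.add_re, Complex.smul_re,
    Complex.smul_re, trace_mul_donaldsonMap ν hH.inv, inv_inv_of_posDef hH, smul_eq_mul,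
    smul_eq_mul]

lemma trace_mul_regMap_inv_self (hν : ν ≠ 0) (ε : ℝ) (hH : H.PosDef) :
    (H * regMap ν ε H⁻¹).trace.re = (1 - ε) * n + ε * H.trace.re := by
  have hone (x : ProjSpace n) : quad H x.rep / quad H x.rep = 1 :=
    div_self (quad_pos hH x.rep_nonzero).ne'
  simp only [trace_mul_regMap_inv ε hH, hone, integral_const, smul_eq_mul, mul_one,
    ratio_mul_real_univ hν]

lemma quad_div_mem_Icc (hW : 0 ≤ W) (hWH : W ≤ H) (hH : H.PosDef) (x : ProjSpace n) :
    quad W x.rep / quad H x.rep ∈ Set.Icc 0 1 :=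
  ⟨div_nonneg (quad_nonneg (Matrix.nonneg_iff_posSemidef.1 hW) _) (quad_pos hH x.rep_nonzero).le,
    (div_le_one (quad_pos hH x.rep_nonzero)).2 (quad_le_quad hWH _)⟩

lemma continuous_quad_div_quad (hH : H.PosDef) (B : Matrix (Fin n) (Fin n) ℂ) :
    Continuous fun x : ProjSpace n => quad B x.rep / quad H x.rep := by
  simpa only [inv_inv_of_posDef hH] using continuous_quad_div hH.inv B

lemma trace_mul_inv_le_of_subsolution (hε0 : 0 ≤ ε) (hε1 : ε ≤ 1) (hH : H.PosDef)
    (hsub : H⁻¹ ≤ regMap ν ε H⁻¹) (hW : 0 ≤ W) (hWH : W ≤ H) {K : Set (ProjSpace n)}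
    (hK : MeasurableSet K) :
    (W * H⁻¹).trace.re ≤
      ratio ν * (ν.real K + ∫ x in Kᶜ, quad W x.rep / quad H x.rep ∂ν) + W.trace.re := by
  set g : ProjSpace n → ℝ := fun x => quad W x.rep / quad H x.rep
  have hg : ∀ x, g x ∈ Set.Icc 0 1 := quad_div_mem_Icc hW hWH hH
  have hint : Integrable g ν := integrable_of_continuous ν (continuous_quad_div_quad hH W)
  have hsplit : ∫ x, g x ∂ν ≤ ν.real K + ∫ x in Kᶜ, g x ∂ν := by
    rw [← integral_add_compl hK hint]
    gcongr
    calc ∫ x in K, g x ∂ν ≤ ∫ _ in K, (1 : ℝ) ∂ν :=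
          setIntegral_mono hint.integrableOn (integrable_const _).integrableOn fun x => (hg x).2
      _ = ν.real K := by simp
  have htrace : 0 ≤ W.trace.re :=
    (Complex.le_def.1 (Matrix.nonneg_iff_posSemidef.1 hW).trace_nonneg).1
  have hintegral : 0 ≤ ratio ν * ∫ x, g x ∂ν :=
    mul_nonneg (ratio_nonneg ν) (integral_nonneg fun x => (hg x).1)
  calc (W * H⁻¹).trace.re ≤ (W * regMap ν ε H⁻¹).trace.re := trace_mul_mono hW hsub
    _ = (1 - ε) * (ratio ν * ∫ x, g x ∂ν) + ε * W.trace.re := trace_mul_regMap_inv ε hH W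
    _ ≤ ratio ν * ∫ x, g x ∂ν + W.trace.re :=
      add_le_add (mul_le_of_le_one_left hintegral (sub_le_self 1 hε0))
        (mul_le_of_le_one_left htrace hε1)
    _ ≤ _ := by gcongr; exact ratio_nonneg ν

lemma tendsto_setIntegral_quad_div {H W : ℕ → Matrix (Fin n) (Fin n) ℂ}
    (hH : ∀ k, (H k).PosDef) (hW : ∀ k, 0 ≤ W k) (hWH : ∀ k, W k ≤ H k)
    (hN : Tendsto H atTop (𝓝 N)) (hW0 : Tendsto W atTop (𝓝 0)) (hNpos : N.PosSemidef) :
    Tendsto (fun k => ∫ x in (projSubspace (matKer N))ᶜ, quad (W k) x.rep / quad (H k) x.rep ∂ν)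
      atTop (𝓝 0) := by
  have hmeas : MeasurableSet (projSubspace (matKer N))ᶜ :=
    (isClosed_projSubspace _).measurableSet.compl
  have hbound (k : ℕ) (x : ProjSpace n) : ‖quad (W k) x.rep / quad (H k) x.rep‖ ≤ 1 := by
    obtain ⟨h0, h1⟩ := quad_div_mem_Icc (hW k) (hWH k) (hH k) x
    rwa [Real.norm_of_nonneg h0]
  have hpointwise : ∀ᵐ x ∂ν.restrict (projSubspace (matKer N))ᶜ,
      Tendsto (fun k => quad (W k) x.rep / quad (H k) x.rep) atTop (𝓝 0) := by
    filter_upwards [ae_restrict_mem hmeas] with x hx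
    have hne : quad N x.rep ≠ 0 := fun h =>
      hx (mem_projSubspace.2 (mulVec_eq_zero_of_quad_eq_zero hNpos h))
    have hzero : quad (0 : Matrix (Fin n) (Fin n) ℂ) x.rep = 0 := by simp [quad]
    have h := (((continuous_quad x.rep).tendsto 0).comp hW0).div
      (((continuous_quad x.rep).tendsto N).comp hN) hne
    rwa [hzero, zero_div] at h
  simpa using tendsto_integral_of_dominated_convergence (fun _ => (1 : ℝ))
    (fun k => (continuous_quad_div_quad (hH k) (W k)).aestronglyMeasurable) (integrable_const 1)
    (fun k => Eventually.of_forall (hbound k)) hpointwise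

-- Test the subsolution inequality against the shorted operators of `H k` on `ker N`, which tend to
-- zero: in the limit, `dim (ker N) ≤ R_ν ν(ℙ(ker N))`.
lemma posDef_of_tendsto (hs : IsStable ν) (hν : ν ≠ 0) {H : ℕ → Matrix (Fin n) (Fin n) ℂ}
    (hH : ∀ k, (H k).PosDef) (hN : Tendsto H atTop (𝓝 N)) (hN0 : N ≠ 0) {ε : ℕ → ℝ}
    (hε : ∀ k, ε k ∈ Set.Icc 0 1) (hsub : ∀ k, (H k)⁻¹ ≤ regMap ν (ε k) (H k)⁻¹) : N.PosDef := by
  have hNpos : N.PosSemidef := Matrix.nonneg_iff_posSemidef.1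
    (ge_of_tendsto' hN fun k => (hH k).posSemidef.nonneg)
  by_contra hdeg
  have hbot : matKer N ≠ ⊥ := fun h => hdeg (posDef_of_matKer_eq_bot hNpos h)
  have htop : matKer N ≠ ⊤ := fun h => hN0 (matKer_eq_top.1 h)
  obtain ⟨V, hV, hVker⟩ := exists_isometry_into (matKer N)
  have hNV : N * V = 0 := Matrix.ext fun i j => congrFun (hVker j) i
  have hW0 := tendsto_shorted hH hN hV hNV
  have htrace : Tendsto (fun k => (shorted (H k) V).trace.re) atTop (𝓝 0) :=
    (continuous_re_trace.tendsto' _ _ (by simp)).comp hW0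
  have hintegral := tendsto_setIntegral_quad_div (ν := ν) hH (fun k => shorted_nonneg (hH k))
    (fun k => shorted_le (hH k) hV) hN hW0 hNpos
  have hbound (k : ℕ) := trace_mul_inv_le_of_subsolution (hε k).1 (hε k).2 (hH k) (hsub k)
    (shorted_nonneg (hH k)) (shorted_le (hH k) hV)
    (isClosed_projSubspace (matKer N)).measurableSet
  simp only [trace_shorted_mul_inv (hH _) hV, Fintype.card_fin, Complex.natCast_re] at hbound
  have hlim := ge_of_tendsto' (((hintegral.const_add _).const_mul (ratio ν)).add htrace) hbound
  rw [add_zero, add_zero] at hlim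
  exact (hs.ratio_mul_real_lt hν hbot htop).not_ge hlim

lemma le_trace_of_subsolution (hν : ν ≠ 0) (hε : 0 < ε) (hH : H.PosDef)
    (hsub : H⁻¹ ≤ regMap ν ε H⁻¹) : n ≤ H.trace.re := by
  have h := trace_mul_mono hH.posSemidef.nonneg hsub
  rw [trace_mul_regMap_inv_self hν ε hH, Matrix.mul_nonsing_inv _ hH.det_pos.ne'.isUnit,
    Matrix.trace_one, Fintype.card_fin, Complex.natCast_re] at h
  exact le_of_mul_le_mul_left (by linarith) hε

lemma trace_eq_of_regMap_inv_eq (hν : ν ≠ 0) (hε : ε ≠ 0) (hH : H.PosDef)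
    (hfix : regMap ν ε H⁻¹ = H⁻¹) : H.trace.re = n := by
  have h := trace_mul_regMap_inv_self hν ε hH
  rw [hfix, Matrix.mul_nonsing_inv _ hH.det_pos.ne'.isUnit, Matrix.trace_one, Fintype.card_fin,
    Complex.natCast_re] at h
  exact mul_left_cancel₀ hε (by linarith)

-- Iterate from the least possible value `ε`: the iterates are increasing subsolutions, and their
-- inverses decrease to a nondegenerate limit.
lemma exists_regMap_eq (hs : IsStable ν) (hν : ν ≠ 0) (hε0 : 0 < ε) (hε1 : ε ≤ 1) :
    ∃ G : Matrix (Fin n) (Fin n) ℂ, G.PosDef ∧ regMap ν ε G = G := by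
  let G : ℕ → Matrix (Fin n) (Fin n) ℂ := fun k => (regMap ν ε)^[k] (ε • 1)
  have hsucc (k : ℕ) : G (k + 1) = regMap ν ε (G k) := Function.iterate_succ_apply' _ _ _
  have hpos (k : ℕ) : (G k).PosDef := by
    induction k with
    | zero => exact posDef_smul_one hε0
    | succ k ih => exact hsucc k ▸ regMap_posDef hε0 hε1 ih
  have hle (k : ℕ) : G k ≤ G (k + 1) := by
    induction k with
    | zero => exact hsucc 0 ▸ smul_one_le_regMap hε1 (hpos 0)
    | succ k ih =>
      rw [hsucc k, hsucc (k + 1)]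
      exact regMap_mono hε1 (hpos k) (hpos (k + 1)) ih
  have hsub (k : ℕ) : (G k)⁻¹⁻¹ ≤ regMap ν ε (G k)⁻¹⁻¹ := by
    rw [inv_inv_of_posDef (hpos k), ← hsucc]
    exact hle k
  obtain ⟨N, -, hN⟩ := exists_tendsto_of_antitone (u := fun k => (G k)⁻¹)
    (antitone_nat_of_succ_le fun k => inv_le_inv_of_le (hpos k) (hle k))
    fun k => (hpos k).inv.posSemidef.nonneg
  have htrace : n ≤ N.trace.re :=
    ge_of_tendsto' ((continuous_re_trace.tendsto N).comp hN) fun k =>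
      le_trace_of_subsolution hν hε0 (hpos k).inv (hsub k)
  have hNpos : N.PosDef := posDef_of_tendsto hs hν (fun k => (hpos k).inv) hN
    (ne_zero_of_le_trace hν htrace) (fun _ => ⟨hε0.le, hε1⟩) hsub
  have hG : Tendsto G atTop (𝓝 N⁻¹) := by
    simpa only [inv_inv_of_posDef (hpos _)] using tendsto_matrix_inv hNpos hN
  refine ⟨N⁻¹, hNpos.inv, tendsto_nhds_unique ?_ ((tendsto_add_atTop_iff_nat 1).2 hG)⟩
  simpa only [hsucc] using tendsto_regMap hNpos.inv hpos hG tendsto_const_nhds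

lemma exists_donaldsonMap_eq (hs : IsStable ν) (hν : ν ≠ 0) :
    ∃ G : Matrix (Fin n) (Fin n) ℂ, G.PosDef ∧ donaldsonMap ν G = G := by
  let ε : ℕ → ℝ := fun k => 1 / (k + 1)
  have hε0 (k : ℕ) : 0 < ε k := Nat.one_div_pos_of_nat
  have hε1 (k : ℕ) : ε k ≤ 1 := (div_le_one (by positivity)).2 (by simp)
  choose G hpos hfix using fun k => exists_regMap_eq hs hν (hε0 k) (hε1 k)
  have hinv (k : ℕ) : (G k)⁻¹⁻¹ = G k := inv_inv_of_posDef (hpos k)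
  have hfix' (k : ℕ) : regMap ν (ε k) (G k)⁻¹⁻¹ = (G k)⁻¹⁻¹ := by rw [hinv, hfix]
  have htrace (k : ℕ) : (G k)⁻¹.trace.re = n :=
    trace_eq_of_regMap_inv_eq hν (hε0 k).ne' (hpos k).inv (hfix' k)
  obtain ⟨N, -, φ, hφ, hN⟩ := (isCompact_closedBall (0 : Matrix (Fin n) (Fin n) ℂ) n).tendsto_subseq
    (x := fun k => (G k)⁻¹) fun k => by
      rw [mem_closedBall_zero_iff, ← htrace k]
      exact norm_le_re_trace (hpos k).inv.posSemidef.nonneg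
  have hNtrace : n ≤ N.trace.re := ge_of_tendsto'
    ((continuous_re_trace.tendsto N).comp hN) fun k => (htrace (φ k)).ge
  have hNpos : N.PosDef := posDef_of_tendsto hs hν (fun k => (hpos (φ k)).inv) hN
    (ne_zero_of_le_trace hν hNtrace) (fun k => ⟨(hε0 (φ k)).le, hε1 (φ k)⟩) fun k => (hfix' _).ge
  have hG : Tendsto (fun k => G (φ k)) atTop (𝓝 N⁻¹) := by
    simpa only [Function.comp_apply, hinv] using tendsto_matrix_inv hNpos hN
  have hε : Tendsto (fun k => ε (φ k)) atTop (𝓝 0) :=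
    tendsto_one_div_add_atTop_nhds_zero_nat.comp hφ.tendsto_atTop
  have hlim : regMap ν 0 N⁻¹ = N⁻¹ := by
    refine tendsto_nhds_unique ?_ hG
    simpa only [hfix] using tendsto_regMap (ν := ν) hNpos.inv (fun k => hpos (φ k)) hG hε
  exact ⟨N⁻¹, hNpos.inv, by simpa [regMap] using hlim⟩

end Existence

/-! ### Monotone homogeneous maps of the positive cone -/

section ConeMap

variable {A : Type*} [CStarAlgebra A] [PartialOrder A]

/-- An order-preserving, positively homogeneous self-map of the cone of strictly positive elements
of a C⋆-algebra. Its values outside of this cone are irrelevant. -/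
structure IsConeMap (T : A → A) : Prop where
  isStrictlyPositive : ∀ a, IsStrictlyPositive a → IsStrictlyPositive (T a)
  monotoneOn : MonotoneOn T {a | IsStrictlyPositive a}
  map_smul : ∀ a, IsStrictlyPositive a → ∀ c : ℝ, 0 < c → T (c • a) = c • T a

namespace IsConeMap

variable {T : A → A} {a p : A}

lemma iterate (hT : IsConeMap T) (j : ℕ) : IsConeMap T^[j] := by
  induction j with
  | zero => exact ⟨fun _ h => h, fun _ _ _ _ h => h, fun _ _ _ _ => rfl⟩
  | succ j ih =>
    simp only [Function.iterate_succ']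
    refine ⟨fun a ha => hT.isStrictlyPositive _ (ih.isStrictlyPositive a ha),
      fun a ha b hb h => ?_, fun a ha c hc => ?_⟩
    · exact hT.monotoneOn (ih.isStrictlyPositive a ha) (ih.isStrictlyPositive b hb)
        (ih.monotoneOn ha hb h)
    · rw [Function.comp_apply, ih.map_smul a ha c hc,
        hT.map_smul _ (ih.isStrictlyPositive a ha) c hc, Function.comp_apply]

lemma map_smul_fixed (hT : IsConeMap T) (hp : IsStrictlyPositive p) (hfix : T p = p) {c : ℝ}
    (hc : 0 < c) : T (c • p) = c • p := by
  rw [hT.map_smul p hp c hc, hfix]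

variable [StarOrderedRing A]

lemma iterate_le_smul (hT : IsConeMap T) (hp : IsStrictlyPositive p) (hfix : T p = p)
    (ha : IsStrictlyPositive a) {c : ℝ} (hc : 0 < c) (h : a ≤ c • p) (j : ℕ) :
    T^[j] a ≤ c • p := by
  rw [← Function.iterate_fixed (hT.map_smul_fixed hp hfix hc) j]
  exact (hT.iterate j).monotoneOn ha (hp.smul hc) h

lemma smul_le_iterate (hT : IsConeMap T) (hp : IsStrictlyPositive p) (hfix : T p = p)
    (ha : IsStrictlyPositive a) {c : ℝ} (hc : 0 < c) (h : c • p ≤ a) (j : ℕ) :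
    c • p ≤ T^[j] a := by
  rw [← Function.iterate_fixed (hT.map_smul_fixed hp hfix hc) j]
  exact (hT.iterate j).monotoneOn (hp.smul hc) ha h

lemma tendsto_comp (hT : IsConeMap T) {α : Type*} {l : Filter α} {u : α → A}
    (hu : ∀ k, IsStrictlyPositive (u k)) (ha : IsStrictlyPositive a) (hlim : Tendsto u l (𝓝 a)) :
    Tendsto (fun k => T (u k)) l (𝓝 (T a)) :=
  (continuousOn_of_monotoneOn_of_map_smul hT.monotoneOn hT.map_smul a ha).tendsto.comp
    (tendsto_nhdsWithin_iff.2 ⟨hlim, Eventually.of_forall hu⟩)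

lemma tendsto_iterate_of_tendsto_subseq (hT : IsConeMap T) (hp : IsStrictlyPositive p)
    (hfix : T p = p) (ha : IsStrictlyPositive a) {φ : ℕ → ℕ}
    (hlim : Tendsto (fun k => T^[φ k] a) atTop (𝓝 p)) :
    Tendsto (fun r => T^[r] a) atTop (𝓝 p) := by
  refine tendsto_of_eventually_smul_le_of_le_smul fun ε hε0 hε1 => ?_
  have hpos (r : ℕ) : IsStrictlyPositive (T^[r] a) := (hT.iterate r).isStrictlyPositive a ha
  obtain ⟨k, hl, hr⟩ := (eventually_smul_le_and_le_smul
    (Eventually.of_forall fun k => (hpos (φ k)).isSelfAdjoint) hp hlim hε0).exists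
  filter_upwards [eventually_ge_atTop (φ k)] with r hkr
  obtain ⟨s, rfl⟩ := Nat.exists_eq_add_of_le' hkr
  rw [Function.iterate_add_apply]
  exact ⟨hT.smul_le_iterate hp hfix (hpos _) (sub_pos.2 hε1) hl s,
    hT.iterate_le_smul hp hfix (hpos _) (by positivity) hr s⟩

lemma exists_subseq_tendsto_iterate [ProperSpace A] (hT : IsConeMap T)
    (hp : IsStrictlyPositive p) (hfix : T p = p) (ha : IsStrictlyPositive a) :
    ∃ x, IsStrictlyPositive x ∧ ∃ φ : ℕ → ℕ, StrictMono φ ∧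
      Tendsto (fun k => T^[φ k] a) atTop (𝓝 x) := by
  obtain ⟨c, hc, hle⟩ := exists_pos_smul_le hp ha.isSelfAdjoint
  obtain ⟨d, hd, hge⟩ := exists_pos_smul_le ha hp.isSelfAdjoint
  have hle' : a ≤ c⁻¹ • p := (le_inv_smul_iff_of_pos hc).2 hle
  obtain ⟨x, -, φ, hφ, hx⟩ := (isCompact_closedBall (0 : A) ‖c⁻¹ • p‖).tendsto_subseq
    (x := fun r => T^[r] a) fun r => by
      rw [mem_closedBall_zero_iff]
      exact CStarAlgebra.norm_le_norm_of_nonneg_of_le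
        ((hT.iterate r).isStrictlyPositive a ha).nonneg
        (hT.iterate_le_smul hp hfix ha (inv_pos.2 hc) hle' r)
  exact ⟨x, (hp.smul hd).of_le (ge_of_tendsto' hx fun k =>
    hT.smul_le_iterate hp hfix ha hd hge (φ k)), φ, hφ, hx⟩

lemma le_smul_of_tendsto_subseq (hT : IsConeMap T) (hp : IsStrictlyPositive p) (hfix : T p = p)
    (ha : IsStrictlyPositive a) {φ : ℕ → ℕ} (hφ : Tendsto φ atTop atTop) {x : A}
    (hlim : Tendsto (fun k => T^[φ k] a) atTop (𝓝 x)) {c : ℝ} (hc : 0 < c) {r : ℕ}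
    (hr : T^[r] a ≤ c • p) : x ≤ c • p := by
  refine le_of_tendsto hlim ?_
  filter_upwards [hφ.eventually_ge_atTop r] with k hk
  obtain ⟨m, hm⟩ := Nat.exists_eq_add_of_le' hk
  rw [hm, Function.iterate_add_apply]
  exact hT.iterate_le_smul hp hfix ((hT.iterate r).isStrictlyPositive a ha) hc hr m

-- `b` is the infimum of the `c` with `T^[r] a ≤ c • p` for some `r`; by minimality, a limit point
-- of the orbit cannot satisfy the second alternative of `hcontact`.
theorem exists_tendsto_iterate [ProperSpace A] (hT : IsConeMap T) (hp : IsStrictlyPositive p)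
    (hfix : T p = p)
    (hcontact : ∀ x, IsStrictlyPositive x → ∀ b : ℝ, 0 < b → x ≤ b • p →
      ∃ j, T^[j] x = b • p ∨ ∃ c < b, T^[j] x ≤ c • p)
    (ha : IsStrictlyPositive a) :
    ∃ b : ℝ, 0 < b ∧ Tendsto (fun r => T^[r] a) atTop (𝓝 (b • p)) := by
  cases subsingleton_or_nontrivial A
  · exact ⟨1, one_pos, tendsto_const_nhds.congr fun r => Subsingleton.elim _ _⟩
  have hpos (r : ℕ) : IsStrictlyPositive (T^[r] a) := (hT.iterate r).isStrictlyPositive a ha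
  have hp0 : 0 < p := hp.nonneg.lt_of_ne' hp.isUnit.ne_zero
  obtain ⟨d, hd, hge⟩ := exists_pos_smul_le ha hp.isSelfAdjoint
  obtain ⟨c₀, hc₀, hle⟩ := exists_pos_smul_le hp ha.isSelfAdjoint
  let s : Set ℝ := {c | ∃ r, T^[r] a ≤ c • p}
  have hlower : ∀ c ∈ s, d ≤ c := fun c ⟨r, hr⟩ => le_of_smul_le_smul_of_pos_right
    ((hT.smul_le_iterate hp hfix ha hd hge r).trans hr) hp0
  have hs : c₀⁻¹ ∈ s := ⟨0, (le_inv_smul_iff_of_pos hc₀).2 hle⟩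
  have hb : 0 < sInf s := hd.trans_le (le_csInf ⟨_, hs⟩ hlower)
  obtain ⟨x, hx, φ, hφ, hlim⟩ := hT.exists_subseq_tendsto_iterate hp hfix ha
  have hxle (c : ℝ) (hc : sInf s < c) : x ≤ c • p := by
    obtain ⟨c', ⟨r, hr⟩, hc'⟩ := exists_lt_of_csInf_lt ⟨_, hs⟩ hc
    exact hT.le_smul_of_tendsto_subseq hp hfix ha hφ.tendsto_atTop hlim (hb.trans hc)
      (hr.trans (smul_le_smul_of_nonneg_right hc'.le hp.nonneg))
  have hxb : x ≤ sInf s • p := ge_of_tendsto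
    ((tendsto_id.mono_left nhdsWithin_le_nhds).smul_const p)
    (eventually_nhdsWithin_of_forall (s := Set.Ioi (sInf s)) hxle)
  obtain ⟨j, hj⟩ := hcontact x hx _ hb hxb
  have hlim' : Tendsto (fun k => T^[j + φ k] a) atTop (𝓝 (T^[j] x)) := by
    simpa only [Function.iterate_add_apply] using
      (hT.iterate j).tendsto_comp (fun k => hpos (φ k)) hx hlim
  rcases hj with hj | ⟨c, hcb, hc⟩
  · exact ⟨sInf s, hb, hT.tendsto_iterate_of_tendsto_subseq (hp.smul hb)
      (hT.map_smul_fixed hp hfix hb) ha (hj ▸ hlim')⟩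
  · have hδ : 0 < (sInf s - c) / 2 := by linarith
    obtain ⟨k, hk⟩ := (eventually_le_add_smul (Eventually.of_forall fun k => (hpos _).isSelfAdjoint)
      ((hT.iterate j).isStrictlyPositive x hx).isSelfAdjoint hp hlim' hδ).exists
    have hmem : c + (sInf s - c) / 2 ∈ s :=
      ⟨_, hk.trans ((add_le_add_left hc _).trans_eq (add_smul c _ p).symm)⟩
    have hmin : sInf s ≤ c + (sInf s - c) / 2 := csInf_le ⟨d, hlower⟩ hmem
    linarith

end IsConeMap

end ConeMap

/-! ### Convergence of the iterates -/

section Convergence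

variable {n : ℕ} {ν : Measure (ProjSpace n)} [IsFiniteMeasure ν]
  {P G H : Matrix (Fin n) (Fin n) ℂ}

lemma isConeMap_donaldsonMap (hs : IsStable ν) (hν : ν ≠ 0) : IsConeMap (donaldsonMap ν) where
  isStrictlyPositive _ hG :=
    (donaldsonMap_posDef hs hν (Matrix.isStrictlyPositive_iff_posDef.1 hG)).isStrictlyPositive
  monotoneOn _ hG _ hH h := donaldsonMap_mono ν (Matrix.isStrictlyPositive_iff_posDef.1 hG)
    (Matrix.isStrictlyPositive_iff_posDef.1 hH) h
  map_smul _ hG _ hc := donaldsonMap_smul ν (Matrix.isStrictlyPositive_iff_posDef.1 hG) hc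

lemma inv_mulVec_mem_matKer_sub (hG : G.PosDef) (hH : H.PosDef) (hle : G ≤ H) {z : Fin n → ℂ}
    (hz : quad G⁻¹ z = quad H⁻¹ z) : H⁻¹ *ᵥ z ∈ matKer (H - G) := by
  have hker : (G⁻¹ - H⁻¹) *ᵥ z = 0 := mulVec_eq_zero_of_quad_eq_zero
    (Matrix.le_iff.1 (inv_le_inv_of_le hG hle)) (by rw [quad_sub, hz, sub_self])
  rw [Matrix.sub_mulVec, sub_eq_zero] at hker
  rw [mem_matKer, Matrix.sub_mulVec, mulVec_inv_mulVec hH, ← hker, mulVec_inv_mulVec hG, sub_self]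

lemma ae_of_mem_matKer_sub (hν : ν ≠ 0) (hG : G.PosDef) (hH : H.PosDef) (hle : G ≤ H)
    {v : Fin n → ℂ} (hv : v ∈ matKer (donaldsonMap ν H - donaldsonMap ν G)) :
    ∀ᵐ x ∂ν, star v ⬝ᵥ x.rep = 0 ∨ H⁻¹ *ᵥ x.rep ∈ matKer (H - G) := by
  let q (M : Matrix (Fin n) (Fin n) ℂ) (x : ProjSpace n) : ℝ :=
    ‖star v ⬝ᵥ x.rep‖ ^ 2 / quad M⁻¹ x.rep
  have hint {M : Matrix (Fin n) (Fin n) ℂ} (hM : M.PosDef) : Integrable (q M) ν := by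
    simp only [q, ← quad_vecMulVec_star]
    exact integrable_of_continuous ν (continuous_quad_div hM _)
  have hnonneg (x : ProjSpace n) : 0 ≤ q H x - q G x := sub_nonneg.2 <|
    div_le_div_of_nonneg_left (by positivity) (quad_inv_rep_pos hH x)
      (quad_le_quad (inv_le_inv_of_le hG hle) _)
  have hquad : quad (donaldsonMap ν H) v = quad (donaldsonMap ν G) v := by
    rw [← sub_eq_zero, ← quad_sub, quad, mem_matKer.1 hv, dotProduct_zero, Complex.zero_re]
  have hzero : ∫ x, (q H x - q G x) ∂ν = 0 := by
    rw [quad_donaldsonMap ν hH, quad_donaldsonMap ν hG] at hquad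
    rw [integral_sub (hint hH) (hint hG), sub_eq_zero]
    exact mul_left_cancel₀ (ratio_pos hν).ne' hquad
  filter_upwards [(integral_eq_zero_iff_of_nonneg hnonneg ((hint hH).sub (hint hG))).1 hzero]
    with x hx
  refine or_iff_not_imp_left.2 fun hz => inv_mulVec_mem_matKer_sub hG hH hle ?_
  have hdiv : q G x = q H x := (sub_eq_zero.1 hx).symm
  simp only [q, div_eq_mul_inv] at hdiv
  exact inv_injective (mul_left_cancel₀ (pow_ne_zero 2 (norm_ne_zero_iff.2 hz)) hdiv)

lemma matKer_sub_donaldsonMap_le (hν : ν ≠ 0) (hG : G.PosDef) (hH : H.PosDef)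
    (hfix : donaldsonMap ν H = H) (hle : G ≤ H) :
    matKer (H - donaldsonMap ν G) ≤ matKer (H - G) := by
  intro v hv
  have hint : Integrable (kern H) ν := integrable_of_continuous ν (continuous_kern hH)
  have hae : (fun x => ((H - G) * H⁻¹) *ᵥ kern H x *ᵥ v) =ᵐ[ν] 0 := by
    filter_upwards [ae_of_mem_matKer_sub hν hG hH hle (hfix.symm ▸ hv)] with x hx
    rw [kern, Matrix.smul_mulVec, Matrix.vecMulVec_mulVec, ← Matrix.mulVec_mulVec]
    rcases hx with hx | hx
    · have : star x.rep ⬝ᵥ v = 0 := by rw [Matrix.star_dotProduct, hx, star_zero]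
      simp [this]
    · simp only [Matrix.mulVec_smul, op_smul_eq_smul, mem_matKer.1 hx, smul_zero, Pi.zero_apply]
  calc (H - G) *ᵥ v = ((H - G) * H⁻¹) *ᵥ donaldsonMap ν H *ᵥ v := by
        rw [hfix, Matrix.mulVec_mulVec, Matrix.mul_assoc,
          Matrix.nonsing_inv_mul _ hH.det_pos.ne'.isUnit, Matrix.mul_one]
    _ = ratio ν • ∫ x, ((H - G) * H⁻¹) *ᵥ kern H x *ᵥ v ∂ν := by
        rw [donaldsonMap_eq_integral ν hH, Matrix.smul_mulVec, Matrix.mulVec_smul,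
          mulVec_integral_mulVec _ hint]
    _ = 0 := by rw [integral_eq_zero_of_ae hae, smul_zero]

lemma disjoint_map_mulVecLin_orth (hH : H.PosDef) (S : Submodule ℂ (Fin n → ℂ)) :
    Disjoint (S.map H.mulVecLin) (orth (S : Set (Fin n → ℂ))) := by
  rw [Submodule.disjoint_def]
  rintro _ ⟨v, hv, rfl⟩ hz
  have hq : quad H v = 0 := by
    rw [quad, ← Matrix.mulVecLin_apply, mem_orth.1 hz v hv, Complex.zero_re]
  rcases eq_or_ne v 0 with rfl | hv0
  · exact map_zero _
  · exact absurd hq (quad_pos hH hv0).ne'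

lemma ae_mem_orth_or {ν : Measure (ProjSpace n)} {S : Submodule ℂ (Fin n → ℂ)}
    {p : ProjSpace n → Prop} (h : ∀ v ∈ S, ∀ᵐ x ∂ν, star v ⬝ᵥ x.rep = 0 ∨ p x) :
    ∀ᵐ x ∂ν, x.rep ∈ orth (S : Set (Fin n → ℂ)) ∨ p x := by
  obtain ⟨t, rfl⟩ := IsNoetherian.noetherian S
  have hall : ∀ᵐ x ∂ν, ∀ v ∈ t, star v ⬝ᵥ x.rep = 0 ∨ p x :=
    (ae_ball_iff t.countable_toSet).2 fun v hv => h v (Submodule.subset_span hv)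
  filter_upwards [hall] with x hx
  refine or_iff_not_imp_right.2 fun hp v hv => ?_
  induction hv using Submodule.span_induction with
  | mem v hv => exact (hx v hv).resolve_right hp
  | zero => rw [star_zero, zero_dotProduct]
  | add u v _ _ hu hv => rw [star_add, add_dotProduct, hu, hv, add_zero]
  | smul c v _ hv => rw [star_smul, smul_dotProduct, hv, smul_zero]

lemma eq_of_matKer_sub_donaldsonMap_eq (hs : IsStable ν) (hν : ν ≠ 0) (hG : G.PosDef)
    (hH : H.PosDef) (hfix : donaldsonMap ν H = H) (hle : G ≤ H)
    (heq : matKer (H - donaldsonMap ν G) = matKer (H - G)) (hbot : matKer (H - G) ≠ ⊥) :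
    G = H := by
  by_contra hne
  have hinj : Function.Injective H.mulVecLin := Matrix.mulVec_injective_of_isUnit hH.isUnit
  have htop : matKer (H - G) ≠ ⊤ := fun h => hne (sub_eq_zero.1 (matKer_eq_top.1 h)).symm
  have hcomap := Submodule.comap_map_eq_of_injective hinj (matKer (H - G))
  refine hs.not_ae_mem_or hν (S := (matKer (H - G)).map H.mulVecLin)
    (S' := orth (matKer (H - G) : Set (Fin n → ℂ))) ?_ ?_ ?_ ?_
  · intro h
    rw [h, Submodule.comap_bot, LinearMap.ker_eq_bot.2 hinj] at hcomap
    exact hbot hcomap.symm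
  · intro h
    rw [h, Submodule.comap_top] at hcomap
    exact htop hcomap.symm
  · simpa using Submodule.finrank_add_finrank_le_of_disjoint
      (disjoint_map_mulVecLin_orth hH (matKer (H - G)))
  · filter_upwards [ae_mem_orth_or fun v hv =>
      ae_of_mem_matKer_sub hν hG hH hle (by rwa [hfix, heq])] with x hx
    refine hx.symm.imp (fun hx => mem_projSubspace.2 ⟨_, hx, ?_⟩) mem_projSubspace.2
    exact mulVec_inv_mulVec hH _

-- The contact spaces `ker (b P - T^j X)` decrease with `j`, so two consecutive ones agree.
lemma exists_iterate_donaldsonMap_eq_or_le (hs : IsStable ν) (hν : ν ≠ 0) (hP : P.PosDef)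
    (hfix : donaldsonMap ν P = P) (hG : G.PosDef) {b : ℝ} (hb : 0 < b) (hle : G ≤ b • P) :
    ∃ j, (donaldsonMap ν)^[j] G = b • P ∨ ∃ c < b, (donaldsonMap ν)^[j] G ≤ c • P := by
  have hT := isConeMap_donaldsonMap hs hν
  have hbP : (b • P).PosDef := hP.smul hb
  have hfix' : donaldsonMap ν (b • P) = b • P := hT.map_smul_fixed hP.isStrictlyPositive hfix hb
  have hpos (j : ℕ) : ((donaldsonMap ν)^[j] G).PosDef := Matrix.isStrictlyPositive_iff_posDef.1
    ((hT.iterate j).isStrictlyPositive G hG.isStrictlyPositive)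
  have hle' (j : ℕ) : (donaldsonMap ν)^[j] G ≤ b • P :=
    hT.iterate_le_smul hP.isStrictlyPositive hfix hG.isStrictlyPositive hb hle j
  have hanti : Antitone fun j => matKer (b • P - (donaldsonMap ν)^[j] G) :=
    antitone_nat_of_succ_le fun j => by
      rw [Function.iterate_succ_apply']
      exact matKer_sub_donaldsonMap_le hν (hpos j) hbP hfix' (hle' j)
  obtain ⟨j, hj⟩ := IsArtinian.monotone_stabilizes
    (⟨_, hanti.dual_right⟩ : ℕ →o (Submodule ℂ (Fin n → ℂ))ᵒᵈ)
  refine ⟨j, or_iff_not_imp_left.2 fun hne => ?_⟩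
  have heq : matKer (b • P - donaldsonMap ν ((donaldsonMap ν)^[j] G)) =
      matKer (b • P - (donaldsonMap ν)^[j] G) := by
    rw [← Function.iterate_succ_apply' (donaldsonMap ν)]
    exact (hj (j + 1) j.le_succ).symm
  have hker : matKer (b • P - (donaldsonMap ν)^[j] G) = ⊥ := by
    by_contra hbot
    exact hne (eq_of_matKer_sub_donaldsonMap_eq hs hν (hpos j) hbP hfix' (hle' j) heq hbot)
  obtain ⟨c, hc, hcP⟩ := exists_pos_smul_le
    (posDef_of_matKer_eq_bot (Matrix.le_iff.1 (hle' j)) hker).isStrictlyPositive hP.1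
  exact ⟨b - c, by linarith, by rw [sub_smul]; exact le_sub_comm.1 hcP⟩

theorem exists_tendsto_iterate_donaldsonMap (hs : IsStable ν) (hν : ν ≠ 0) (hP : P.PosDef)
    (hfix : donaldsonMap ν P = P) (hG : G.PosDef) :
    ∃ b : ℝ, 0 < b ∧ Tendsto (fun r => (donaldsonMap ν)^[r] G) atTop (𝓝 (b • P)) :=
  (isConeMap_donaldsonMap hs hν).exists_tendsto_iterate hP.isStrictlyPositive hfix
    (fun _ hX _ hb hle => exists_iterate_donaldsonMap_eq_or_le hs hν hP hfix
      (Matrix.isStrictlyPositive_iff_posDef.1 hX) hb hle)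
    hG.isStrictlyPositive

lemma eq_smul_of_donaldsonMap_eq (hs : IsStable ν) (hν : ν ≠ 0) (hP : P.PosDef)
    (hfixP : donaldsonMap ν P = P) (hG : G.PosDef) (hfixG : donaldsonMap ν G = G) :
    ∃ c : ℝ, 0 < c ∧ G = c • P := by
  obtain ⟨c, hc, hlim⟩ := exists_tendsto_iterate_donaldsonMap hs hν hP hfixP hG
  simp only [Function.iterate_fixed hfixG] at hlim
  exact ⟨c, hc, tendsto_nhds_unique tendsto_const_nhds hlim⟩

end Convergence

/-! ### The spectrum of the quantum channel -/

section SelfAdjoint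

variable {K V : Type*} [Field K] [AddCommGroup V] [Module K V]
  {B : LinearMap.BilinForm K V} {f : Module.End K V}

lemma maxGenEigenspace_eq_eigenspace_of_isSelfAdjoint (hB : ∀ x, B x x = 0 → x = 0)
    (hf : B.IsSelfAdjoint f) (μ : K) : f.maxGenEigenspace μ = f.eigenspace μ := by
  set g := f - μ • (1 : Module.End K V)
  have hg (x y : V) : B (g x) y = B x (g y) := by
    simp only [g, LinearMap.sub_apply, LinearMap.smul_apply, Module.End.one_apply, map_sub,
      map_smul, hf x y]
  have hker : LinearMap.ker (g ^ 1) = LinearMap.ker (g ^ 2) := by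
    refine le_antisymm (fun x hx => ?_) fun x hx => ?_
    · rw [pow_one, LinearMap.mem_ker] at hx
      rw [LinearMap.mem_ker, pow_two, Module.End.mul_apply, hx, map_zero]
    · rw [LinearMap.mem_ker, pow_two, Module.End.mul_apply] at hx
      rw [pow_one, LinearMap.mem_ker]
      exact hB _ (by rw [hg, hx, map_zero])
  refine le_antisymm (fun x hx => ?_) (f.genEigenspace_le_maximal μ 1)
  obtain ⟨k, hk⟩ := (Module.End.mem_maxGenEigenspace f μ x).1 hx
  have hx1 : x ∈ LinearMap.ker (g ^ 1) := by
    rw [Module.End.ker_pow_constant hker k, LinearMap.mem_ker, pow_add, Module.End.mul_apply, hk,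
      map_zero]
  rw [LinearMap.mem_ker, pow_one, LinearMap.sub_apply, sub_eq_zero] at hx1
  exact Module.End.mem_eigenspace_iff.2 hx1

end SelfAdjoint

lemma spectralGap_pos_of_roots {V : Type*} [AddCommGroup V] [Module ℝ V] [Module.Finite ℝ V]
    (E : V →ₗ[ℝ] V) (hle : ∀ μ ∈ E.charpoly.roots, μ ≤ 1)
    (hmult : E.charpoly.rootMultiplicity 1 ≤ 1) : 0 < spectralGap E := by
  rw [spectralGap, eigenvalueDesc, sub_pos]
  have hsorted := E.charpoly.roots.pairwise_sort (fun a b : ℝ => b ≤ a)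
  have hle' : ∀ μ ∈ E.charpoly.roots.sort (fun a b : ℝ => b ≤ a), μ ≤ 1 := fun μ hμ =>
    hle μ ((Multiset.mem_sort _).1 hμ)
  have hcount : (E.charpoly.roots.sort (fun a b : ℝ => b ≤ a)).count 1 ≤ 1 := by
    rwa [← Multiset.coe_count, Multiset.sort_eq, Polynomial.count_roots]
  generalize E.charpoly.roots.sort (fun a b : ℝ => b ≤ a) = l at hsorted hle' hcount
  match l with
  | [] => simp
  | [_] => simp
  | a :: b :: t =>
    have hba : b ≤ a := (List.pairwise_cons.1 hsorted).1 b (by simp)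
    have ha : a ≤ 1 := hle' a (by simp)
    refine (hba.trans ha).lt_of_ne ?_
    rintro rfl
    simp [ha.antisymm hba] at hcount

section Spectrum

variable {n : ℕ} {G A B : Matrix (Fin n) (Fin n) ℂ}

lemma isHermitian_inv_mul (hG : G.PosDef) (hA : A ∈ hermOps G) : (G⁻¹ * A).IsHermitian := by
  ext i j
  exact ((mem_hermOps_iff hG A).1 hA i j).symm

lemma trace_mul_self_pos (hG : G.PosDef) (hA : A ∈ hermOps G) (hA0 : A ≠ 0) :
    0 < (A * A).trace.re := by
  obtain ⟨c, hc, hcG⟩ := exists_pos_smul_le hG.isStrictlyPositive (IsSelfAdjoint.one _)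
  obtain ⟨M, hM, rfl⟩ : ∃ M : Matrix (Fin n) (Fin n) ℂ, Mᴴ = M ∧ G * M = A :=
    ⟨G⁻¹ * A, isHermitian_inv_mul hG hA,
      Matrix.mul_nonsing_inv_cancel_left _ _ hG.det_pos.ne'.isUnit⟩
  have hM0 : M ≠ 0 := by
    rintro rfl
    exact hA0 (Matrix.mul_zero G)
  have hpsd : 0 ≤ M * G * M := by
    simpa only [hM] using (hG.posSemidef.conjTranspose_mul_mul_same M).nonneg
  have hpsd' : 0 ≤ M * M := by
    simpa only [hM] using (Matrix.posSemidef_conjTranspose_mul_self M).nonneg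
  have hnorm : ‖M‖ * ‖M‖ ≤ (M * M).trace.re := by
    rw [← CStarRing.norm_star_mul_self, Matrix.star_eq_conjTranspose, hM]
    exact norm_le_re_trace hpsd'
  have htrace {X : Matrix (Fin n) (Fin n) ℂ} (hX : 0 ≤ X) : c * X.trace.re ≤ (X * G).trace.re := by
    simpa using trace_mul_mono hX hcG
  calc 0 < c * (c * (‖M‖ * ‖M‖)) := by have := norm_pos_iff.2 hM0; positivity
    _ ≤ c * (c * (M * M).trace.re) := by gcongr
    _ ≤ c * (M * M * G).trace.re := by gcongr; exact htrace hpsd'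
    _ = c * (M * G * M).trace.re := by rw [Matrix.mul_assoc, Matrix.trace_mul_comm]
    _ ≤ (M * G * M * G).trace.re := htrace hpsd
    _ = (G * M * (G * M)).trace.re := by rw [Matrix.trace_mul_comm]; simp only [Matrix.mul_assoc]

/-- The expectation `tr (F A)` of an observable `A` in the coherent state `F` of a line. -/
def expect (G A : Matrix (Fin n) (Fin n) ℂ) (x : ProjSpace n) : ℝ := (projector G x * A).trace.re

/-- The variance `‖A z - tr(F A) z‖² / ‖z‖²`, for the norm of `q* = dualProd G`, of an observable
`A` in the coherent state `F` of a line `[z]`. -/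
def variance (G A : Matrix (Fin n) (Fin n) ℂ) (x : ProjSpace n) : ℝ :=
  quad G⁻¹ (A *ᵥ x.rep - (expect G A x : ℂ) • x.rep) / quad G⁻¹ x.rep

lemma ofReal_expect (hG : G.PosDef) (hA : A ∈ hermOps G) (x : ProjSpace n) :
    (expect G A x : ℂ) = (projector G x * A).trace := by
  apply Complex.conj_eq_iff_re.1
  rw [← Complex.star_def, trace_projector_mul, star_div₀, dualProd_star hG, dualProd_star hG, hA]

lemma expect_eq (hG : G.PosDef) (A : Matrix (Fin n) (Fin n) ℂ) (x : ProjSpace n) :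
    expect G A x = quad (G⁻¹ * A) x.rep / quad G⁻¹ x.rep := by
  rw [expect, projector_eq_kern_mul hG, Matrix.mul_assoc, Matrix.trace_mul_comm, trace_mul_kern]

lemma continuous_trace_projector_mul (hG : G.PosDef) (A : Matrix (Fin n) (Fin n) ℂ) :
    Continuous fun x => (projector G x * A).trace :=
  ((continuous_projector_matrix hG).matrix_mul continuous_const).matrix_trace

lemma continuous_expect (hG : G.PosDef) (A : Matrix (Fin n) (Fin n) ℂ) :
    Continuous (expect G A) :=
  Complex.continuous_re.comp (continuous_trace_projector_mul hG A)

lemma variance_nonneg (hG : G.PosDef) (A : Matrix (Fin n) (Fin n) ℂ) (x : ProjSpace n) :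
    0 ≤ variance G A x :=
  div_nonneg (quad_nonneg hG.inv.posSemidef _) (quad_inv_rep_pos hG x).le

lemma mulVec_rep_eq_of_variance_eq_zero (hG : G.PosDef) {x : ProjSpace n}
    (h : variance G A x = 0) : A *ᵥ x.rep = (expect G A x : ℂ) • x.rep := by
  by_contra hne
  exact (div_pos (quad_pos hG.inv (sub_ne_zero.2 hne)) (quad_inv_rep_pos hG x)).ne' h

lemma quad_inv_mulVec (hA : A ∈ hermOps G) (z : Fin n → ℂ) :
    quad G⁻¹ (A *ᵥ z) = quad (G⁻¹ * (A * A)) z := by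
  have h := hA (A *ᵥ z) z
  rw [dualProd_eq, dualProd_eq] at h
  rw [quad, quad, ← h, Matrix.mulVec_mulVec z A, Matrix.mulVec_mulVec]

lemma variance_eq (hG : G.PosDef) (hA : A ∈ hermOps G) (x : ProjSpace n) :
    variance G A x = quad (G⁻¹ * (A * A)) x.rep / quad G⁻¹ x.rep - expect G A x * expect G A x := by
  have hq : quad G⁻¹ x.rep ≠ 0 := (quad_inv_rep_pos hG x).ne'
  have hcross : (star ((expect G A x : ℂ) • x.rep) ⬝ᵥ G⁻¹ *ᵥ (A *ᵥ x.rep)).re =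
      expect G A x * (expect G A x * quad G⁻¹ x.rep) := by
    rw [star_smul, smul_dotProduct, Matrix.mulVec_mulVec, Complex.star_def, Complex.conj_ofReal,
      smul_eq_mul, Complex.re_ofReal_mul, ← quad, expect_eq hG, div_mul_cancel₀ _ hq]
  rw [variance, quad_sub_vec hG.inv.1, hcross, quad_smul_vec, Complex.norm_real,
    Real.norm_eq_abs, sq_abs, quad_inv_mulVec hA]
  field_simp
  ring

lemma continuous_variance (hG : G.PosDef) (hA : A ∈ hermOps G) : Continuous (variance G A) := by
  rw [funext (variance_eq hG hA)]
  exact (continuous_quad_div hG _).sub ((continuous_expect hG A).mul (continuous_expect hG A))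

variable (ν : Measure (ProjSpace n)) [IsFiniteMeasure ν]

lemma integrable_trace_smul_projector (hG : G.PosDef) (A : Matrix (Fin n) (Fin n) ℂ) :
    Integrable (fun x => (projector G x * A).trace • projector G x) ν :=
  integrable_of_continuous ν
    ((continuous_trace_projector_mul hG A).smul (continuous_projector_matrix hG))

lemma channelFun_eq_integral (hG : G.PosDef) (A : Matrix (Fin n) (Fin n) ℂ) :
    channelFun ν G A = ratio ν • ∫ x, (projector G x * A).trace • projector G x ∂ν := by
  ext i j
  rw [Matrix.smul_apply, integral_matrix_apply (integrable_trace_smul_projector ν hG A),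
    Complex.real_smul]
  rfl

lemma trace_mul_channelFun (hG : G.PosDef) (hA : A ∈ hermOps G)
    (B : Matrix (Fin n) (Fin n) ℂ) :
    (B * channelFun ν G A).trace.re = ratio ν * ∫ x, expect G A x * expect G B x ∂ν := by
  rw [channelFun_eq_integral ν hG, Matrix.mul_smul, Matrix.trace_smul, Complex.smul_re,
    re_trace_mul_integral B (integrable_trace_smul_projector ν hG A), smul_eq_mul]
  congr 2 with x
  rw [Matrix.mul_smul, Matrix.trace_smul, ← ofReal_expect hG hA, smul_eq_mul,
    Complex.re_ofReal_mul, Matrix.trace_mul_comm B, expect, expect]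

lemma trace_mul_self_sub_trace_mul_channelFun (hG : G.PosDef) (hfix : donaldsonMap ν G = G)
    (hA : A ∈ hermOps G) :
    (A * A).trace.re - (A * channelFun ν G A).trace.re = ratio ν * ∫ x, variance G A x ∂ν := by
  have htrace : (A * A).trace.re =
      ratio ν * ∫ x, quad (G⁻¹ * (A * A)) x.rep / quad G⁻¹ x.rep ∂ν := by
    rw [← trace_mul_donaldsonMap ν hG, hfix, Matrix.trace_mul_comm _ G, ← Matrix.mul_assoc G,
      Matrix.mul_nonsing_inv _ hG.det_pos.ne'.isUnit, Matrix.one_mul]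
  have hsq : Integrable (fun x => expect G A x * expect G A x) ν :=
    integrable_of_continuous ν ((continuous_expect hG A).mul (continuous_expect hG A))
  simp only [variance_eq hG hA]
  rw [integral_sub (integrable_of_continuous ν (continuous_quad_div hG _)) hsq, mul_sub, ← htrace,
    ← trace_mul_channelFun ν hG hA]

variable {ν}

lemma trace_mul_channelFun_le (hG : G.PosDef) (hfix : donaldsonMap ν G = G) (hA : A ∈ hermOps G) :
    (A * channelFun ν G A).trace.re ≤ (A * A).trace.re := by
  rw [← sub_nonneg, trace_mul_self_sub_trace_mul_channelFun ν hG hfix hA]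
  exact mul_nonneg (ratio_nonneg ν) (integral_nonneg (variance_nonneg hG A))

lemma ae_mulVec_rep_eq_of_channelFun_eq (hν : ν ≠ 0) (hG : G.PosDef)
    (hfix : donaldsonMap ν G = G) (hA : A ∈ hermOps G) (hEA : channelFun ν G A = A) :
    ∀ᵐ x ∂ν, A *ᵥ x.rep = (expect G A x : ℂ) • x.rep := by
  have hzero := trace_mul_self_sub_trace_mul_channelFun ν hG hfix hA
  rw [hEA, sub_self, zero_eq_mul, or_iff_right (ratio_pos hν).ne',
    integral_eq_zero_iff_of_nonneg (variance_nonneg hG A)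
      (integrable_of_continuous ν (continuous_variance hG hA))] at hzero
  filter_upwards [hzero] with x hx using mulVec_rep_eq_of_variance_eq_zero hG hx

lemma ae_expect_eq_zero_of_channelFun_eq_zero (hν : ν ≠ 0) (hG : G.PosDef) (hA : A ∈ hermOps G)
    (hEA : channelFun ν G A = 0) : ∀ᵐ x ∂ν, expect G A x = 0 := by
  have hzero := trace_mul_channelFun ν hG hA A
  rw [hEA, Matrix.mul_zero, Matrix.trace_zero, Complex.zero_re, zero_eq_mul,
    or_iff_right (ratio_pos hν).ne', integral_eq_zero_iff_of_nonneg (fun x => mul_self_nonneg _)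
      (integrable_of_continuous ν
        ((continuous_expect hG A).mul (continuous_expect hG A)))] at hzero
  filter_upwards [hzero] with x hx using mul_self_eq_zero.1 hx

-- An eigenspace and the image of `A - μ` have complementary dimensions, and together they contain
-- almost every line.
lemma IsStable.eq_smul_one_of_ae_mulVec_rep_eq (hs : IsStable ν) (hν : ν ≠ 0)
    (h : ∀ᵐ x ∂ν, ∃ c : ℂ, A *ᵥ x.rep = c • x.rep) : ∃ μ : ℂ, A = μ • 1 := by
  have := nonempty_fin_of_measure_ne_zero hν
  obtain ⟨μ, hμ⟩ := Module.End.exists_eigenvalue A.mulVecLin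
  have hmul (w : Fin n → ℂ) : (A - μ • 1) *ᵥ w = A *ᵥ w - μ • w := by
    rw [Matrix.sub_mulVec, Matrix.smul_mulVec, Matrix.one_mulVec]
  refine ⟨μ, sub_eq_zero.1 (matKer_eq_top.1 (by_contra fun htop => ?_))⟩
  refine hs.not_ae_mem_or hν (S := matKer (A - μ • 1))
    (S' := LinearMap.range (A - μ • 1).mulVecLin) (fun hbot => ?_) htop ?_ ?_
  · obtain ⟨v, hv⟩ := hμ.exists_hasEigenvector
    have hmem : v ∈ matKer (A - μ • 1) := by
      rw [mem_matKer, hmul, ← Matrix.mulVecLin_apply, hv.apply_eq_smul, sub_self]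
    rw [hbot, Submodule.mem_bot] at hmem
    exact hv.2 hmem
  · rw [add_comm, LinearMap.finrank_range_add_finrank_ker, Module.finrank_fin_fun]
  · filter_upwards [h] with x ⟨c, hx⟩
    rw [mem_projSubspace, mem_projSubspace, mem_matKer, hmul, hx, ← sub_smul]
    refine (eq_or_ne c μ).imp (fun hc => by rw [hc, sub_self, zero_smul]) fun hc =>
      ⟨(c - μ)⁻¹ • x.rep, ?_⟩
    rw [Matrix.mulVecLin_apply, Matrix.mulVec_smul, hmul, hx, ← sub_smul, smul_smul,
      inv_mul_cancel₀ (sub_ne_zero.2 hc), one_smul]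

lemma eq_smul_one_of_channelFun_eq (hs : IsStable ν) (hν : ν ≠ 0) (hG : G.PosDef)
    (hfix : donaldsonMap ν G = G) (hA : A ∈ hermOps G) (hEA : channelFun ν G A = A) :
    ∃ c : ℝ, A = c • (1 : Matrix (Fin n) (Fin n) ℂ) := by
  have hae := ae_mulVec_rep_eq_of_channelFun_eq hν hG hfix hA hEA
  obtain ⟨μ, hμ⟩ := hs.eq_smul_one_of_ae_mulVec_rep_eq hν (hae.mono fun _ hx => ⟨_, hx⟩)
  have : NeZero ν := ⟨hν⟩
  obtain ⟨x, hx⟩ := hae.exists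
  have hreal : μ = (expect G A x : ℂ) := smul_left_injective ℂ x.rep_nonzero <| by
    change μ • x.rep = (expect G A x : ℂ) • x.rep
    rw [← hx, hμ, Matrix.smul_mulVec, Matrix.one_mulVec]
  exact ⟨expect G A x, by rw [← Complex.coe_smul, ← hreal, ← hμ]⟩

/-- The trace form `tr (A B)` on the Hermitian operators of `(ℂ^n, q*)`. -/
def traceForm (G : Matrix (Fin n) (Fin n) ℂ) : LinearMap.BilinForm ℝ (hermOps G) :=
  LinearMap.mk₂ ℝ (fun A B => ((A : Matrix (Fin n) (Fin n) ℂ) * B).trace.re)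
    (fun A A' B => by simp [Matrix.add_mul]) (fun c A B => by simp)
    (fun A B B' => by simp [Matrix.mul_add]) (fun c A B => by simp)

lemma traceForm_apply (A B : hermOps G) :
    traceForm G A B = ((A : Matrix (Fin n) (Fin n) ℂ) * B).trace.re := rfl

lemma eq_zero_of_traceForm_self (hG : G.PosDef) {A : hermOps G} (h : traceForm G A A = 0) :
    A = 0 := by
  by_contra hne
  exact (trace_mul_self_pos hG A.2 fun hA => hne (Subtype.ext hA)).ne' h

lemma isSelfAdjoint_quantumChannel (hG : G.PosDef) :
    (traceForm G).IsSelfAdjoint (quantumChannel ν G hG) := fun A B => by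
  rw [traceForm_apply, traceForm_apply, Matrix.trace_mul_comm]
  change (B.1 * channelFun ν G A.1).trace.re = (A.1 * channelFun ν G B.1).trace.re
  rw [trace_mul_channelFun ν hG A.2, trace_mul_channelFun ν hG B.2]
  simp only [mul_comm]

lemma rootMultiplicity_quantumChannel_le (hs : IsStable ν) (hν : ν ≠ 0) (hG : G.PosDef)
    (hfix : donaldsonMap ν G = G) : (quantumChannel ν G hG).charpoly.rootMultiplicity 1 ≤ 1 := by
  have hle : (Module.End.eigenspace (quantumChannel ν G hG) 1).map (hermOps G).subtype ≤
      Submodule.span ℝ {(1 : Matrix (Fin n) (Fin n) ℂ)} := by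
    rintro _ ⟨A, hA, rfl⟩
    rw [SetLike.mem_coe, Module.End.mem_eigenspace_iff, one_smul] at hA
    obtain ⟨c, hc⟩ := eq_smul_one_of_channelFun_eq hs hν hG hfix A.2 (congrArg Subtype.val hA)
    exact Submodule.mem_span_singleton.2 ⟨c, hc.symm⟩
  rw [← LinearMap.finrank_maxGenEigenspace_eq, maxGenEigenspace_eq_eigenspace_of_isSelfAdjoint
    (fun _ => eq_zero_of_traceForm_self hG) (isSelfAdjoint_quantumChannel hG),
    ← Submodule.finrank_map_subtype_eq]
  exact (Submodule.finrank_mono hle).trans ((finrank_span_le_card _).trans (by simp))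

lemma le_one_of_mem_roots_quantumChannel (hG : G.PosDef) (hfix : donaldsonMap ν G = G) {μ : ℝ}
    (hμ : μ ∈ (quantumChannel ν G hG).charpoly.roots) : μ ≤ 1 := by
  obtain ⟨A, hA⟩ := ((Module.End.hasEigenvalue_iff_isRoot_charpoly _ _).2
    (Polynomial.isRoot_of_mem_roots hμ)).exists_hasEigenvector
  have hEA : channelFun ν G A.1 = μ • A.1 := congrArg Subtype.val hA.apply_eq_smul
  have hle := trace_mul_channelFun_le hG hfix A.2
  rw [hEA, Matrix.mul_smul, Matrix.trace_smul, Complex.smul_re, smul_eq_mul] at hle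
  exact le_of_mul_le_mul_right (hle.trans_eq (one_mul _).symm)
    (trace_mul_self_pos hG A.2 fun h => hA.2 (Subtype.ext h))

theorem spectralGap_quantumChannel_pos (hs : IsStable ν) (hν : ν ≠ 0) (hG : G.PosDef)
    (hfix : donaldsonMap ν G = G) : 0 < spectralGap (quantumChannel ν G hG) :=
  spectralGap_pos_of_roots _ (fun _ => le_one_of_mem_roots_quantumChannel hG hfix)
    (rootMultiplicity_quantumChannel_le hs hν hG hfix)

end Spectrum

/-! ### Euclidean neighbourhoods in irreducible affine varieties are Zariski dense -/

section Extension

variable {B A K : Type*} [CommRing B] [CommRing A] [Algebra B A] [Algebra.IsIntegral B A]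
  [Field K] [IsAlgClosed K]

lemma exists_ringHom_comp_algebraMap_eq (hinj : Function.Injective (algebraMap B A))
    (ψ : B →+* K) : ∃ χ : A →+* K, χ.comp (algebraMap B A) = ψ := by
  have : (RingHom.ker ψ).IsPrime := RingHom.ker_isPrime ψ
  have hbot : Ideal.comap (algebraMap B A) ⊥ ≤ RingHom.ker ψ := by
    rw [← RingHom.ker_eq_comap_bot, (RingHom.injective_iff_ker_eq_bot _).1 hinj]
    exact bot_le
  obtain ⟨Q, -, hQ, hQψ⟩ :=
    Ideal.exists_ideal_over_prime_of_isIntegral (RingHom.ker ψ) (⊥ : Ideal A) hbot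
  have : Q.LiesOver (RingHom.ker ψ) := ⟨hQψ.symm⟩
  have : Module.IsTorsionFree (B ⧸ RingHom.ker ψ) (A ⧸ Q) :=
    Module.isTorsionFree_iff_faithfulSMul.2 (Ideal.Quotient.instFaithfulSMul _ _)
  let : Algebra (B ⧸ RingHom.ker ψ) K := ψ.kerLift.toAlgebra
  have : FaithfulSMul (B ⧸ RingHom.ker ψ) K :=
    (faithfulSMul_iff_algebraMap_injective _ _).2 ψ.kerLift_injective
  let χ : A ⧸ Q →ₐ[B ⧸ RingHom.ker ψ] K := IsAlgClosed.lift
  refine ⟨χ.toRingHom.comp (Ideal.Quotient.mk Q), RingHom.ext fun b => ?_⟩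
  exact χ.commutes (Ideal.Quotient.mk _ b)

variable {k : Type*} [CommRing k] [Algebra k B] [Algebra k A] [IsScalarTower k B A] [Algebra k K]
  [IsDomain B] [IsIntegrallyClosed B] [IsDomain A] [Module.IsTorsionFree B A]

open Polynomial in
lemma exists_algHom_of_isRoot_minpoly (e : B →ₐ[k] K) (a : A) {t : K}
    (ht : ((minpoly B a).map (e : B →+* K)).IsRoot t) :
    ∃ χ : A →ₐ[k] K, (∀ b, χ (algebraMap B A b) = e b) ∧ χ a = t := by
  have ha : IsIntegral B a := Algebra.IsIntegral.isIntegral a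
  rw [IsRoot, eval_map] at ht
  have : Algebra.IsIntegral (Algebra.adjoin B {a}) A := Algebra.IsIntegral.tower_top B
  obtain ⟨χ, hχ⟩ := exists_ringHom_comp_algebraMap_eq (A := A) Subtype.val_injective
    ((AdjoinRoot.lift (e : B →+* K) t ht).comp (minpoly.equivAdjoin ha).symm.toRingHom)
  have hχB (b : B) : χ (algebraMap B A b) = e b := by
    refine (RingHom.congr_fun hχ (algebraMap B _ b)).trans ?_
    change AdjoinRoot.lift _ t ht ((minpoly.equivAdjoin ha).symm _) = _
    rw [AlgEquiv.commutes, AdjoinRoot.algebraMap_eq, AdjoinRoot.lift_of]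
    rfl
  have hroot : (minpoly.equivAdjoin ha).symm ⟨a, Algebra.self_mem_adjoin_singleton B a⟩ =
      AdjoinRoot.root _ := by
    rw [AlgEquiv.symm_apply_eq, minpoly.coe_equivAdjoin]
    exact Subtype.ext AdjoinRoot.Minpoly.coe_toAdjoin_mk_X.symm
  refine ⟨⟨χ, fun c => ?_⟩, hχB, ?_⟩
  · exact (congrArg χ (IsScalarTower.algebraMap_apply k B A c)).trans
      ((hχB _).trans (e.commutes c))
  · refine (RingHom.congr_fun hχ ⟨a, Algebra.self_mem_adjoin_singleton B a⟩).trans ?_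
    change AdjoinRoot.lift _ t ht ((minpoly.equivAdjoin ha).symm _) = _
    rw [hroot, AdjoinRoot.lift_root]

end Extension

section PolynomialLemmas

open Polynomial in
lemma coeff_zero_minpoly_ne_zero {A B : Type*} [CommRing B] [IsDomain B] [CommRing A] [IsDomain A]
    [Algebra B A] {a : A} (ha : IsIntegral B a) (ha0 : a ≠ 0) : (minpoly B a).coeff 0 ≠ 0 := by
  intro hcoeff
  obtain ⟨Q, hQ⟩ := X_dvd_iff.2 hcoeff
  have hmonic : Q.Monic := monic_X.of_mul_monic_left (hQ ▸ minpoly.monic ha)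
  have hroot : aeval a Q = 0 := by
    have h := minpoly.aeval B a
    rw [hQ, map_mul, aeval_X] at h
    exact (mul_eq_zero.1 h).resolve_left ha0
  have hdeg := natDegree_le_natDegree (minpoly.min B a hmonic hroot)
  rw [hQ, monic_X.natDegree_mul hmonic, natDegree_X] at hdeg
  omega

open Polynomial in
lemma exists_isRoot_norm_pow_natDegree_le {K : Type*} [NormedField K] [IsAlgClosed K] {P : K[X]}
    (hP : P.Monic) (hdeg : 0 < P.natDegree) :
    ∃ t, P.IsRoot t ∧ ‖t‖ ^ P.natDegree ≤ ‖P.coeff 0‖ := by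
  classical
  have hsplits := IsAlgClosed.splits P
  have hne : P.roots.toFinset.Nonempty := by
    rw [Multiset.toFinset_nonempty, ← Multiset.card_pos, ← hsplits.natDegree_eq_card_roots]
    exact hdeg
  obtain ⟨t, ht, hmin⟩ := P.roots.toFinset.exists_min_image norm hne
  refine ⟨t, isRoot_of_mem_roots (Multiset.mem_toFinset.1 ht), ?_⟩
  calc ‖t‖ ^ P.natDegree
      = (P.roots.map fun _ => ‖t‖).prod := by
        rw [Multiset.map_const', Multiset.prod_replicate, ← hsplits.natDegree_eq_card_roots]
    _ ≤ (P.roots.map fun u => ‖u‖).prod :=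
        Multiset.prod_map_le_prod_map₀ _ _ (fun _ _ => norm_nonneg t)
          fun u hu => hmin u (Multiset.mem_toFinset.2 hu)
    _ = ‖P.coeff 0‖ := by
        rw [hsplits.coeff_zero_eq_prod_roots_of_monic hP, norm_mul, norm_pow, norm_neg, norm_one,
          one_pow, one_mul]
        exact Multiset.prod_hom P.roots (normHom : K →*₀ ℝ)

lemma eq_zero_of_eventually_eval_eq_zero {𝕜 σ : Type*} [NontriviallyNormedField 𝕜] [Finite σ]
    {p : MvPolynomial σ 𝕜} {y₀ : σ → 𝕜} (hp : ∀ᶠ y in 𝓝 y₀, MvPolynomial.eval y p = 0) :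
    p = 0 := by
  have := Fintype.ofFinite σ
  obtain ⟨ε, hε, hball⟩ := Metric.eventually_nhds_iff_ball.1 hp
  refine MvPolynomial.funext_set (fun i => Metric.ball (y₀ i) ε)
    (fun i => infinite_of_mem_nhds (y₀ i) (Metric.ball_mem_nhds _ hε)) fun y hy => ?_
  rw [← ball_pi _ hε] at hy
  rw [hball y hy, map_zero]

lemma exists_eval_eq_zero_imp_eq {R σ : Type*} [CommRing R] [IsDomain R] {F : Set (σ → R)}
    (hF : F.Finite) (x : σ → R) : ∃ p : MvPolynomial σ R, MvPolynomial.eval x p = 0 ∧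
      ∀ y ∈ F, MvPolynomial.eval y p = 0 → y = x := by
  classical
  have hsep (y : {y // y ∈ hF.toFinset.erase x}) : ∃ i, y.1 i ≠ x i :=
    Function.ne_iff.1 (Finset.ne_of_mem_erase y.2)
  choose i hi using hsep
  let q : MvPolynomial σ R := ∏ y ∈ (hF.toFinset.erase x).attach,
    (MvPolynomial.X (i y) - MvPolynomial.C (y.1 (i y)))
  have hqx : MvPolynomial.eval x q ≠ 0 := by
    rw [MvPolynomial.eval_prod, Finset.prod_ne_zero_iff]
    intro y _
    simpa [sub_eq_zero] using (hi y).symm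
  refine ⟨q - MvPolynomial.C (MvPolynomial.eval x q), by simp, fun y hy h => ?_⟩
  by_contra hyx
  have hqy : MvPolynomial.eval y q = 0 := by
    rw [MvPolynomial.eval_prod]
    exact Finset.prod_eq_zero
      (Finset.mem_attach _ ⟨y, Finset.mem_erase.2 ⟨hyx, hF.mem_toFinset.2 hy⟩⟩) (by simp)
  rw [map_sub, hqy, MvPolynomial.eval_C, zero_sub, neg_eq_zero] at h
  exact hqx h

end PolynomialLemmas

section Affine

variable {σ τ A : Type*} [CommRing A] [Algebra ℂ A]

/-- The point of `ℂ^σ` attached to a character `χ` of an algebra `A` with a family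
`π : ℂ[X_σ] → A` of elements; if `π` is surjective, it identifies the characters of `A` with the
zero locus of `ker π`. -/
def charPoint (π : MvPolynomial σ ℂ →ₐ[ℂ] A) (χ : A →ₐ[ℂ] ℂ) : σ → ℂ :=
  fun i => χ (π (MvPolynomial.X i))

lemma eval_charPoint (π : MvPolynomial σ ℂ →ₐ[ℂ] A) (χ : A →ₐ[ℂ] ℂ) (p : MvPolynomial σ ℂ) :
    MvPolynomial.eval (charPoint π χ) p = χ (π p) := by
  have h : χ.comp π = MvPolynomial.aeval (charPoint π χ) :=
    MvPolynomial.algHom_ext fun i => by simp [charPoint]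
  exact (DFunLike.congr_fun h p).symm

lemma exists_charPoint_eq {π : MvPolynomial σ ℂ →ₐ[ℂ] A} (hπ : Function.Surjective π) {x : σ → ℂ}
    (hx : ∀ p, π p = 0 → MvPolynomial.eval x p = 0) :
    ∃ χ : A →ₐ[ℂ] ℂ, charPoint π χ = x := by
  have hker : RingHom.ker π.toRingHom ≤ RingHom.ker (MvPolynomial.aeval x).toRingHom :=
    fun p hp => hx p hp
  refine ⟨AlgHom.liftOfSurjective π hπ (MvPolynomial.aeval x) hker, funext fun i => ?_⟩
  rw [charPoint, AlgHom.liftOfSurjective_apply, MvPolynomial.aeval_X]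

section Normalization

variable [Algebra (MvPolynomial τ ℂ) A] [IsScalarTower ℂ (MvPolynomial τ ℂ) A]

/-- The projection to `ℂ^τ` of the variety of characters of an algebra over `ℂ[X_τ]`. -/
def charProj (τ : Type*) [Algebra (MvPolynomial τ ℂ) A] [IsScalarTower ℂ (MvPolynomial τ ℂ) A]
    (χ : A →ₐ[ℂ] ℂ) : τ → ℂ :=
  charPoint (IsScalarTower.toAlgHom ℂ (MvPolynomial τ ℂ) A) χ

lemma charProj_eq {χ : A →ₐ[ℂ] ℂ} {y : τ → ℂ}
    (h : ∀ b, χ (algebraMap (MvPolynomial τ ℂ) A b) = MvPolynomial.aeval y b) :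
    charProj τ χ = y :=
  funext fun i => (h (MvPolynomial.X i)).trans (MvPolynomial.aeval_X y i)

lemma isRoot_map_minpoly (χ : A →ₐ[ℂ] ℂ) (a : A) :
    ((minpoly (MvPolynomial τ ℂ) a).map (MvPolynomial.eval (charProj τ χ))).IsRoot (χ a) := by
  have heval : MvPolynomial.eval (charProj τ χ) =
      (χ : A →+* ℂ).comp (algebraMap (MvPolynomial τ ℂ) A) :=
    RingHom.ext fun b => eval_charPoint _ χ b
  have h := congrArg (χ : A →+* ℂ) (minpoly.aeval (MvPolynomial τ ℂ) a)
  rw [Polynomial.aeval_def, Polynomial.hom_eval₂, map_zero] at h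
  rw [Polynomial.IsRoot, Polynomial.eval_map, heval]
  exact h

lemma eval_coeff_zero_minpoly_eq_zero {χ : A →ₐ[ℂ] ℂ} {a : A} (ha : χ a = 0) :
    MvPolynomial.eval (charProj τ χ) ((minpoly (MvPolynomial τ ℂ) a).coeff 0) = 0 := by
  have h := isRoot_map_minpoly (τ := τ) χ a
  rwa [ha, Polynomial.IsRoot, ← Polynomial.coeff_zero_eq_eval_zero, Polynomial.coeff_map] at h

variable [Algebra.IsIntegral (MvPolynomial τ ℂ) A]

lemma monic_map_minpoly {A : Type*} [CommRing A] [Algebra (MvPolynomial τ ℂ) A]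
    [Algebra.IsIntegral (MvPolynomial τ ℂ) A] (y : τ → ℂ) (a : A) :
    ((minpoly (MvPolynomial τ ℂ) a).map (MvPolynomial.eval y)).Monic :=
  (minpoly.monic (Algebra.IsIntegral.isIntegral a)).map _

lemma finite_charPoint_fibre [Finite σ] (π : MvPolynomial σ ℂ →ₐ[ℂ] A) (y : τ → ℂ) :
    (charPoint π '' {χ | charProj τ χ = y}).Finite := by
  refine (Set.Finite.pi fun i => (((minpoly (MvPolynomial τ ℂ) (π (MvPolynomial.X i))).map
    (MvPolynomial.eval y)).roots.toFinset).finite_toSet).subset ?_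
  rintro _ ⟨χ, rfl, rfl⟩ i -
  rw [SetLike.mem_coe, Multiset.mem_toFinset, Polynomial.mem_roots (monic_map_minpoly _ _).ne_zero]
  exact isRoot_map_minpoly χ _

lemma exists_charProj_eq_norm_pow_le [IsDomain A] [Module.IsTorsionFree (MvPolynomial τ ℂ) A]
    (a : A) (y : τ → ℂ) :
    ∃ χ : A →ₐ[ℂ] ℂ, charProj τ χ = y ∧ ‖χ a‖ ^ (minpoly (MvPolynomial τ ℂ) a).natDegree ≤
      ‖MvPolynomial.eval y ((minpoly (MvPolynomial τ ℂ) a).coeff 0)‖ := by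
  have ha : IsIntegral (MvPolynomial τ ℂ) a := Algebra.IsIntegral.isIntegral a
  have hdeg := (minpoly.monic ha).natDegree_map (MvPolynomial.eval y)
  obtain ⟨t, ht, hle⟩ := exists_isRoot_norm_pow_natDegree_le (monic_map_minpoly y a)
    (hdeg ▸ minpoly.natDegree_pos ha)
  obtain ⟨χ, hχ, rfl⟩ := exists_algHom_of_isRoot_minpoly (MvPolynomial.aeval y) a ht
  rw [hdeg, Polynomial.coeff_map] at hle
  exact ⟨χ, charProj_eq hχ, hle⟩

lemma exists_norm_apply_le [Fintype τ] (y₀ : τ → ℂ) (a : A) :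
    ∃ C : ℝ, ∀ χ : A →ₐ[ℂ] ℂ, charProj τ χ ∈ Metric.closedBall y₀ 1 → ‖χ a‖ ≤ C := by
  set P := minpoly (MvPolynomial τ ℂ) a
  have hcoeff (j : ℕ) : ∃ C : NNReal, ∀ y ∈ Metric.closedBall y₀ 1,
      ‖MvPolynomial.eval y (P.coeff j)‖₊ ≤ C := by
    obtain ⟨C, hC⟩ := (isCompact_closedBall y₀ 1).exists_bound_of_continuousOn
      (MvPolynomial.continuous_eval (P.coeff j)).continuousOn
    exact ⟨C.toNNReal, fun y hy => NNReal.le_toNNReal_of_coe_le (hC y hy)⟩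
  choose C hC using hcoeff
  refine ⟨((Finset.range P.natDegree).sup C + 1 : NNReal), fun χ hχ => ?_⟩
  have hmonic := monic_map_minpoly (charProj τ χ) a
  refine ((isRoot_map_minpoly χ a).norm_lt_cauchyBound hmonic.ne_zero).le.trans
    (NNReal.coe_le_coe.2 ?_)
  rw [Polynomial.cauchyBound, hmonic.leadingCoeff, nnnorm_one, div_one]
  gcongr
  refine Finset.sup_le fun j hj => ?_
  rw [Polynomial.coeff_map]
  refine (hC j _ hχ).trans (Finset.le_sup (f := C) ?_)
  rw [Finset.mem_range] at hj ⊢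
  exact hj.trans_le Polynomial.natDegree_map_le

lemma exists_norm_charPoint_le [Fintype τ] [Fintype σ] (π : MvPolynomial σ ℂ →ₐ[ℂ] A)
    (y₀ : τ → ℂ) :
    ∃ C : ℝ, ∀ χ : A →ₐ[ℂ] ℂ, charProj τ χ ∈ Metric.closedBall y₀ 1 →
      charPoint π χ ∈ Metric.closedBall 0 C := by
  choose C hC using fun i : σ => exists_norm_apply_le y₀ (π (MvPolynomial.X i))
  refine ⟨∑ i, |C i|, fun χ hχ => mem_closedBall_zero_iff.2 ?_⟩
  refine (pi_norm_le_iff_of_nonneg (by positivity)).2 fun i => (hC i χ hχ).trans ?_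
  exact (le_abs_self _).trans
    (Finset.single_le_sum (f := fun i => |C i|) (fun _ _ => abs_nonneg _) (Finset.mem_univ i))

variable [Finite τ] [Finite σ] {π : MvPolynomial σ ℂ →ₐ[ℂ] A}

-- The projection is proper, so it is enough to identify the cluster points.
lemma tendsto_charPoint (hπ : Function.Surjective π) {ι : Type*} {l : Filter ι}
    {χ : ι → A →ₐ[ℂ] ℂ} {χ₀ : A →ₐ[ℂ] ℂ} {p : MvPolynomial σ ℂ}
    (hp : ∀ ψ : A →ₐ[ℂ] ℂ, charProj τ ψ = charProj τ χ₀ → ψ (π p) = 0 →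
      charPoint π ψ = charPoint π χ₀)
    (hproj : Tendsto (fun i => charProj τ (χ i)) l (𝓝 (charProj τ χ₀)))
    (hχp : Tendsto (fun i => χ i (π p)) l (𝓝 0)) :
    Tendsto (fun i => charPoint π (χ i)) l (𝓝 (charPoint π χ₀)) := by
  have := Fintype.ofFinite τ
  have := Fintype.ofFinite σ
  obtain ⟨C, hC⟩ := exists_norm_charPoint_le π (charProj τ χ₀)
  refine (isCompact_closedBall (0 : σ → ℂ) C).tendsto_nhds_of_unique_mapClusterPt
    ((hproj.eventually (Metric.closedBall_mem_nhds _ one_pos)).mono fun i => hC (χ i))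
    fun x _ hx => ?_
  have heval {q : MvPolynomial σ ℂ} {c : ℂ} (hq : Tendsto (fun i => χ i (π q)) l (𝓝 c)) :
      MvPolynomial.eval x q = c := by
    have hcluster := hx.continuousAt_comp (MvPolynomial.continuous_eval q).continuousAt
    simp only [Function.comp_def, eval_charPoint] at hcluster
    exact eq_of_nhds_neBot (hcluster.clusterPt.neBot.mono (inf_le_inf_left _ hq))
  obtain ⟨ψ, rfl⟩ := exists_charPoint_eq hπ fun q hq => heval (by simp [hq, tendsto_const_nhds])
  refine hp ψ (funext fun i => ?_) (by rw [← eval_charPoint]; exact heval hχp)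
  obtain ⟨q, hq⟩ := hπ (algebraMap (MvPolynomial τ ℂ) A (MvPolynomial.X i))
  refine .trans (?_ : _ = ψ (π q)) ?_
  · rw [hq]; rfl
  · rw [← eval_charPoint]
    refine heval ?_
    rw [hq]
    exact tendsto_pi_nhds.1 hproj i

variable [IsDomain A] [Module.IsTorsionFree (MvPolynomial τ ℂ) A]

-- The section picks the smallest value of a function whose only zero in the fibre is the given
-- point.
lemma exists_section_tendsto_charPoint (hπ : Function.Surjective π) (χ₀ : A →ₐ[ℂ] ℂ) :
    ∃ s : (τ → ℂ) → (A →ₐ[ℂ] ℂ), (∀ y, charProj τ (s y) = y) ∧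
      Tendsto (fun y => charPoint π (s y)) (𝓝 (charProj τ χ₀)) (𝓝 (charPoint π χ₀)) := by
  obtain ⟨p, hp₀, hp⟩ := exists_eval_eq_zero_imp_eq
    (finite_charPoint_fibre π (charProj τ χ₀)) (charPoint π χ₀)
  rw [eval_charPoint] at hp₀
  set d := (minpoly (MvPolynomial τ ℂ) (π p)).natDegree
  have hd : d ≠ 0 := (minpoly.natDegree_pos (Algebra.IsIntegral.isIntegral _)).ne'
  choose s hs hle using exists_charProj_eq_norm_pow_le (τ := τ) (π p)
  have hpow : Tendsto (fun y => ‖s y (π p)‖ ^ d) (𝓝 (charProj τ χ₀)) (𝓝 0) := by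
    refine squeeze_zero (fun y => by positivity) hle ?_
    exact (MvPolynomial.continuous_eval _).norm.tendsto' _ _
      (by rw [eval_coeff_zero_minpoly_eq_zero hp₀, norm_zero])
  have hzero : Tendsto (fun y => s y (π p)) (𝓝 (charProj τ χ₀)) (𝓝 0) := by
    have hroot := hpow.rpow_const (p := (d : ℝ)⁻¹) (Or.inr (by positivity))
    simp only [Real.pow_rpow_inv_natCast (norm_nonneg _) hd] at hroot
    rw [Real.zero_rpow (by positivity)] at hroot
    exact tendsto_zero_iff_norm_tendsto_zero.2 hroot
  refine ⟨s, hs, tendsto_charPoint (τ := τ) hπ (fun ψ hψ hψp => ?_) ?_ hzero⟩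
  · exact hp _ ⟨ψ, hψ, rfl⟩ (by rw [eval_charPoint, hψp])
  · simp only [hs]
    exact tendsto_id

lemma map_eq_zero_of_eventually_eval_eq_zero (τ : Type*) [Finite τ] [Algebra (MvPolynomial τ ℂ) A]
    [IsScalarTower ℂ (MvPolynomial τ ℂ) A] [Algebra.IsIntegral (MvPolynomial τ ℂ) A]
    [Module.IsTorsionFree (MvPolynomial τ ℂ) A] (hπ : Function.Surjective π) {x : σ → ℂ}
    (hx : ∀ p, π p = 0 → MvPolynomial.eval x p = 0) {f : MvPolynomial σ ℂ}
    (hf : ∀ᶠ z in 𝓝 x, (∀ p, π p = 0 → MvPolynomial.eval z p = 0) → MvPolynomial.eval z f = 0) :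
    π f = 0 := by
  obtain ⟨χ₀, rfl⟩ := exists_charPoint_eq hπ hx
  obtain ⟨s, hs, hlim⟩ := exists_section_tendsto_charPoint (τ := τ) hπ χ₀
  by_contra hne
  refine coeff_zero_minpoly_ne_zero (B := MvPolynomial τ ℂ) (Algebra.IsIntegral.isIntegral _) hne
    (eq_zero_of_eventually_eval_eq_zero (y₀ := charProj τ χ₀) ?_)
  filter_upwards [hlim.eventually hf] with y hy
  have hzero : s y (π f) = 0 := by
    rw [← eval_charPoint]
    exact hy fun p hp => by rw [eval_charPoint, hp, map_zero]
  simpa only [hs] using eval_coeff_zero_minpoly_eq_zero (τ := τ) hzero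

end Normalization

theorem mem_of_eventually_eval_eq_zero {n : ℕ} (I : Ideal (MvPolynomial (Fin n) ℂ)) [I.IsPrime]
    {x : Fin n → ℂ} (hx : ∀ p ∈ I, MvPolynomial.eval x p = 0) {f : MvPolynomial (Fin n) ℂ}
    (hf : ∀ᶠ z in 𝓝 x, (∀ p ∈ I, MvPolynomial.eval z p = 0) → MvPolynomial.eval z f = 0) :
    f ∈ I := by
  obtain ⟨s, -, g, hinj, hint⟩ :=
    exists_integral_inj_algHom_of_quotient I (Ideal.IsPrime.ne_top inferInstance)
  let : Algebra (MvPolynomial (Fin s) ℂ) (MvPolynomial (Fin n) ℂ ⧸ I) := g.toRingHom.toAlgebra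
  have : IsScalarTower ℂ (MvPolynomial (Fin s) ℂ) (MvPolynomial (Fin n) ℂ ⧸ I) :=
    IsScalarTower.of_algebraMap_eq fun c => (g.commutes c).symm
  have : Algebra.IsIntegral (MvPolynomial (Fin s) ℂ) (MvPolynomial (Fin n) ℂ ⧸ I) := ⟨hint⟩
  have : FaithfulSMul (MvPolynomial (Fin s) ℂ) (MvPolynomial (Fin n) ℂ ⧸ I) :=
    (faithfulSMul_iff_algebraMap_injective _ _).2 hinj
  simp only [← Ideal.Quotient.eq_zero_iff_mem] at hx hf ⊢
  exact map_eq_zero_of_eventually_eval_eq_zero (Fin s) (π := Ideal.Quotient.mkₐ ℂ I)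
    (Ideal.Quotient.mkₐ_surjective ℂ I) hx hf

end Affine

/-! ### Euclidean neighbourhoods in irreducible projective varieties are Zariski dense -/

section Homogeneous

variable {R σ : Type*}

lemma eval_smul_of_isHomogeneous [CommSemiring R] {p : MvPolynomial σ R} {k : ℕ}
    (hp : p.IsHomogeneous k) (c : R) (v : σ → R) :
    MvPolynomial.eval (c • v) p = c ^ k * MvPolynomial.eval v p := by
  rw [MvPolynomial.eval_eq, MvPolynomial.eval_eq, Finset.mul_sum]
  refine Finset.sum_congr rfl fun m hm => ?_
  have hk : ∑ i ∈ m.support, m i = k := by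
    rw [← hp (MvPolynomial.mem_support_iff.1 hm)]
    simp [Finsupp.weight_apply, Finsupp.sum]
  simp only [Pi.smul_apply, smul_eq_mul, mul_pow, Finset.prod_mul_distrib,
    Finset.prod_pow_eq_pow_sum, hk]
  ring

lemma eval_homogeneousComponent_eq_zero [CommRing R] [IsDomain R] [Infinite R]
    {p : MvPolynomial σ R} {v : σ → R} (h : ∀ t : R, MvPolynomial.eval (t • v) p = 0) (k : ℕ) :
    MvPolynomial.eval v (MvPolynomial.homogeneousComponent k p) = 0 := by
  by_cases hk : p.totalDegree < k
  · rw [MvPolynomial.homogeneousComponent_eq_zero _ _ hk, map_zero]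
  let q : Polynomial R := ∑ j ∈ Finset.range (p.totalDegree + 1),
    Polynomial.monomial j (MvPolynomial.eval v (MvPolynomial.homogeneousComponent j p))
  have hq : q = 0 := Polynomial.funext fun t => by
    have heval := h t
    rw [← MvPolynomial.sum_homogeneousComponent p, map_sum] at heval
    rw [Polynomial.eval_zero, ← heval, Polynomial.eval_finsetSum]
    refine Finset.sum_congr rfl fun j _ => ?_
    rw [eval_smul_of_isHomogeneous (MvPolynomial.homogeneousComponent_isHomogeneous j p),
      Polynomial.eval_monomial, mul_comm]
  have hcoeff := congrArg (Polynomial.coeff · k) hq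
  simpa [q, Polynomial.finsetSum_coeff, Polynomial.coeff_monomial, Nat.lt_succ_iff,
    not_lt.1 hk] using hcoeff

end Homogeneous

section Projective

variable {n : ℕ} {Z : Set (ProjSpace n)} {p : MvPolynomial (Fin n) ℂ} {k : ℕ}

lemma exists_rep_mk (v : Fin n → ℂ) (hv : v ≠ 0) :
    ∃ a : ℂ, a ≠ 0 ∧ (Projectivization.mk ℂ v hv).rep = a • v := by
  obtain ⟨a, ha⟩ := Projectivization.exists_smul_eq_mk_rep ℂ v hv
  exact ⟨a, a.ne_zero, ha.symm⟩

lemma eval_rep_mk_eq_zero_iff (hp : p.IsHomogeneous k) {v : Fin n → ℂ} (hv : v ≠ 0) :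
    MvPolynomial.eval (Projectivization.mk ℂ v hv).rep p = 0 ↔ MvPolynomial.eval v p = 0 := by
  obtain ⟨a, ha₀, ha⟩ := exists_rep_mk v hv
  rw [ha, eval_smul_of_isHomogeneous hp, mul_eq_zero, or_iff_right (pow_ne_zero _ ha₀)]

lemma isAlgebraicSet_eval_rep_eq_zero (hp : p.IsHomogeneous k) :
    IsAlgebraicSet {x : ProjSpace n | MvPolynomial.eval x.rep p = 0} :=
  ⟨{p}, fun _ hq => ⟨k, Set.mem_singleton_iff.1 hq ▸ hp⟩, by simp⟩

lemma isClosed_eval_rep_eq_zero (hp : p.IsHomogeneous k) :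
    IsClosed {x : ProjSpace n | MvPolynomial.eval x.rep p = 0} := by
  rw [← isQuotientMap_mk.isClosed_preimage]
  simp only [Set.preimage_ofPred_eq, eval_rep_mk_eq_zero_iff hp]
  exact isClosed_eq ((MvPolynomial.continuous_eval p).comp continuous_subtype_val)
    continuous_const

lemma IsAlgebraicSet.isClosed (hZ : IsAlgebraicSet Z) : IsClosed Z := by
  obtain ⟨I, hI, rfl⟩ := hZ
  simp only [Set.ofPred_forall]
  refine isClosed_biInter fun p hp => ?_
  obtain ⟨k, hk⟩ := hI p hp
  exact isClosed_eval_rep_eq_zero hk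

lemma isOpen_cone {O : Set (ProjSpace n)} (hO : IsOpen O) :
    IsOpen {v : Fin n → ℂ | ∃ h : v ≠ 0, Projectivization.mk ℂ v h ∈ O} := by
  have hpre := isQuotientMap_mk.isOpen_preimage.2 hO
  have hne : IsOpen {v : Fin n → ℂ | v ≠ 0} := isOpen_ne
  convert hne.isOpenMap_subtype_val _ hpre using 1
  ext v
  simp

/-- The ideal of the polynomials vanishing on the affine cone over `Z`, through which statements on
affine varieties are carried over to projective ones. -/
def coneIdeal (Z : Set (ProjSpace n)) : Ideal (MvPolynomial (Fin n) ℂ) where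
  carrier := {p | ∀ x ∈ Z, ∀ c : ℂ, MvPolynomial.eval (c • x.rep) p = 0}
  zero_mem' _ _ _ := map_zero _
  add_mem' hp hq x hx c := by rw [map_add, hp x hx c, hq x hx c, add_zero]
  smul_mem' r p hp x hx c := by rw [smul_eq_mul, map_mul, hp x hx c, mul_zero]

lemma eval_rep_eq_zero_of_mem_coneIdeal (hp : p ∈ coneIdeal Z) {x : ProjSpace n} (hx : x ∈ Z) :
    MvPolynomial.eval x.rep p = 0 := by
  simpa only [one_smul] using hp x hx 1

lemma mem_coneIdeal_of_isHomogeneous (hp : p.IsHomogeneous k)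
    (h : ∀ x ∈ Z, MvPolynomial.eval x.rep p = 0) : p ∈ coneIdeal Z :=
  fun x hx c => by rw [eval_smul_of_isHomogeneous hp, h x hx, mul_zero]

lemma homogeneousComponent_mem_coneIdeal (hp : p ∈ coneIdeal Z) (k : ℕ) :
    MvPolynomial.homogeneousComponent k p ∈ coneIdeal Z :=
  mem_coneIdeal_of_isHomogeneous (MvPolynomial.homogeneousComponent_isHomogeneous k p)
    fun x hx => eval_homogeneousComponent_eq_zero (hp x hx) k

lemma IsAlgebraicSet.mk_mem (hZ : IsAlgebraicSet Z) {v : Fin n → ℂ} (hv : v ≠ 0)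
    (h : ∀ p ∈ coneIdeal Z, MvPolynomial.eval v p = 0) : Projectivization.mk ℂ v hv ∈ Z := by
  obtain ⟨I, hI, rfl⟩ := hZ
  intro p hp
  obtain ⟨k, hk⟩ := hI p hp
  exact (eval_rep_mk_eq_zero_iff hk hv).2
    (h p (mem_coneIdeal_of_isHomogeneous hk fun x hx => hx p hp))

attribute [local instance] MvPolynomial.gradedAlgebra

lemma isHomogeneous_coneIdeal (Z : Set (ProjSpace n)) :
    (coneIdeal Z).IsHomogeneous (MvPolynomial.homogeneousSubmodule (Fin n) ℂ) := by
  intro k p hp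
  have hcomp := homogeneousComponent_mem_coneIdeal hp k
  rwa [← MvPolynomial.decomposition.decompose'_apply] at hcomp

lemma IsIrreducibleVariety.isPrime_coneIdeal (hZ : IsIrreducibleVariety Z) :
    (coneIdeal Z).IsPrime := by
  obtain ⟨-, ⟨x₀, hx₀⟩, hirr⟩ := hZ
  refine (isHomogeneous_coneIdeal Z).isPrime_of_homogeneous_mem_or_mem ?_ ?_
  · rw [Ne, Ideal.eq_top_iff_one]
    intro hone
    simpa using hone x₀ hx₀ 1
  · rintro f g ⟨k, hf⟩ ⟨l, hg⟩ hfg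
    rw [MvPolynomial.mem_homogeneousSubmodule] at hf hg
    refine (hirr _ _ (isAlgebraicSet_eval_rep_eq_zero hf) (isAlgebraicSet_eval_rep_eq_zero hg)
      fun x hx => ?_).imp (mem_coneIdeal_of_isHomogeneous hf) (mem_coneIdeal_of_isHomogeneous hg)
    have hmul := eval_rep_eq_zero_of_mem_coneIdeal hfg hx
    rwa [map_mul, mul_eq_zero] at hmul

theorem IsIrreducibleVariety.eval_rep_eq_zero_of_isOpen (hZ : IsIrreducibleVariety Z)
    {O : Set (ProjSpace n)} (hO : IsOpen O) (hne : (O ∩ Z).Nonempty) (hp : p.IsHomogeneous k)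
    (h : ∀ x ∈ O ∩ Z, MvPolynomial.eval x.rep p = 0) {x : ProjSpace n} (hx : x ∈ Z) :
    MvPolynomial.eval x.rep p = 0 := by
  obtain ⟨x₀, hx₀O, hx₀⟩ := hne
  have := hZ.isPrime_coneIdeal
  refine eval_rep_eq_zero_of_mem_coneIdeal (mem_of_eventually_eval_eq_zero (coneIdeal Z)
    (fun q hq => eval_rep_eq_zero_of_mem_coneIdeal hq hx₀) ?_) hx
  filter_upwards [(isOpen_cone hO).mem_nhds ⟨x₀.rep_nonzero, by rwa [x₀.mk_rep]⟩]
  rintro z ⟨hz₀, hzO⟩ hz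
  exact (eval_rep_mk_eq_zero_iff hp hz₀).1 (h _ ⟨hzO, hZ.1.mk_mem hz₀ hz⟩)

lemma IsIrreducibleVariety.dotProduct_rep_eq_zero_of_isOpen (hZ : IsIrreducibleVariety Z)
    {O : Set (ProjSpace n)} (hO : IsOpen O) (hne : (O ∩ Z).Nonempty) {w : Fin n → ℂ}
    (h : ∀ x ∈ O ∩ Z, w ⬝ᵥ x.rep = 0) {x : ProjSpace n} (hx : x ∈ Z) : w ⬝ᵥ x.rep = 0 := by
  let l : MvPolynomial (Fin n) ℂ := ∑ i, MvPolynomial.C (w i) * MvPolynomial.X i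
  have hl : l.IsHomogeneous 1 :=
    MvPolynomial.IsHomogeneous.sum _ _ _ fun i _ => MvPolynomial.isHomogeneous_C_mul_X (w i) i
  have heval (v : Fin n → ℂ) : MvPolynomial.eval v l = w ⬝ᵥ v := by simp [l, dotProduct]
  simp only [← heval] at h ⊢
  exact hZ.eval_rep_eq_zero_of_isOpen hO hne hl h hx

end Projective

/-! ### Zero sets of positive measure -/

section ZeroSets

lemma eqOn_zero_of_volume_ne_zero {F : ℝ → ℂ} {U T : Set ℝ} (hU : IsOpen U)
    (hconn : IsPreconnected U) (hF : AnalyticOnNhd ℝ F U) (hTU : T ⊆ U) (hT : volume T ≠ 0)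
    (h : Set.EqOn F 0 T) : Set.EqOn F 0 U := by
  intro x hx
  by_contra hFx
  have hcodiscrete := hF.preimage_zero_mem_codiscreteWithin hFx hx ⟨⟨x, hx⟩, hconn⟩
  have hnull := ae_restrict_le_codiscreteWithin (μ := volume) hU.measurableSet hcodiscrete
  rw [mem_ae_iff, Measure.restrict_apply' hU.measurableSet] at hnull
  refine hT (measure_mono_null (fun t ht => ?_) hnull)
  exact ⟨by simpa using h ht, hTU ht⟩

variable {E : Type*} [NormedAddCommGroup E] [NormedSpace ℝ E] {g : E → ℂ} {U : Set E}

/-- Real analyticity of `g` along the intersection of `U` with every line. Unlike joint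
analyticity, it is available for holomorphic functions of several variables from the theory in one
variable, and it suffices for the identity theorem. -/
def LineAnalyticOn (g : E → ℂ) (U : Set E) : Prop :=
  ∀ a ξ : E, ∀ t : ℝ, a + t • ξ ∈ U → AnalyticAt ℝ (fun s : ℝ => g (a + s • ξ)) t

lemma LineAnalyticOn.mono {V : Set E} (hg : LineAnalyticOn g U) (hV : V ⊆ U) :
    LineAnalyticOn g V :=
  fun a ξ t ht => hg a ξ t (hV ht)

lemma LineAnalyticOn.comp_linearMap {E' : Type*} [NormedAddCommGroup E'] [NormedSpace ℝ E']
    (hg : LineAnalyticOn g U) (L : E' →ₗ[ℝ] E) : LineAnalyticOn (g ∘ L) (L ⁻¹' U) := by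
  intro a ξ t ht
  rw [Set.mem_preimage, map_add, map_smul] at ht
  simpa only [Function.comp_apply, map_add, map_smul] using hg (L a) (L ξ) t ht

variable {m : ℕ}

lemma cons_mem_ball {a : Fin (m + 1) → ℝ} {r t : ℝ} (hr : 0 < r) {y : Fin m → ℝ} :
    (Fin.cons t y : Fin (m + 1) → ℝ) ∈ Metric.ball a r ↔
      t ∈ Metric.ball (a 0) r ∧ y ∈ Metric.ball (Fin.tail a) r := by
  simp only [Metric.mem_ball, dist_pi_lt_iff hr, Fin.forall_fin_succ, Fin.cons_zero, Fin.cons_succ,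
    Fin.tail]

lemma volume_setOf_slice_ne_zero {S : Set (Fin (m + 1) → ℝ)} (hS : MeasurableSet S)
    (hS₀ : volume S ≠ 0) :
    volume {t : ℝ | volume {y : Fin m → ℝ | Fin.cons t y ∈ S} ≠ 0} ≠ 0 := by
  let e := MeasurableEquiv.piFinSuccAbove (fun _ : Fin (m + 1) => ℝ) 0
  have he (t : ℝ) (y : Fin m → ℝ) : e.symm (t, y) = Fin.cons t y := by
    simp [e, MeasurableEquiv.piFinSuccAbove, Fin.insertNthEquiv]
  have hpre : volume (e.symm ⁻¹' S) ≠ 0 := by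
    rwa [((volume_preserving_piFinSuccAbove (fun _ : Fin (m + 1) => ℝ) 0).symm).measure_preimage
      hS.nullMeasurableSet]
  simp only [← he]
  intro hnull
  exact hpre ((Measure.measure_prod_null (e.symm.measurable hS)).2 (mem_ae_iff.2 hnull))

lemma LineAnalyticOn.cons {g : (Fin (m + 1) → ℝ) → ℂ} {a : Fin (m + 1) → ℝ} {r t : ℝ}
    (hr : 0 < r) (hg : LineAnalyticOn g (Metric.ball a r)) (ht : t ∈ Metric.ball (a 0) r) :
    LineAnalyticOn (fun y => g (Fin.cons t y)) (Metric.ball (Fin.tail a) r) := by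
  have hcons (y ξ : Fin m → ℝ) (s : ℝ) : (Fin.cons t (y + s • ξ) : Fin (m + 1) → ℝ) =
      Fin.cons t y + s • Fin.cons 0 ξ := by
    ext i
    refine Fin.cases ?_ (fun j => ?_) i <;> simp
  intro y ξ s hs
  simp only [hcons]
  refine hg _ _ s ?_
  rw [← hcons]
  exact (cons_mem_ball hr).2 ⟨ht, hs⟩

lemma LineAnalyticOn.analyticOnNhd_cons {g : (Fin (m + 1) → ℝ) → ℂ} {a : Fin (m + 1) → ℝ} {r : ℝ}
    (hr : 0 < r) (hg : LineAnalyticOn g (Metric.ball a r)) {y : Fin m → ℝ}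
    (hy : y ∈ Metric.ball (Fin.tail a) r) :
    AnalyticOnNhd ℝ (fun t => g (Fin.cons t y)) (Metric.ball (a 0) r) := by
  have hcons (t : ℝ) : (Fin.cons t y : Fin (m + 1) → ℝ) =
      Fin.cons 0 y + t • Fin.cons 1 0 := by
    ext i
    refine Fin.cases ?_ (fun j => ?_) i <;> simp
  intro t ht
  rw [funext fun t => congrArg g (hcons t)]
  refine hg _ _ t ?_
  rw [← hcons]
  exact (cons_mem_ball hr).2 ⟨ht, hy⟩

theorem LineAnalyticOn.eqOn_zero_of_volume_ne_zero {g : (Fin m → ℝ) → ℂ} {a : Fin m → ℝ} {r : ℝ}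
    (hr : 0 < r) (hg : LineAnalyticOn g (Metric.ball a r)) {S : Set (Fin m → ℝ)}
    (hS : MeasurableSet S) (hSa : S ⊆ Metric.ball a r) (hS₀ : volume S ≠ 0)
    (h : Set.EqOn g 0 S) : Set.EqOn g 0 (Metric.ball a r) := by
  induction m with
  | zero =>
    intro x _
    obtain ⟨y, hy⟩ := nonempty_of_measure_ne_zero hS₀
    rw [Subsingleton.elim x y]
    exact h hy
  | succ m ih =>
    set T : Set ℝ := {t | volume {y : Fin m → ℝ | Fin.cons t y ∈ S} ≠ 0}
    have hTa : T ⊆ Metric.ball (a 0) r := by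
      intro t ht
      obtain ⟨y, hy⟩ := nonempty_of_measure_ne_zero ht
      exact ((cons_mem_ball hr).1 (hSa hy)).1
    have hslice (t : ℝ) (ht : t ∈ T) :
        Set.EqOn (fun y => g (Fin.cons t y)) 0 (Metric.ball (Fin.tail a) r) := by
      have hcons : Measurable fun y : Fin m → ℝ => (Fin.cons t y : Fin (m + 1) → ℝ) := by fun_prop
      exact ih (hg.cons hr (hTa ht)) (hcons hS) (fun y hy => ((cons_mem_ball hr).1 (hSa hy)).2) ht
        fun y hy => h hy
    intro x hx
    rw [← Fin.cons_self_tail x] at hx ⊢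
    obtain ⟨hx₀, hxtail⟩ := (cons_mem_ball hr).1 hx
    exact Donaldson.eqOn_zero_of_volume_ne_zero Metric.isOpen_ball (convex_ball _ _).isPreconnected
      (hg.analyticOnNhd_cons hr hxtail) hTa (volume_setOf_slice_ne_zero hS hS₀)
      (fun t ht => hslice t ht hxtail) hx₀

lemma measurableSet_inter_eq_zero {X : Type*} [TopologicalSpace X] [MeasurableSpace X]
    [OpensMeasurableSpace X] {g : X → ℂ} {U : Set X} (hU : IsOpen U) (hg : ContinuousOn g U) :
    MeasurableSet {u | u ∈ U ∧ g u = 0} := by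
  convert hU.measurableSet.diff
    (hg.isOpen_inter_preimage hU isOpen_compl_singleton : IsOpen (U ∩ g ⁻¹' {0}ᶜ)).measurableSet
    using 1
  ext u
  simp

theorem LineAnalyticOn.exists_isOpen_eqOn_zero [FiniteDimensional ℝ E] [MeasurableSpace E]
    [BorelSpace E] (μ : Measure E) [μ.IsAddHaarMeasure] (hU : IsOpen U) (hcont : ContinuousOn g U)
    (hg : LineAnalyticOn g U) (h : μ {u | u ∈ U ∧ g u = 0} ≠ 0) :
    ∃ W ⊆ U, IsOpen W ∧ W.Nonempty ∧ Set.EqOn g 0 W := by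
  set S := {u | u ∈ U ∧ g u = 0}
  have hS : MeasurableSet S := measurableSet_inter_eq_zero hU hcont
  let L : (Fin (Module.finrank ℝ E) → ℝ) ≃L[ℝ] E := ContinuousLinearEquiv.ofFinrankEq (by simp)
  have hLS : volume (L ⁻¹' S) ≠ 0 := by
    intro hnull
    rw [← Measure.map_apply L.continuous.measurable hS] at hnull
    exact h ((Measure.absolutelyContinuous_isAddHaarMeasure μ (volume.map L)) hnull)
  obtain ⟨x, hx, hxpos⟩ := exists_mem_forall_mem_nhdsWithin_pos_measure hLS
  obtain ⟨r, hr, hball⟩ := Metric.isOpen_iff.1 (hU.preimage L.continuous) x hx.1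
  have hzero : Set.EqOn (g ∘ L) 0 (Metric.ball x r) :=
    ((hg.comp_linearMap L.toLinearMap).mono hball).eqOn_zero_of_volume_ne_zero hr
      ((L.continuous.measurable hS).inter Metric.isOpen_ball.measurableSet) Set.inter_subset_right
      (hxpos _ (inter_mem self_mem_nhdsWithin
        (mem_nhdsWithin_of_mem_nhds (Metric.ball_mem_nhds x hr)))).ne' fun y hy => hy.1.2
  refine ⟨L '' Metric.ball x r, Set.image_subset_iff.2 hball,
    L.toHomeomorph.isOpenMap _ Metric.isOpen_ball, ⟨L x, x, Metric.mem_ball_self hr, rfl⟩, ?_⟩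
  rintro _ ⟨y, hy, rfl⟩
  exact hzero hy

end ZeroSets

/-! ### Hermitian pairings of holomorphic maps -/

section Polarization

lemma eqOn_zero_of_eq_zero_on_reals {F : ℂ → ℂ} {r : ℝ} (hr : 0 < r)
    (hF : DifferentiableOn ℂ F (Metric.ball 0 r)) (h : ∀ t : ℝ, |t| < r → F t = 0) :
    Set.EqOn F 0 (Metric.ball 0 r) := by
  refine (hF.analyticOnNhd Metric.isOpen_ball).eqOn_zero_of_preconnected_of_frequently_eq_zero
    (convex_ball 0 r).isPreconnected (Metric.mem_ball_self hr) ?_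
  have hreal : Tendsto (fun t : ℝ => (t : ℂ)) (𝓝[≠] 0) (𝓝[≠] 0) := by
    refine tendsto_nhdsWithin_iff.2 ⟨?_, ?_⟩
    · exact (Complex.continuous_ofReal.tendsto' 0 0 (by simp)).mono_left nhdsWithin_le_nhds
    · filter_upwards [self_mem_nhdsWithin] with t ht
      simpa using ht
  have hzero : ∀ᶠ t : ℝ in 𝓝[≠] 0, F t = 0 := by
    filter_upwards [mem_nhdsWithin_of_mem_nhds (Metric.ball_mem_nhds (0 : ℝ) hr)] with t ht
    exact h t (by simpa using ht)
  exact hreal.frequently hzero.frequently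

lemma eq_zero_of_eq_zero_on_reals₂ {K : ℂ → ℂ → ℂ} {r : ℝ} (hr : 0 < r)
    (hK : ∀ y ∈ Metric.ball (0 : ℂ) r, DifferentiableOn ℂ (K · y) (Metric.ball 0 r))
    (hK' : ∀ x ∈ Metric.ball (0 : ℂ) r, DifferentiableOn ℂ (K x) (Metric.ball 0 r))
    (h : ∀ x y : ℝ, |x| < r → |y| < r → K x y = 0) {x y : ℂ} (hx : x ∈ Metric.ball 0 r)
    (hy : y ∈ Metric.ball 0 r) : K x y = 0 := by
  refine eqOn_zero_of_eq_zero_on_reals hr (hK' x hx) (fun t ht => ?_) hy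
  exact eqOn_zero_of_eq_zero_on_reals hr (hK t (by simpa using ht)) (fun s hs => h s t hs ht) hx

-- The set `t = conj s` is totally real: it is the real plane in the coordinates `s = x + iy`,
-- `t = x - iy`.
lemma eq_zero_of_eq_zero_on_conj {H : ℂ × ℂ → ℂ} {r : ℝ} (hr : 0 < r)
    (hH : DifferentiableOn ℂ H (Metric.ball 0 (2 * r)))
    (h : ∀ s : ℂ, ‖s‖ < 2 * r → H (s, star s) = 0) {s t : ℂ} (hs : ‖s‖ < r) (ht : ‖t‖ < r) :
    H (s, t) = 0 := by
  let K (x y : ℂ) : ℂ := H (x + Complex.I * y, x - Complex.I * y)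
  have hmem {x y : ℂ} (hx : x ∈ Metric.ball 0 r) (hy : y ∈ Metric.ball 0 r) :
      (x + Complex.I * y, x - Complex.I * y) ∈ Metric.ball (0 : ℂ × ℂ) (2 * r) := by
    rw [mem_ball_zero_iff] at hx hy ⊢
    have hadd := norm_add_le x (Complex.I * y)
    have hsub := norm_sub_le x (Complex.I * y)
    rw [norm_mul, Complex.norm_I, one_mul] at hadd hsub
    exact max_lt (by linarith) (by linarith)
  have hreal (x y : ℝ) (hx : |x| < r) (hy : |y| < r) : K x y = 0 := by
    have hxy := hmem (x := x) (y := y) (by simpa using hx) (by simpa using hy)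
    have hconj : star ((x : ℂ) + Complex.I * y) = x - Complex.I * y := by simp [sub_eq_add_neg]
    rw [mem_ball_zero_iff] at hxy
    simpa only [hconj] using h _ ((norm_fst_le _).trans_lt hxy)
  have hx : (s + t) / 2 ∈ Metric.ball 0 r := by
    rw [mem_ball_zero_iff, norm_div, Complex.norm_two]
    linarith [norm_add_le s t]
  have hy : -(Complex.I * (s - t)) / 2 ∈ Metric.ball 0 r := by
    rw [mem_ball_zero_iff, norm_div, Complex.norm_two, norm_neg, norm_mul, Complex.norm_I]
    linarith [norm_sub_le s t]
  have hzero : K ((s + t) / 2) (-(Complex.I * (s - t)) / 2) = 0 := by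
    refine eq_zero_of_eq_zero_on_reals₂ hr (fun y hy => ?_) (fun x hx => ?_) hreal hx hy
    · exact hH.comp (f := fun x : ℂ => (x + Complex.I * y, x - Complex.I * y)) (by fun_prop)
        fun x hx => hmem hx hy
    · exact hH.comp (f := fun y : ℂ => (x + Complex.I * y, x - Complex.I * y)) (by fun_prop)
        fun y hy => hmem hx hy
  convert hzero using 3
  · linear_combination (s - t) / 2 * Complex.I_mul_I
  · linear_combination (t - s) / 2 * Complex.I_mul_I

variable {E ι : Type*} [NormedAddCommGroup E] [NormedSpace ℂ E] [Fintype ι] {p q : E → ι → ℂ}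
  {U : Set E}

lemma continuousOn_dotProduct_star {X : Type*} [TopologicalSpace X] {p q : X → ι → ℂ} {U : Set X}
    (hp : ContinuousOn p U) (hq : ContinuousOn q U) :
    ContinuousOn (fun u => p u ⬝ᵥ star (q u)) U :=
  continuousOn_finsetSum _ fun i _ => (continuousOn_pi.1 hp i).mul (continuousOn_pi.1 hq i).star

lemma analyticAt_comp_line {f : E → ℂ} (hU : IsOpen U) (hf : DifferentiableOn ℂ f U) (a ξ : E)
    {s : ℂ} (hs : a + s • ξ ∈ U) : AnalyticAt ℂ (fun s : ℂ => f (a + s • ξ)) s := by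
  have hline : Differentiable ℂ fun s : ℂ => a + s • ξ := by fun_prop
  exact (hf.comp hline.differentiableOn (Set.mapsTo_preimage _ U)).analyticAt
    ((hU.preimage hline.continuous).mem_nhds hs)

lemma lineAnalyticOn_dotProduct_star (hU : IsOpen U) (hp : DifferentiableOn ℂ p U)
    (hq : DifferentiableOn ℂ q U) : LineAnalyticOn (fun u => p u ⬝ᵥ star (q u)) U := by
  intro a ξ t ht
  have hreal {f : E → ℂ} (hf : DifferentiableOn ℂ f U) :
      AnalyticAt ℝ (fun s : ℝ => f (a + s • ξ)) t :=
    ((analyticAt_comp_line hU hf a ξ (s := t) ht).restrictScalars (𝕜 := ℝ)).comp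
      (Complex.ofRealCLM.analyticAt t)
  exact Finset.analyticAt_fun_sum _ fun i _ => (hreal (differentiableOn_pi.1 hp i)).fun_mul
    ((Complex.conjCLE.toContinuousLinearMap.analyticAt _).comp (hreal (differentiableOn_pi.1 hq i)))

lemma differentiableOn_conj_comp_line {f : E → ℂ} (hU : IsOpen U) (hf : DifferentiableOn ℂ f U)
    (a ξ : E) : DifferentiableOn ℂ (fun s : ℂ => star (f (a + star s • ξ)))
      {s | a + star s • ξ ∈ U} := by
  intro s hs
  have hconj := (analyticAt_comp_line hU hf a ξ hs).differentiableAt.conj_conj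
  simpa [Function.comp_def] using hconj.differentiableWithinAt

lemma dotProduct_star_eq_zero_of_ball {u v : E} {ρ : ℝ}
    (hp : DifferentiableOn ℂ p (Metric.ball u ρ)) (hq : DifferentiableOn ℂ q (Metric.ball u ρ))
    (h : ∀ w ∈ Metric.ball u ρ, p w ⬝ᵥ star (q w) = 0) (hv : v ∈ Metric.ball u (ρ / 4)) :
    p v ⬝ᵥ star (q u) = 0 := by
  set ξ := v - u with hξ
  have hmem {s : ℂ} (hs : ‖s‖ < 2 * 2) : u + s • ξ ∈ Metric.ball u ρ := by
    rw [mem_ball_iff_norm] at hv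
    rw [mem_ball_iff_norm, add_sub_cancel_left, norm_smul]
    nlinarith [norm_nonneg s, norm_nonneg ξ]
  let H (z : ℂ × ℂ) : ℂ := p (u + z.1 • ξ) ⬝ᵥ star (q (u + star z.2 • ξ))
  have hH : DifferentiableOn ℂ H (Metric.ball 0 (2 * 2)) := by
    have hz {z : ℂ × ℂ} (hz : z ∈ Metric.ball 0 (2 * 2)) : ‖z.1‖ < 2 * 2 ∧ ‖z.2‖ < 2 * 2 :=
      max_lt_iff.1 (mem_ball_zero_iff.1 hz)
    refine DifferentiableOn.fun_sum fun i _ => DifferentiableOn.mul ?_ ?_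
    · exact (differentiableOn_pi.1 hp i).comp (f := fun z : ℂ × ℂ => u + z.1 • ξ) (by fun_prop)
        fun z hz' => hmem (hz hz').1
    · have hconj :=
        differentiableOn_conj_comp_line Metric.isOpen_ball (differentiableOn_pi.1 hq i) u ξ
      exact hconj.comp (f := Prod.snd) (by fun_prop) fun z hz' =>
        hmem ((norm_star _).trans_lt (hz hz').2)
  have hzero : H (1, 0) = 0 := by
    refine eq_zero_of_eq_zero_on_conj two_pos hH (fun s hs => ?_) (by simp) (by simp)
    simp only [H, star_star]
    exact h _ (hmem hs)
  simpa [H, hξ] using hzero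

end Polarization

/-! ### Invertibility of the channel -/

section Invertible

variable {n d : ℕ} {Z : Set (ProjSpace n)}

lemma expect_mk_eq_zero_iff {G A : Matrix (Fin n) (Fin n) ℂ} (hG : G.PosDef) (hA : A ∈ hermOps G)
    {v : Fin n → ℂ} (hv : v ≠ 0) :
    expect G A (Projectivization.mk ℂ v hv) = 0 ↔ ((G⁻¹ * A) *ᵥ v) ⬝ᵥ star v = 0 := by
  obtain ⟨a, ha, hrep⟩ := exists_rep_mk v hv
  have hscalar : ‖a‖ ^ 2 ≠ 0 := pow_ne_zero 2 (norm_ne_zero_iff.2 ha)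
  rw [expect_eq hG, div_eq_zero_iff, or_iff_left (quad_inv_rep_pos hG _).ne', hrep, quad_smul_vec,
    mul_eq_zero, or_iff_right hscalar, ← Complex.ofReal_eq_zero,
    ofReal_quad (isHermitian_inv_mul hG hA), dotProduct_comm]

/-- `Z` is linearly nondegenerate: it lies in no proper projective subspace. -/
def IsNondegenerate (Z : Set (ProjSpace n)) : Prop :=
  ∀ S : Submodule ℂ (Fin n → ℂ), S ≠ ⊤ → ¬ Z ⊆ projSubspace S

lemma IsNondegenerate.eq_zero_of_dotProduct_rep_eq_zero (hspan : IsNondegenerate Z)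
    {w : Fin n → ℂ} (hw : ∀ x ∈ Z, w ⬝ᵥ x.rep = 0) : w = 0 := by
  have hker : LinearMap.ker (dotProductBilin ℂ ℂ w) = ⊤ := by
    by_contra hproper
    exact hspan _ hproper fun x hx => mem_projSubspace.2 (hw x hx)
  exact dotProduct_eq_zero w fun v => LinearMap.mem_ker.1 (hker ▸ Submodule.mem_top)

variable {U V : Set (Fin d → ℂ)} {φ : (Fin d → ℂ) → ProjSpace n} {f : (Fin d → ℂ) → (Fin n → ℂ)}

lemma IsNondegenerate.eq_zero_of_dotProduct_lift_eq_zero (hspan : IsNondegenerate Z)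
    (hZ : IsIrreducibleVariety Z) (hφ : IsLocalParam Z U φ)
    (hf : ∀ u ∈ U, ∃ h : f u ≠ 0, φ u = Projectivization.mk ℂ (f u) h)
    (hVU : V ⊆ U) (hV : IsOpen V) (hne : V.Nonempty) {w : Fin n → ℂ}
    (hw : ∀ v ∈ V, w ⬝ᵥ f v = 0) : w = 0 := by
  obtain ⟨O, hO, himage⟩ := hφ.image_open V hVU hV
  have hO₀ : ∀ x ∈ O ∩ Z, w ⬝ᵥ x.rep = 0 := by
    rw [← himage]
    rintro _ ⟨v, hv, rfl⟩
    obtain ⟨hfv, hφv⟩ := hf v (hVU hv)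
    obtain ⟨a, -, hrep⟩ := exists_rep_mk (f v) hfv
    rw [hφv, hrep, dotProduct_smul, hw v hv, smul_zero]
  exact hspan.eq_zero_of_dotProduct_rep_eq_zero fun x hx =>
    hZ.dotProduct_rep_eq_zero_of_isOpen hO (himage ▸ hne.image φ) hO₀ hx

lemma IsNondegenerate.eq_zero_of_volume_ne_zero (hspan : IsNondegenerate Z)
    (hZ : IsIrreducibleVariety Z) (hφ : IsLocalParam Z U φ) (hfd : DifferentiableOn ℂ f U)
    (hf : ∀ u ∈ U, ∃ h : f u ≠ 0, φ u = Projectivization.mk ℂ (f u) h)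
    {B : Matrix (Fin n) (Fin n) ℂ}
    (hB : volume {u | u ∈ U ∧ (B *ᵥ f u) ⬝ᵥ star (f u) = 0} ≠ 0) : B = 0 := by
  have hBf : DifferentiableOn ℂ (fun u => B *ᵥ f u) U :=
    B.mulVecLin.toContinuousLinearMap.differentiable.comp_differentiableOn hfd
  obtain ⟨W, hWU, hW, hWne, hW₀⟩ :=
    (lineAnalyticOn_dotProduct_star hφ.isOpen hBf hfd).exists_isOpen_eqOn_zero volume hφ.isOpen
      (continuousOn_dotProduct_star hBf.continuousOn hfd.continuousOn) hB
  -- Polarization decouples the two arguments; nondegeneracy then applies to each of them in turn.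
  have hleft (u : Fin d → ℂ) (hu : u ∈ W) : Bᴴ *ᵥ f u = 0 := by
    obtain ⟨ρ, hρ, hball⟩ := Metric.isOpen_iff.1 hW u hu
    have hballU := hball.trans hWU
    have hsmall : Metric.ball u (ρ / 4) ⊆ Metric.ball u ρ := Metric.ball_subset_ball (by linarith)
    rw [← star_eq_zero, Matrix.star_mulVec, Matrix.conjTranspose_conjTranspose]
    refine hspan.eq_zero_of_dotProduct_lift_eq_zero hZ hφ hf (hsmall.trans hballU)
      Metric.isOpen_ball ⟨u, Metric.mem_ball_self (by positivity)⟩ fun v hv => ?_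
    rw [← Matrix.dotProduct_mulVec, dotProduct_comm]
    exact dotProduct_star_eq_zero_of_ball (hBf.mono hballU) (hfd.mono hballU)
      (fun w hw => hW₀ (hball hw)) hv
  have hright : Bᴴ = 0 := funext fun i =>
    hspan.eq_zero_of_dotProduct_lift_eq_zero hZ hφ hf hWU hW hWne fun u hu =>
      congrFun (hleft u hu) i
  exact Matrix.conjTranspose_eq_zero.1 hright

variable {ν : Measure (ProjSpace n)} [IsFiniteMeasure ν] {G A : Matrix (Fin n) (Fin n) ℂ}

theorem IsNondegenerate.eq_zero_of_channelFun_eq_zero (hspan : IsNondegenerate Z)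
    (hZ : IsIrreducibleVariety Z) (hac : IsAbsContOn ν Z) (hνZ : 0 < ν Z) (hG : G.PosDef)
    (hA : A ∈ hermOps G) (hEA : channelFun ν G A = 0) : A = 0 := by
  have hν : ν ≠ 0 := by
    rintro rfl
    exact hνZ.ne' rfl
  set N : Set (ProjSpace n) := Z ∩ {x | expect G A x = 0} with hN
  have hNmeas : MeasurableSet N := (hZ.1.isClosed.inter
    (isClosed_eq (continuous_expect hG A) continuous_const)).measurableSet
  have hνN : ν N ≠ 0 := by
    rw [hN, measure_inter_conull (t := {x | expect G A x = 0})
      (ae_expect_eq_zero_of_channelFun_eq_zero hν hG hA hEA)]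
    exact hνZ.ne'
  have hnotnull : ¬ IsNullIn Z N := fun h => hνN (hac N hNmeas Set.inter_subset_left h)
  simp only [IsNullIn, not_forall] at hnotnull
  obtain ⟨d, U, φ, hφ, hvol⟩ := hnotnull
  obtain ⟨f, hfd, hf, -⟩ := hφ.immersion
  have hzero : U ∩ φ ⁻¹' N ⊆ {u | u ∈ U ∧ ((G⁻¹ * A) *ᵥ f u) ⬝ᵥ star (f u) = 0} := by
    rintro u ⟨hu, -, hu₀⟩
    obtain ⟨hfu, hφu⟩ := hf u hu
    exact ⟨hu, (expect_mk_eq_zero_iff hG hA hfu).1 (hφu ▸ hu₀)⟩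
  have hGA : G⁻¹ * A = 0 :=
    hspan.eq_zero_of_volume_ne_zero hZ hφ hfd hf fun h => hvol (measure_mono_null hzero h)
  rw [← Matrix.mul_nonsing_inv_cancel_left G A hG.det_pos.ne'.isUnit, hGA, Matrix.mul_zero]

theorem IsNondegenerate.isUnit_quantumChannel (hspan : IsNondegenerate Z)
    (hZ : IsIrreducibleVariety Z) (hac : IsAbsContOn ν Z) (hνZ : 0 < ν Z) (hG : G.PosDef) :
    IsUnit (quantumChannel ν G hG) := by
  rw [LinearMap.isUnit_iff_ker_eq_bot, LinearMap.ker_eq_bot']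
  intro A hA
  exact Subtype.ext
    (hspan.eq_zero_of_channelFun_eq_zero hZ hac hνZ hG A.2 (congrArg Subtype.val hA))

end Invertible

end Donaldson

end

theorem theorem4p4_general {n : ℕ} (ν : Measure (Donaldson.ProjSpace n)) [IsFiniteMeasure ν]
    (hν : ν ≠ 0) :
    (Donaldson.IsStable ν →
      (∀ G : Matrix (Fin n) (Fin n) ℂ, G.PosDef → (Donaldson.donaldsonMap ν G).PosDef) ∧
      (∀ G₀ : Matrix (Fin n) (Fin n) ℂ, G₀.PosDef →
        ∃ G : Matrix (Fin n) (Fin n) ℂ, G.PosDef ∧ Donaldson.donaldsonMap ν G = G ∧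
          Tendsto (fun r : ℕ => (Donaldson.donaldsonMap ν)^[r] G₀) atTop (𝓝 G)) ∧
      (∀ G G' : Matrix (Fin n) (Fin n) ℂ, G.PosDef → G'.PosDef →
        Donaldson.donaldsonMap ν G = G → Donaldson.donaldsonMap ν G' = G' →
          ∃ c : ℝ, 0 < c ∧ G' = c • G) ∧
      ∀ (G : Matrix (Fin n) (Fin n) ℂ) (hG : G.PosDef), Donaldson.donaldsonMap ν G = G →
        0 < Donaldson.spectralGap (Donaldson.quantumChannel ν G hG)) ∧
    ∀ Z, Donaldson.IsIrreducibleVariety Z → Donaldson.IsAbsContOn ν Z → 0 < ν Z →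
      Donaldson.IsNondegenerate Z → ∀ (G : Matrix (Fin n) (Fin n) ℂ) (hG : G.PosDef),
        IsUnit (Donaldson.quantumChannel ν G hG) := by
  refine ⟨fun hs => ⟨fun G hG => Donaldson.donaldsonMap_posDef hs hν hG, fun G₀ hG₀ => ?_,
    fun G G' hG hG' hfix hfix' =>
      Donaldson.eq_smul_of_donaldsonMap_eq hs hν hG hfix hG' hfix',
    fun G hG hfix => Donaldson.spectralGap_quantumChannel_pos hs hν hG hfix⟩,
    fun Z hZ hac hνZ hspan G hG => hspan.isUnit_quantumChannel hZ hac hνZ hG⟩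
  obtain ⟨P, hP, hfix⟩ := Donaldson.exists_donaldsonMap_eq hs hν
  obtain ⟨b, hb, hlim⟩ := Donaldson.exists_tendsto_iterate_donaldsonMap hs hν hP hfix hG₀
  exact ⟨b • P, hP.smul hb, by rw [Donaldson.donaldsonMap_smul ν hP hb, hfix], hlim⟩

theorem theorem4p4 {n : ℕ} (ν : Measure (Donaldson.ProjSpace n)) [IsFiniteMeasure ν] (hν : ν ≠ 0)
    (Y : Set (Donaldson.ProjSpace n)) (hY : Donaldson.IsAlgebraicSet Y) (hsupp : ν Yᶜ = 0)
    (hac : ∀ Z, Donaldson.IsComponent Z Y → Donaldson.IsAbsContOn ν Z)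
    -- `ν(Σ) / (dim Σ + 1) < |ν| / n` for all proper projective subspaces `Σ = ℙ(S)`
    (hstab : ∀ S : Submodule ℂ (Fin n → ℂ), S ≠ ⊥ → S ≠ ⊤ →
      ν.real (Donaldson.projSubspace S) / (Module.finrank ℂ S : ℝ) < ν.real Set.univ / (n : ℝ)) :
    -- `T_ν` preserves the positive Hermitian matrices
    (∀ G : Matrix (Fin n) (Fin n) ℂ, G.PosDef → (Donaldson.donaldsonMap ν G).PosDef) ∧
    -- convergence of the iterations to a fixed point
    (∀ G₀ : Matrix (Fin n) (Fin n) ℂ, G₀.PosDef →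
      ∃ G : Matrix (Fin n) (Fin n) ℂ, G.PosDef ∧ Donaldson.donaldsonMap ν G = G ∧
        Tendsto (fun r : ℕ => (Donaldson.donaldsonMap ν)^[r] G₀) atTop (𝓝 G)) ∧
    -- uniqueness of the fixed point up to scaling
    (∀ G G' : Matrix (Fin n) (Fin n) ℂ, G.PosDef → G'.PosDef →
      Donaldson.donaldsonMap ν G = G → Donaldson.donaldsonMap ν G' = G' →
        ∃ c : ℝ, 0 < c ∧ G' = c • G) ∧
    -- positive spectral gap
    (∀ (G : Matrix (Fin n) (Fin n) ℂ) (hG : G.PosDef), Donaldson.donaldsonMap ν G = G →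
      0 < Donaldson.spectralGap (Donaldson.quantumChannel ν G hG)) ∧
    -- invertibility
    ((∃ Z, Donaldson.IsComponent Z Y ∧ 0 < ν Z ∧
        ∀ S : Submodule ℂ (Fin n → ℂ), S ≠ ⊤ → ¬ Z ⊆ Donaldson.projSubspace S) →
      ∀ (G : Matrix (Fin n) (Fin n) ℂ) (hG : G.PosDef), Donaldson.donaldsonMap ν G = G →
        IsUnit (Donaldson.quantumChannel ν G hG)) := by
  obtain ⟨hstable, hunit⟩ := theorem4p4_general ν hν
  obtain ⟨hposDef, hconv, huniq, hgap⟩ := hstable hstab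
  exact ⟨hposDef, hconv, huniq, hgap, fun ⟨Z, hZ, hνZ, hspan⟩ G hG _ =>
    hunit Z hZ.1 (hac Z hZ) hνZ hspan G hG⟩
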